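/- Fix $0<\alpha<1$ and put $\beta=1/\alpha$. For a positive integer $n$, a restricted $\alpha$-partition of $n$ is a finite set $\{a_1<\dots<a_\ell\}$ of positive integers with $n=\lfloor a_1^\alpha\rfloor+\dots+\lfloor a_\ell^\alpha\rfloor$; let $\varpi_n$ be the number $\ell$ of summands of a uniformly random restricted $\alpha$-partition of $n$. For $k\ge 1$ let $g(k)=\lceil (k+1)^\beta\rceil-\lceil k^\beta\rceil$ be the number of integers $a\ge1$ with $\lfloor a^\alpha\rfloor=k$. For every $n\ge 1$ there is a unique $\eta=\eta_n>0$ with $$n=\sum_{k\ge1}\frac{k\,g(k)}{e^{\eta k}+1}.$$ Put $$\mu_n=\sum_{k\ge1}\frac{g(k)}{e^{\eta k}+1},\qquad \sigma_n^2=\sum_{k\ge1}\frac{g(k)e^{\eta k}}{(e^{\eta k}+1)^2}-\frac{\Bigl(\sum_{k\ge1}\frac{g(k)\,k\,e^{\eta k}}{(e^{\eta k}+1)^2}\Bigr)^2}{\sum_{k\ge1}\frac{g(k)\,k^2e^{\eta k}}{(e^{\eta k}+1)^2}}.$$ Then, as $n\to\infty$, $\mathbb E(\varpi_n)\sim\mu_n$,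 $\mathbb V(\varpi_n)\sim\sigma_n^2$, and $$\mathbb P\Bigl(\frac{\varpi_n-\mu_n}{\sigma_n}<x\Bigr)=\frac1{\sqrt{2\pi}}\int_{-\infty}^x e^{-t^2/2}\,dt+o(1)$$ uniformly in $x\in\mathbb R$. Moreover $\mu_n\sim c_1n^{1/(\alpha+1)}$ and $\sigma_n^2\sim c_2n^{1/(\alpha+1)}$, where, with $\mathrm{Li}_s(-1)=\sum_{m\ge1}(-1)^m/m^s$ and $A=-\beta\,\mathrm{Li}_{\beta+1}(-1)\Gamma(\beta+1)$, $$c_1=-\beta\,\mathrm{Li}_\beta(-1)\Gamma(\beta)\,A^{-\beta/(\beta+1)},\qquad c_2=\Bigl(-\beta\,\mathrm{Li}_{\beta-1}(-1)\Gamma(\beta)+\frac{(\beta\,\mathrm{Li}_\beta(-1)\Gamma(\beta+1))^2}{\beta\,\mathrm{Li}_{\beta+1}(-1)\Gamma(\beta+2)}\Bigr)A^{-\beta/(\beta+1)}.$$ Finally, with $T_n=n^{1/(6\alpha+6)}/\log n$, $$\mathbb P\Bigl(\frac{\varpi_n-\mu_n}{\sigma_n}\ge x\Bigr)\le\begin{cases}e^{-x^2/2}\bigl(1+\mathcal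 O((\log n)^{-3})\bigr)&\text{if }0\le x\le T_n,\\ e^{-T_nx/2}\bigl(1+\mathcal O((\log n)^{-3})\bigr)&\text{if }x\ge T_n,\end{cases}$$ as $n\to\infty$, where the implied constants depend only on $\alpha$ (in particular not on $x$), and the same bounds hold for $\mathbb P\bigl(\frac{\varpi_n-\mu_n}{\sigma_n}\le -x\bigr)$. -/

import Mathlib

open MeasureTheory ProbabilityTheory Filter Topology Asymptotics

namespace AlphaPartition

/-- The restricted `α`-partitions of `n`: finite sets `{a₁ < ⋯ < a_ℓ}` of positive integers
with `⌊a₁ ^ α⌋ + ⋯ + ⌊a_ℓ ^ α⌋ = n`. -/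
def partitions (α : ℝ) (n : ℕ) : Set (Finset ℕ) :=
  {S | (∀ a ∈ S, 1 ≤ a) ∧ ∑ a ∈ S, ⌊(a : ℝ) ^ α⌋₊ = n}

/-- The uniform probability measure on the restricted `α`-partitions of `n`. -/
noncomputable def unif (α : ℝ) (n : ℕ) : Measure (Finset ℕ) :=
  uniformOn (partitions α n)

/-- The number of summands of a partition, as a real random variable. -/
def numSummands (S : Finset ℕ) : ℝ := (S.card : ℝ)

/-- `g(k) = ⌈(k+1)^β⌉ - ⌈k^β⌉` with `β = 1/α`: the number of integers `a ≥ 1`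
with `⌊a ^ α⌋ = k` (for `k ≥ 1`). -/
noncomputable def g (α : ℝ) (k : ℕ) : ℝ :=
  (⌈((k : ℝ) + 1) ^ (1 / α)⌉ : ℝ) - (⌈(k : ℝ) ^ (1 / α)⌉ : ℝ)

/-- `η` is a positive solution of the saddle-point equation
`n = ∑_{k ≥ 1} k g(k) / (e^{η k} + 1)`. -/
def IsSaddlePoint (α : ℝ) (n : ℕ) (η : ℝ) : Prop :=
  0 < η ∧ HasSum (fun k : ℕ+ => (k : ℝ) * g α k / (Real.exp (η * k) + 1)) (n : ℝ)

/-- `∑_{k ≥ 1} g(k) / (e^{η k} + 1)`. -/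
noncomputable def mu (α η : ℝ) : ℝ :=
  ∑' k : ℕ+, g α k / (Real.exp (η * k) + 1)

/-- `∑_{k ≥ 1} g(k) k^j e^{η k} / (e^{η k} + 1)^2`. -/
noncomputable def momentSum (α η : ℝ) (j : ℕ) : ℝ :=
  ∑' k : ℕ+, g α k * (k : ℝ) ^ j * Real.exp (η * k) / (Real.exp (η * k) + 1) ^ 2

/-- The variance `σ²` as a function of the saddle point `η`. -/
noncomputable def sigmaSq (α η : ℝ) : ℝ :=
  momentSum α η 0 - momentSum α η 1 ^ 2 / momentSum α η 2

/-- The polylogarithm `Li_s(z) = ∑_{m ≥ 1} z^m / m^s` for real `s` and `z`, as the limit of the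
partial sums (the series converges only conditionally for `z = -1` and `0 < s ≤ 1`). -/
noncomputable def polylog (s z : ℝ) : ℝ :=
  limUnder atTop (fun N : ℕ => ∑ m ∈ Finset.range N, z ^ (m + 1) / ((m : ℝ) + 1) ^ s)

/-- `-β Li_{β+1}(-1) Γ(β+1)`. -/
noncomputable def constA (β : ℝ) : ℝ :=
  -β * polylog (β + 1) (-1) * Real.Gamma (β + 1)

/-- The constant in the asymptotics of the mean, in terms of `β = 1/α`. -/
noncomputable def c₁ (β : ℝ) : ℝ :=
  -β * polylog β (-1) * Real.Gamma β * constA β ^ (-(β / (β + 1)))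

/-- The constant in the asymptotics of the variance, in terms of `β = 1/α`. -/
noncomputable def c₂ (β : ℝ) : ℝ :=
  (-β * polylog (β - 1) (-1) * Real.Gamma β
    + (β * polylog β (-1) * Real.Gamma (β + 1)) ^ 2
      / (β * polylog (β + 1) (-1) * Real.Gamma (β + 2)))
    * constA β ^ (-(β / (β + 1)))

/-- The distribution function of the standard normal distribution. -/
noncomputable def Φ (x : ℝ) : ℝ :=
  1 / √(2 * Real.pi) * ∫ t in Set.Iic x, Real.exp (-t ^ 2 / 2)

/-! Sanity facts: the measure above is a probability measure, `g` counts what it should, and the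
series defining the polylogarithm converges at `z = -1`. -/

theorem floor_eq_iff {α : ℝ} (hα : 0 < α) {k : ℕ} (hk : 1 ≤ k) (a : ℕ) :
    ⌊(a : ℝ) ^ α⌋₊ = k ↔ ⌈(k : ℝ) ^ (1 / α)⌉₊ ≤ a ∧ a < ⌈((k : ℝ) + 1) ^ (1 / α)⌉₊ := by
  have ha : (0 : ℝ) ≤ a := a.cast_nonneg
  rw [Nat.floor_eq_iff' (by omega), Nat.ceil_le, Nat.lt_ceil, one_div,
    Real.rpow_inv_le_iff_of_pos (by positivity) ha hα,
    Real.lt_rpow_inv_iff_of_pos ha (by positivity) hα]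

theorem g_eq_ncard {α : ℝ} (hα : 0 < α) {k : ℕ} (hk : 1 ≤ k) :
    g α k = ({a : ℕ | 1 ≤ a ∧ ⌊(a : ℝ) ^ α⌋₊ = k}.ncard : ℝ) := by
  have h1 : (1 : ℝ) ≤ (k : ℝ) ^ (1 / α) :=
    Real.one_le_rpow (by exact_mod_cast hk) (by positivity)
  have hle : ⌈(k : ℝ) ^ (1 / α)⌉₊ ≤ ⌈((k : ℝ) + 1) ^ (1 / α)⌉₊ :=
    Nat.ceil_mono (Real.rpow_le_rpow (by positivity) (by linarith) (by positivity))
  have hset : {a : ℕ | 1 ≤ a ∧ ⌊(a : ℝ) ^ α⌋₊ = k}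
      = ((Finset.Ico ⌈(k : ℝ) ^ (1 / α)⌉₊ ⌈((k : ℝ) + 1) ^ (1 / α)⌉₊ : Finset ℕ) : Set ℕ) := by
    ext a
    simp only [Set.mem_ofPred_eq, Finset.coe_Ico, Set.mem_Ico, floor_eq_iff hα hk]
    refine ⟨fun h => h.2, fun h => ⟨?_, h⟩⟩
    exact le_trans (Nat.one_le_iff_ne_zero.2 (Nat.ceil_pos.2 (by linarith)).ne') h.1
  rw [hset, Set.ncard_coe_finset, Nat.card_Ico, Nat.cast_sub hle, g,
    ← natCast_ceil_eq_intCast_ceil (by positivity),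
    ← natCast_ceil_eq_intCast_ceil (by positivity)]

theorem partitions_finite {α : ℝ} (hα : 0 < α) (n : ℕ) : (partitions α n).Finite := by
  refine Set.Finite.subset
    (Finset.finite_toSet (Finset.range ⌈((n : ℝ) + 1) ^ (1 / α)⌉₊).powerset) ?_
  rintro S ⟨h1, hS⟩
  simp only [Finset.mem_coe, Finset.mem_powerset]
  intro a ha
  have hle : ⌊(a : ℝ) ^ α⌋₊ ≤ n :=
    hS ▸ Finset.single_le_sum (f := fun a : ℕ => ⌊(a : ℝ) ^ α⌋₊) (fun _ _ => Nat.zero_le _) ha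
  have hpos : 1 ≤ ⌊(a : ℝ) ^ α⌋₊ :=
    Nat.one_le_floor_iff _ |>.2 (Real.one_le_rpow (by exact_mod_cast h1 a ha) hα.le)
  have h := ((floor_eq_iff hα hpos a).1 rfl).2
  refine Finset.mem_range.2 (lt_of_lt_of_le h (Nat.ceil_mono ?_))
  exact Real.rpow_le_rpow (by positivity) (by gcongr) (by positivity)

theorem partitions_nonempty {α : ℝ} (hα : 0 < α) (hα1 : α ≤ 1) {n : ℕ} (hn : 1 ≤ n) :
    (partitions α n).Nonempty := by
  have h1 : (1 : ℝ) ≤ (n : ℝ) ^ (1 / α) :=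
    Real.one_le_rpow (by exact_mod_cast hn) (by positivity)
  have hβ : 1 ≤ 1 / α := by rw [le_div_iff₀ hα]; linarith
  have h2 : (n : ℝ) ^ (1 / α) + 1 ≤ ((n : ℝ) + 1) ^ (1 / α) := by
    have := Real.add_rpow_le_rpow_add (a := (n : ℝ)) (b := 1) (by positivity) zero_le_one hβ
    simpa using this
  have h3 : ⌊((⌈(n : ℝ) ^ (1 / α)⌉₊ : ℕ) : ℝ) ^ α⌋₊ = n := by
    rw [floor_eq_iff hα hn]
    refine ⟨le_rfl, Nat.lt_ceil.2 (lt_of_lt_of_le ?_ h2)⟩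
    exact Nat.ceil_lt_add_one (by positivity)
  refine ⟨{⌈(n : ℝ) ^ (1 / α)⌉₊}, ?_, ?_⟩
  · intro a ha
    rw [Finset.mem_singleton.1 ha]
    exact Nat.one_le_iff_ne_zero.2 (Nat.ceil_pos.2 (by linarith)).ne'
  · rw [Finset.sum_singleton, h3]

theorem isProbabilityMeasure_unif {α : ℝ} (hα : 0 < α) (hα1 : α ≤ 1) {n : ℕ} (hn : 1 ≤ n) :
    IsProbabilityMeasure (unif α n) :=
  isProbabilityMeasure_uniformOn (partitions_finite hα n) (partitions_nonempty hα hα1 hn)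

theorem tendsto_polylog_neg_one {s : ℝ} (hs : 0 < s) :
    Tendsto (fun N : ℕ => ∑ m ∈ Finset.range N, (-1 : ℝ) ^ (m + 1) / ((m : ℝ) + 1) ^ s) atTop
      (𝓝 (polylog s (-1))) := by
  have hanti : Antitone fun m : ℕ => ((m : ℝ) + 1) ^ (-s) := by
    intro a b hab
    have : (a : ℝ) ≤ b := by exact_mod_cast hab
    exact Real.rpow_le_rpow_of_nonpos (by positivity) (by linarith) (by linarith)
  have h0 : Tendsto (fun m : ℕ => ((m : ℝ) + 1) ^ (-s)) atTop (𝓝 0) :=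
    (tendsto_rpow_neg_atTop hs).comp
      (tendsto_atTop_add_const_right _ _ tendsto_natCast_atTop_atTop)
  obtain ⟨l, hl⟩ := hanti.tendsto_alternating_series_of_tendsto_zero h0
  refine tendsto_nhds_limUnder ⟨-l, ?_⟩
  convert hl.neg using 2 with N
  rw [← Finset.sum_neg_distrib]
  refine Finset.sum_congr rfl fun m _ => ?_
  rw [Real.rpow_neg (by positivity), pow_succ]
  ring

end AlphaPartition

/-!
Give every positive integer `a` an independent Bernoulli indicator with success probability
`sigmoid u_a`, where `u_a = -η ⌊a ^ α⌋ + s w_a` and the weight `w_a = 1 - c ⌊a ^ α⌋` is the residual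
of regressing the number of summands on the size: `c` is chosen so that the two are uncorrelated
at `s = 0`. Conditioned on having size `n`, this random set has the law of a restricted
`α`-partition of `n` tilted by `exp (s ϖ)`, so the moment generating function of `ϖ - μ_n` at `s`
is the exponential of a cumulant sum `∑ log (1 + exp u_a)`, recentred, times the ratio of the
probabilities that the tilted and the untilted random set have size `n`.

By the choice of `c` the tilt moves the mean size only to second order in `s`, so a local limit
theorem, by Fourier inversion, says that both probabilities are close to the value of a Gaussian
density near its centre, and the cumulant sum is `σ_n² s² / 2` up to a cubic error. Hence the
moment generating function of the normalised number of summands is `exp (t ^ 2 / 2)` up to an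
explicit factor, uniformly for `t` up to `T_n`. For fixed `t` Curtiss's theorem gives the central
limit theorem together with the first two moments, Pólya's theorem makes the convergence uniform,
and Chernoff's bound with `t = min x T_n` gives the tails. The constants are Riemann sum limits of
`∑ f (η ⌊a ^ α⌋)` as `η → 0`.
-/

namespace AlphaPartition

/-- The summand `⌊(a + 1) ^ α⌋` contributed by the positive integer `a + 1`; the shift makes the
index set of all possible summands the whole of `ℕ`. -/
noncomputable def part (α : ℝ) (a : ℕ) : ℕ := ⌊((a : ℝ) + 1) ^ α⌋₊

lemma one_le_part {α : ℝ} (hα : 0 ≤ α) (a : ℕ) : 1 ≤ part α a :=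
  Nat.one_le_floor_iff _ |>.2 (Real.one_le_rpow (by simp) hα)

lemma part_le (α : ℝ) (a : ℕ) : (part α a : ℝ) ≤ ((a : ℝ) + 1) ^ α :=
  Nat.floor_le (by positivity)

lemma rpow_lt_part_add_one (α : ℝ) (a : ℕ) : ((a : ℝ) + 1) ^ α < part α a + 1 :=
  Nat.lt_floor_add_one _

lemma part_pred (α : ℝ) {a : ℕ} (ha : 1 ≤ a) : part α (a - 1) = ⌊(a : ℝ) ^ α⌋₊ := by
  rw [part, Nat.cast_sub ha, Nat.cast_one, sub_add_cancel]

lemma card_part_fiber {α : ℝ} (hα : 0 < α) {k : ℕ} (hk : 1 ≤ k) :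
    (Nat.card {a | part α a = k} : ℝ) = g α k := by
  rw [g_eq_ncard hα hk, Nat.card_coe_set_eq,
    ← Set.ncard_image_of_injective _ (add_left_injective 1)]
  congr 2
  ext a
  constructor
  · rintro ⟨b, hb, rfl⟩
    exact ⟨by simp, by simpa [part] using hb⟩
  · rintro ⟨h1, h2⟩
    exact ⟨a - 1, (part_pred α h1).trans h2, Nat.sub_add_cancel h1⟩

lemma hasSum_g_mul {α : ℝ} (hα : 0 < α) {f : ℕ → ℝ} (hf : Summable fun a => f (part α a)) :
    HasSum (fun k : ℕ+ => g α k * f k) (∑' a, f (part α a)) := by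
  let size : ℕ → ℕ+ := fun a => ⟨part α a, one_le_part hα.le a⟩
  refine (hf.hasSum.tsum_fiberwise size).congr_fun fun k => ?_
  have hfiber : size ⁻¹' {k} = {a | part α a = k} := by
    ext a
    exact PNat.coe_inj.symm
  rw [hfiber, ← card_part_fiber hα k.pos, ← nsmul_eq_mul, ← tsum_const]
  exact tsum_congr fun a => congrArg f a.2.symm

lemma summable_exp_neg_mul_rpow {α c : ℝ} (hα : 0 < α) (hc : 0 < c) :
    Summable fun a : ℕ => Real.exp (-c * ((a : ℝ) + 1) ^ α) := by
  have hdecay := (isLittleO_exp_neg_mul_rpow_atTop hc (-(2 / α))).isBigO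
  have hα_atTop : Tendsto (fun a : ℕ => ((a : ℝ) + 1) ^ α) atTop atTop :=
    (tendsto_rpow_atTop hα).comp (tendsto_atTop_add_const_right _ _ tendsto_natCast_atTop_atTop)
  refine summable_of_isBigO_nat (g := fun a : ℕ => 1 / (((a : ℝ) + 1) ^ 2)) ?_ ?_
  · simpa using (summable_nat_add_iff 1).2 (Real.summable_one_div_nat_pow.2 one_lt_two)
  · refine (hdecay.comp_tendsto hα_atTop).congr_right fun a => ?_
    simp only [Function.comp]
    rw [← Real.rpow_mul (by positivity), mul_neg, mul_div_cancel₀ _ hα.ne',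
      Real.rpow_neg (by positivity), one_div]
    norm_num

lemma summable_exp_neg_mul_part {α c : ℝ} (hα : 0 < α) (hc : 0 < c) :
    Summable fun a : ℕ => Real.exp (-c * part α a) := by
  refine Summable.of_nonneg_of_le (fun _ => (Real.exp_pos _).le) (fun a => ?_)
    ((summable_exp_neg_mul_rpow hα hc).mul_left (Real.exp c))
  rw [← Real.exp_add, Real.exp_le_exp]
  nlinarith [rpow_lt_part_add_one α a]

lemma summable_comp_part {α η C c : ℝ} (hα : 0 < α) (hη : 0 < η) (hc : 0 < c) {h : ℝ → ℝ}
    (hb : ∀ x, 0 ≤ x → |h x| ≤ C * Real.exp (-c * x)) :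
    Summable fun a : ℕ => h (η * part α a) := by
  refine Summable.of_norm_bounded
    ((summable_exp_neg_mul_part hα (mul_pos hc hη)).mul_left C) fun a => ?_
  refine (hb _ (by positivity)).trans_eq ?_
  congr 2
  ring

lemma map_floor_volume :
    ((volume : Measure ℝ).restrict (Set.Ioi 0)).map (fun y : ℝ => ⌊y⌋₊) = Measure.count := by
  refine Measure.ext_of_singleton fun a => ?_
  rw [Measure.map_apply Nat.measurable_floor (measurableSet_singleton a),
    Measure.restrict_apply (Nat.measurable_floor (measurableSet_singleton a)),
    Measure.count_singleton]
  have hset : (fun y : ℝ => ⌊y⌋₊) ⁻¹' {a} ∩ Set.Ioi 0 = Set.Ico (a : ℝ) (a + 1) ∩ Set.Ioi 0 := by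
    ext y
    simp only [Set.mem_inter_iff, Set.mem_preimage, Set.mem_singleton_iff, Set.mem_Ioi, Set.mem_Ico]
    exact and_congr_left fun h => Nat.floor_eq_iff h.le
  rw [hset]
  refine le_antisymm ((measure_mono Set.inter_subset_left).trans (by simp)) ?_
  refine le_trans (by simp) (measure_mono (s := Set.Ioo (a : ℝ) (a + 1)) fun y hy => ?_)
  exact ⟨⟨hy.1.le, hy.2⟩, lt_of_le_of_lt (Nat.cast_nonneg a) hy.1⟩

lemma integral_comp_floor {f : ℕ → ℝ} (hf : Summable f) :
    ∫ y in Set.Ioi (0 : ℝ), f ⌊y⌋₊ = ∑' a, f a := by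
  rw [← integral_map (φ := fun y : ℝ => ⌊y⌋₊) Nat.measurable_floor.aemeasurable
    (measurable_of_countable f).aestronglyMeasurable, map_floor_volume,
    integral_countable (by rw [integrable_count_iff]; exact hf.norm)]
  simp

section RiemannSum

variable {α η y : ℝ}

lemma mul_rpow_eq_rpow_one_div_mul (hα : α ≠ 0) (hη : 0 ≤ η) (hy : 0 ≤ y) :
    η * y ^ α = (η ^ (1 / α) * y) ^ α := by
  rw [Real.mul_rpow (by positivity) hy, ← Real.rpow_mul hη, one_div_mul_cancel hα, Real.rpow_one]

lemma rpow_sub_le_mul_part (hα : 0 < α) (hη : 0 < η) (hy : 0 ≤ y) :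
    y ^ α - η ≤ η * part α ⌊(η ^ (1 / α))⁻¹ * y⌋₊ := by
  set z := (η ^ (1 / α))⁻¹ * y
  have hscale : η * z ^ α = y ^ α := by
    rw [mul_rpow_eq_rpow_one_div_mul hα.ne' hη.le (by positivity),
      mul_inv_cancel_left₀ (by positivity)]
  have hfloor : z ^ α ≤ ((⌊z⌋₊ : ℝ) + 1) ^ α :=
    Real.rpow_le_rpow (by positivity) (Nat.lt_floor_add_one z).le hα.le
  nlinarith [hfloor.trans (rpow_lt_part_add_one α ⌊z⌋₊).le]

lemma mul_part_le_rpow (hα : 0 < α) (hη : 0 < η) (hy : 0 ≤ y) :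
    η * part α ⌊(η ^ (1 / α))⁻¹ * y⌋₊ ≤ (y + η ^ (1 / α)) ^ α := by
  set z := (η ^ (1 / α))⁻¹ * y with hz
  have hz0 : 0 ≤ z := by positivity
  have hscale : η * (z + 1) ^ α = (y + η ^ (1 / α)) ^ α := by
    rw [mul_rpow_eq_rpow_one_div_mul hα.ne' hη.le (by positivity), mul_add, hz,
      mul_inv_cancel_left₀ (by positivity), mul_one]
  rw [← hscale]
  refine mul_le_mul_of_nonneg_left ((part_le α _).trans ?_) hη.le
  exact Real.rpow_le_rpow (by positivity) (by linarith [Nat.floor_le hz0]) hα.le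

lemma tendsto_mul_part (hα : 0 < α) (hy : 0 ≤ y) :
    Tendsto (fun η : ℝ => η * part α ⌊(η ^ (1 / α))⁻¹ * y⌋₊) (𝓝[>] 0) (𝓝 (y ^ α)) := by
  have hid : Tendsto (fun η : ℝ => η) (𝓝[>] 0) (𝓝 0) := nhdsWithin_le_nhds
  have hlower : Tendsto (fun η => y ^ α - η) (𝓝[>] 0) (𝓝 (y ^ α)) := by
    simpa using tendsto_const_nhds.sub hid
  have hupper : Tendsto (fun η : ℝ => (y + η ^ (1 / α)) ^ α) (𝓝[>] 0) (𝓝 (y ^ α)) := by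
    have hstep := hid.rpow_const (p := 1 / α) (Or.inr (by positivity))
    rw [Real.zero_rpow (by positivity)] at hstep
    simpa using (hstep.const_add y).rpow_const (p := α) (Or.inr hα.le)
  refine tendsto_of_tendsto_of_tendsto_of_le_of_le' hlower hupper ?_ ?_
  · filter_upwards [self_mem_nhdsWithin] with η hη using rpow_sub_le_mul_part hα hη hy
  · filter_upwards [self_mem_nhdsWithin] with η hη using mul_part_le_rpow hα hη hy

lemma rpow_mul_tsum_part_eq_integral {C c : ℝ} (hα : 0 < α) (hη : 0 < η) (hc : 0 < c) {h : ℝ → ℝ}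
    (hb : ∀ x, 0 ≤ x → |h x| ≤ C * Real.exp (-c * x)) :
    η ^ (1 / α) * ∑' a, h (η * part α a)
      = ∫ y in Set.Ioi (0 : ℝ), h (η * part α ⌊(η ^ (1 / α))⁻¹ * y⌋₊) := by
  have hstep : 0 < η ^ (1 / α) := by positivity
  rw [integral_comp_mul_left_Ioi (fun y => h (η * part α ⌊y⌋₊)) 0 (inv_pos.2 hstep), mul_zero,
    integral_comp_floor (f := fun a => h (η * part α a)) (summable_comp_part hα hη hc hb),
    inv_inv, smul_eq_mul]

/- With mesh `η ^ (1 / α)` the sum is a Riemann sum of `h (y ^ α)`. -/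
theorem tendsto_rpow_mul_tsum_part {C c : ℝ} (hα : 0 < α) (hc : 0 < c) {h : ℝ → ℝ}
    (hcont : Continuous h) (hb : ∀ x, 0 ≤ x → |h x| ≤ C * Real.exp (-c * x)) :
    Tendsto (fun η => η ^ (1 / α) * ∑' a, h (η * part α a)) (𝓝[>] 0)
      (𝓝 (∫ y in Set.Ioi (0 : ℝ), h (y ^ α))) := by
  have hC : 0 ≤ C := by simpa using (abs_nonneg _).trans (hb 0 le_rfl)
  have hev : ∀ᶠ η : ℝ in 𝓝[>] 0, 0 < η ∧ η ≤ 1 := Ioc_mem_nhdsGT zero_lt_one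
  refine Tendsto.congr' (f₁ := fun η =>
    ∫ y in Set.Ioi (0 : ℝ), h (η * part α ⌊(η ^ (1 / α))⁻¹ * y⌋₊)) ?_ ?_
  · filter_upwards [hev] with η hη using (rpow_mul_tsum_part_eq_integral hα hη.1 hc hb).symm
  refine tendsto_integral_filter_of_dominated_convergence
    (fun y => C * Real.exp c * Real.exp (-c * y ^ α)) ?_ ?_ ?_ ?_
  · filter_upwards with η
    exact ((measurable_of_countable fun a : ℕ => h (η * part α a)).comp
      (Nat.measurable_floor.comp (measurable_const_mul _))).aestronglyMeasurable
  · filter_upwards [hev] with η hη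
    filter_upwards [ae_restrict_mem measurableSet_Ioi] with y hy
    refine (hb _ (mul_nonneg hη.1.le (Nat.cast_nonneg _))).trans ?_
    rw [mul_assoc, ← Real.exp_add]
    gcongr
    nlinarith [rpow_sub_le_mul_part hα hη.1 (le_of_lt hy), hη.2]
  · simpa [IntegrableOn] using (integrableOn_rpow_mul_exp_neg_mul_rpow (p := α) (s := 0)
      (b := c) (by norm_num) hα hc).const_mul (C * Real.exp c)
  · filter_upwards [ae_restrict_mem measurableSet_Ioi] with y hy
    exact (hcont.tendsto _).comp (tendsto_mul_part hα (le_of_lt hy))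

end RiemannSum

section Logistic

/-- The density `e ^ x / (e ^ x + 1) ^ 2` of the logistic distribution. It is the derivative of
`Real.sigmoid` and the variance of a Bernoulli variable with parameter `Real.sigmoid x`. -/
noncomputable def logisticDensity (x : ℝ) : ℝ := Real.sigmoid x * Real.sigmoid (-x)

lemma sigmoid_neg_eq (x : ℝ) : Real.sigmoid (-x) = 1 / (Real.exp x + 1) := by
  rw [Real.sigmoid_def, neg_neg, add_comm, one_div]

lemma sigmoid_le_exp (x : ℝ) : Real.sigmoid x ≤ Real.exp x := by
  rw [Real.sigmoid_def, ← inv_inv (Real.exp x), ← Real.exp_neg]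
  gcongr
  linarith

lemma logisticDensity_pos (x : ℝ) : 0 < logisticDensity x :=
  mul_pos (Real.sigmoid_pos _) (Real.sigmoid_pos _)

lemma logisticDensity_neg (x : ℝ) : logisticDensity (-x) = logisticDensity x := by
  rw [logisticDensity, logisticDensity, neg_neg, mul_comm]

lemma logisticDensity_eq (x : ℝ) :
    logisticDensity x = Real.exp x / (Real.exp x + 1) ^ 2 := by
  rw [logisticDensity, ← Real.sigmoid_mul_rexp_neg, ← neg_neg x, sigmoid_neg_eq, neg_neg,
    Real.exp_neg]
  field_simp
  ring

lemma logisticDensity_le_exp (x : ℝ) : logisticDensity x ≤ Real.exp x :=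
  (mul_le_of_le_one_right (Real.sigmoid_nonneg x) (Real.sigmoid_le_one _)).trans (sigmoid_le_exp x)

lemma logisticDensity_le_exp_neg (x : ℝ) : logisticDensity x ≤ Real.exp (-x) :=
  logisticDensity_neg x ▸ logisticDensity_le_exp (-x)

lemma hasDerivAt_sigmoid_logisticDensity (x : ℝ) :
    HasDerivAt Real.sigmoid (logisticDensity x) x :=
  (Real.hasDerivAt_sigmoid x).congr_deriv (by rw [logisticDensity, Real.sigmoid_neg])

lemma hasDerivAt_sigmoid_neg (x : ℝ) :
    HasDerivAt (fun y => Real.sigmoid (-y)) (-logisticDensity x) x :=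
  ((hasDerivAt_sigmoid_logisticDensity (-x)).comp x (hasDerivAt_neg x)).congr_deriv
    (by rw [logisticDensity_neg, mul_neg_one])

lemma hasDerivAt_logisticDensity (x : ℝ) :
    HasDerivAt logisticDensity (logisticDensity x * (Real.sigmoid (-x) - Real.sigmoid x)) x :=
  ((hasDerivAt_sigmoid_logisticDensity x).mul (hasDerivAt_sigmoid_neg x)).congr_deriv (by ring)

@[fun_prop]
lemma continuous_logisticDensity : Continuous logisticDensity :=
  continuous_iff_continuousAt.2 fun x => (hasDerivAt_logisticDensity x).continuousAt

@[fun_prop]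
lemma continuous_sigmoid_neg : Continuous fun x => Real.sigmoid (-x) :=
  continuous_sigmoid.comp continuous_neg

lemma abs_sigmoid_neg_le (x : ℝ) : |Real.sigmoid (-x)| ≤ Real.exp (-x) :=
  (abs_of_pos (Real.sigmoid_pos _)).trans_le (sigmoid_le_exp _)

lemma abs_logisticDensity_le (x : ℝ) : |logisticDensity x| ≤ Real.exp (-x) :=
  (abs_of_pos (logisticDensity_pos _)).trans_le (logisticDensity_le_exp_neg x)

lemma abs_pow_mul_le (j : ℕ) {f : ℝ → ℝ} (hf : ∀ x, |f x| ≤ Real.exp (-x)) (x : ℝ) (hx : 0 ≤ x) :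
    |x ^ j * f x| ≤ j.factorial * 2 ^ j * Real.exp (-(1 / 2) * x) := by
  have hpow : x ^ j ≤ Real.exp (x / 2) * (2 ^ j * j.factorial) := by
    have h := Real.pow_div_factorial_le_exp (x := x / 2) (by positivity) j
    rwa [div_pow, div_div, div_le_iff₀ (by positivity)] at h
  calc |x ^ j * f x| = x ^ j * |f x| := by rw [abs_mul, abs_of_nonneg (by positivity)]
    _ ≤ Real.exp (x / 2) * (2 ^ j * j.factorial) * Real.exp (-x) := by
        gcongr
        exact hf x
    _ = j.factorial * 2 ^ j * (Real.exp (x / 2) * Real.exp (-x)) := by ring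
    _ = j.factorial * 2 ^ j * Real.exp (-(1 / 2) * x) := by
        rw [← Real.exp_add]
        congr 2
        ring

end Logistic

section FermiDirac

variable {s : ℝ}

lemma integrableOn_rpow_mul_of_le {C : ℝ} (hs : 0 < s) {f : ℝ → ℝ} (hf : Measurable f)
    (hb : ∀ x, 0 < x → |f x| ≤ C * Real.exp (-x)) :
    IntegrableOn (fun x : ℝ => x ^ (s - 1) * f x) (Set.Ioi 0) := by
  refine Integrable.mono' ((Real.GammaIntegral_convergent hs).const_mul C)
    ((Measurable.pow_const measurable_id _).mul hf).aestronglyMeasurable ?_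
  filter_upwards [ae_restrict_mem measurableSet_Ioi] with x (hx : 0 < x)
  rw [norm_mul, Real.norm_of_nonneg (by positivity), Real.norm_eq_abs]
  calc x ^ (s - 1) * |f x| ≤ x ^ (s - 1) * (C * Real.exp (-x)) := by
        gcongr
        exact hb x hx
    _ = C * (Real.exp (-x) * x ^ (s - 1)) := by ring

lemma sum_neg_one_pow_mul_exp (N : ℕ) (x : ℝ) :
    ∑ m ∈ Finset.range N, (-1 : ℝ) ^ m * Real.exp (-(((m : ℝ) + 1) * x))
      = Real.sigmoid (-x) * (1 - (-Real.exp (-x)) ^ N) := by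
  have hterm : ∀ m : ℕ, (-1 : ℝ) ^ m * Real.exp (-(((m : ℝ) + 1) * x))
      = Real.exp (-x) * (-Real.exp (-x)) ^ m := fun m => by
    rw [neg_pow (Real.exp (-x)), ← Real.exp_nat_mul, mul_left_comm, ← Real.exp_add]
    congr 2
    ring
  have hgeom := mul_neg_geom_sum (-Real.exp (-x)) N
  have hne : 1 + Real.exp (-x) ≠ 0 := by positivity
  rw [sub_neg_eq_add] at hgeom
  rw [Finset.sum_congr rfl fun m _ => hterm m, ← Finset.mul_sum, ← hgeom,
    ← Real.sigmoid_mul_rexp_neg, Real.sigmoid_def]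
  field_simp

lemma tendsto_integral_rpow_mul_sum_exp (hs : 0 < s) :
    Tendsto (fun N : ℕ => ∫ x in Set.Ioi (0 : ℝ), x ^ (s - 1) *
      ∑ m ∈ Finset.range N, (-1 : ℝ) ^ m * Real.exp (-(((m : ℝ) + 1) * x))) atTop
      (𝓝 (∫ x in Set.Ioi (0 : ℝ), x ^ (s - 1) * Real.sigmoid (-x))) := by
  refine tendsto_integral_of_dominated_convergence
    (fun x => 2 * (Real.exp (-x) * x ^ (s - 1))) (fun N => ?_)
    ((Real.GammaIntegral_convergent hs).const_mul 2) (fun N => ?_) ?_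
  · exact ((Measurable.pow_const measurable_id _).mul (by fun_prop)).aestronglyMeasurable
  · filter_upwards [ae_restrict_mem measurableSet_Ioi] with x (hx : 0 < x)
    have hremainder : |1 - (-Real.exp (-x)) ^ N| ≤ 2 := by
      refine (abs_sub _ _).trans ?_
      rw [abs_one, abs_pow, abs_neg, Real.abs_exp]
      linarith [pow_le_one₀ (n := N) (Real.exp_pos (-x)).le (Real.exp_le_one_iff.2 (by linarith))]
    rw [sum_neg_one_pow_mul_exp, norm_mul, Real.norm_of_nonneg (by positivity), Real.norm_eq_abs,
      abs_mul]
    calc x ^ (s - 1) * (|Real.sigmoid (-x)| * |1 - (-Real.exp (-x)) ^ N|)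
        ≤ x ^ (s - 1) * (Real.exp (-x) * 2) := by
          gcongr
          exact abs_sigmoid_neg_le x
      _ = 2 * (Real.exp (-x) * x ^ (s - 1)) := by ring
  · filter_upwards [ae_restrict_mem measurableSet_Ioi] with x (hx : 0 < x)
    have hpow : Tendsto (fun N : ℕ => (-Real.exp (-x)) ^ N) atTop (𝓝 0) := by
      refine tendsto_pow_atTop_nhds_zero_of_abs_lt_one ?_
      rw [abs_neg, Real.abs_exp, Real.exp_lt_one_iff]
      linarith
    simp only [sum_neg_one_pow_mul_exp]
    simpa using ((hpow.const_sub 1).const_mul (Real.sigmoid (-x))).const_mul (x ^ (s - 1))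

lemma integral_rpow_mul_sum_exp (hs : 0 < s) (N : ℕ) :
    ∫ x in Set.Ioi (0 : ℝ), x ^ (s - 1) *
      (∑ m ∈ Finset.range N, (-1 : ℝ) ^ m * Real.exp (-(((m : ℝ) + 1) * x)))
      = -(Real.Gamma s * ∑ m ∈ Finset.range N, (-1 : ℝ) ^ (m + 1) / ((m : ℝ) + 1) ^ s) := by
  have hint : ∀ m : ℕ, IntegrableOn
      (fun x : ℝ => x ^ (s - 1) * Real.exp (-(((m : ℝ) + 1) * x))) (Set.Ioi 0) := fun m => by
    refine integrableOn_rpow_mul_of_le (C := 1) hs (by fun_prop) fun x hx => ?_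
    rw [Real.abs_exp, one_mul, Real.exp_le_exp]
    nlinarith [mul_nonneg (Nat.cast_nonneg (α := ℝ) m) hx.le]
  simp only [Finset.mul_sum, mul_left_comm (_ ^ (s - 1)) ((-1 : ℝ) ^ _)]
  rw [integral_finsetSum _ fun m _ => (hint m).const_mul _, ← Finset.sum_neg_distrib]
  refine Finset.sum_congr rfl fun m _ => ?_
  rw [integral_const_mul, Real.integral_rpow_mul_exp_neg_mul_Ioi hs (by positivity),
    Real.div_rpow (by positivity) (by positivity), Real.one_rpow, pow_succ]
  ring

theorem integral_rpow_mul_sigmoid_neg (hs : 0 < s) :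
    ∫ x in Set.Ioi (0 : ℝ), x ^ (s - 1) * Real.sigmoid (-x)
      = -(Real.Gamma s * polylog s (-1)) := by
  refine tendsto_nhds_unique (tendsto_integral_rpow_mul_sum_exp hs) ?_
  simp only [integral_rpow_mul_sum_exp hs]
  exact ((tendsto_polylog_neg_one hs).const_mul _).neg

lemma tendsto_rpow_mul_sigmoid_neg_atTop (s : ℝ) :
    Tendsto (fun x : ℝ => x ^ s * Real.sigmoid (-x)) atTop (𝓝 0) := by
  have hexp := tendsto_rpow_mul_exp_neg_mul_atTop_nhds_zero s 1 one_pos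
  refine squeeze_zero' ?_ ?_ hexp
  · filter_upwards [eventually_ge_atTop 0] with x hx
    exact mul_nonneg (Real.rpow_nonneg hx s) (Real.sigmoid_nonneg _)
  · filter_upwards [eventually_ge_atTop 0] with x hx
    rw [neg_one_mul]
    gcongr
    exact sigmoid_le_exp _

theorem integral_rpow_mul_logisticDensity (hs : 0 < s) :
    ∫ x in Set.Ioi (0 : ℝ), x ^ s * logisticDensity x
      = -(Real.Gamma (s + 1) * polylog s (-1)) := by
  have hint_density : IntegrableOn (fun x : ℝ => x ^ s * logisticDensity x) (Set.Ioi 0) := by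
    simpa using integrableOn_rpow_mul_of_le (s := s + 1) (C := 1) (by linarith)
      continuous_logisticDensity.measurable fun x _ => by
        simpa using abs_logisticDensity_le x
  have hint_sigmoid : IntegrableOn (fun x : ℝ => x ^ (s - 1) * Real.sigmoid (-x)) (Set.Ioi 0) :=
    integrableOn_rpow_mul_of_le (C := 1) hs continuous_sigmoid_neg.measurable fun x _ => by
      simpa using abs_sigmoid_neg_le x
  have hzero : Tendsto (fun x : ℝ => x ^ s * Real.sigmoid (-x)) (𝓝[>] 0) (𝓝 0) := by
    have h := ((Real.continuous_rpow_const hs.le).mul continuous_sigmoid_neg).tendsto 0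
    rw [Pi.mul_apply, Real.zero_rpow hs.ne', zero_mul] at h
    exact h.mono_left nhdsWithin_le_nhds
  have hparts := integral_Ioi_mul_deriv_eq_deriv_mul (u := fun x : ℝ => x ^ s)
    (u' := fun x => s * x ^ (s - 1)) (fun x hx => Real.hasDerivAt_rpow_const (Or.inl (ne_of_gt hx)))
    (fun x _ => hasDerivAt_sigmoid_neg x)
    (hint_density.neg.congr (.of_forall fun x => by simp))
    ((hint_sigmoid.const_mul s).congr (.of_forall fun x => by simp [mul_assoc]))
    hzero (tendsto_rpow_mul_sigmoid_neg_atTop s)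
  simp only [mul_neg, integral_neg, sub_self, zero_sub, neg_inj, mul_assoc] at hparts
  rw [hparts, integral_const_mul, integral_rpow_mul_sigmoid_neg hs, Real.Gamma_add_one hs.ne']
  ring

end FermiDirac

section LimitConstants

variable {α : ℝ}

lemma integral_rpow_pow_mul_comp_rpow (hα : 0 < α) (j : ℕ) (f : ℝ → ℝ) :
    ∫ y in Set.Ioi (0 : ℝ), (y ^ α) ^ j * f (y ^ α)
      = 1 / α * ∫ x in Set.Ioi (0 : ℝ), x ^ (1 / α + j - 1) * f x := by
  rw [← integral_comp_rpow_Ioi_of_pos (g := fun y : ℝ => (y ^ α) ^ j * f (y ^ α))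
    (show 0 < 1 / α by positivity), ← integral_const_mul]
  refine setIntegral_congr_fun measurableSet_Ioi fun x (hx : 0 < x) => ?_
  simp only [smul_eq_mul]
  rw [← Real.rpow_mul hx.le, one_div_mul_cancel hα.ne', Real.rpow_one,
    add_sub_right_comm, Real.rpow_add_natCast hx.ne']
  ring

lemma integrableOn_comp_rpow {C c : ℝ} (hα : 0 < α) (hc : 0 < c) {f : ℝ → ℝ} (hf : Measurable f)
    (hb : ∀ x, 0 ≤ x → |f x| ≤ C * Real.exp (-c * x)) :
    IntegrableOn (fun y : ℝ => f (y ^ α)) (Set.Ioi 0) := by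
  refine Integrable.mono' ((integrableOn_rpow_mul_exp_neg_mul_rpow (p := α) (s := 0)
    (by norm_num) hα hc).const_mul C)
    (hf.comp (Measurable.pow_const measurable_id _)).aestronglyMeasurable ?_
  filter_upwards [ae_restrict_mem measurableSet_Ioi] with y (hy : 0 < y)
  rw [Real.rpow_zero, one_mul]
  exact hb _ (by positivity)

lemma setIntegral_Ioi_pos {f : ℝ → ℝ} {r : ℝ} (hr : 0 ≤ r) (hint : IntegrableOn f (Set.Ioi 0))
    (h0 : ∀ y, 0 < y → 0 ≤ f y) (hpos : ∀ y, r < y → 0 < f y) :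
    0 < ∫ y in Set.Ioi (0 : ℝ), f y := by
  rw [setIntegral_pos_iff_support_of_nonneg_ae
    ((ae_restrict_mem measurableSet_Ioi).mono h0) hint]
  exact lt_of_lt_of_le (b := volume (Set.Ioi r)) (by simp)
    (measure_mono fun y hy => ⟨(hpos y hy).ne', lt_of_le_of_lt hr hy⟩)

/-- The limit `∫ (y ^ α) ^ j e ^ (y ^ α) / (e ^ (y ^ α) + 1) ^ 2 dy` of the rescaled `momentSum`. -/
noncomputable def limMoment (α : ℝ) (j : ℕ) : ℝ :=
  ∫ y in Set.Ioi (0 : ℝ), (y ^ α) ^ j * logisticDensity (y ^ α)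

lemma limMoment_eq (hα : 0 < α) (hα1 : α < 1) (j : ℕ) :
    limMoment α j = -(1 / α * Real.Gamma (1 / α + j) * polylog (1 / α + j - 1) (-1)) := by
  have hβ : 1 < 1 / α := by rwa [lt_one_div one_pos hα, div_one]
  rw [limMoment, integral_rpow_pow_mul_comp_rpow hα,
    integral_rpow_mul_logisticDensity (by linarith [j.cast_nonneg (α := ℝ)]), sub_add_cancel]
  ring

lemma integral_sigmoid_neg_rpow (hα : 0 < α) :
    ∫ y in Set.Ioi (0 : ℝ), Real.sigmoid (-(y ^ α))
      = -(1 / α) * polylog (1 / α) (-1) * Real.Gamma (1 / α) := by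
  have h := integral_rpow_pow_mul_comp_rpow hα 0 fun x => Real.sigmoid (-x)
  simp only [pow_zero, one_mul, Nat.cast_zero, add_zero] at h
  rw [h, integral_rpow_mul_sigmoid_neg (by positivity)]
  ring

lemma integral_rpow_mul_sigmoid_neg_rpow (hα : 0 < α) :
    ∫ y in Set.Ioi (0 : ℝ), y ^ α * Real.sigmoid (-(y ^ α)) = constA (1 / α) := by
  have h := integral_rpow_pow_mul_comp_rpow hα 1 fun x => Real.sigmoid (-x)
  simp only [pow_one, Nat.cast_one] at h
  rw [h, integral_rpow_mul_sigmoid_neg (by positivity), constA]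
  ring

lemma integrableOn_limMoment (hα : 0 < α) (j : ℕ) :
    IntegrableOn (fun y : ℝ => (y ^ α) ^ j * logisticDensity (y ^ α)) (Set.Ioi 0) :=
  integrableOn_comp_rpow (f := fun x => x ^ j * logisticDensity x) hα one_half_pos
    (by fun_prop) (abs_pow_mul_le j abs_logisticDensity_le)

lemma limMoment_pos (hα : 0 < α) (j : ℕ) : 0 < limMoment α j := by
  have hpos : ∀ y : ℝ, 0 < y → 0 < (y ^ α) ^ j * logisticDensity (y ^ α) := fun y hy =>
    mul_pos (by positivity) (logisticDensity_pos _)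
  exact setIntegral_Ioi_pos le_rfl (integrableOn_limMoment hα j) (fun y hy => (hpos y hy).le) hpos

lemma limMoment_quadratic (hα : 0 < α) (t : ℝ) :
    limMoment α 0 - 2 * t * limMoment α 1 + t ^ 2 * limMoment α 2
      = ∫ y in Set.Ioi (0 : ℝ), (1 - t * y ^ α) ^ 2 * logisticDensity (y ^ α) := by
  have hint₀ := integrableOn_limMoment hα 0
  have hint₁ := (integrableOn_limMoment hα 1).const_mul (2 * t)
  have hint₂ := (integrableOn_limMoment hα 2).const_mul (t ^ 2)
  rw [limMoment, limMoment, limMoment, ← integral_const_mul, ← integral_const_mul,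
    ← integral_sub hint₀ hint₁, ← integral_add (by exact hint₀.sub hint₁) hint₂]
  congr with y
  ring

lemma limMoment_quadratic_pos (hα : 0 < α) {t : ℝ} (ht : 0 < t) :
    0 < limMoment α 0 - 2 * t * limMoment α 1 + t ^ 2 * limMoment α 2 := by
  rw [limMoment_quadratic hα]
  refine setIntegral_Ioi_pos (r := (1 / t) ^ α⁻¹) (by positivity) ?_
    (fun y _ => mul_nonneg (sq_nonneg _) (logisticDensity_pos _).le) fun y hy => ?_
  · refine (((integrableOn_limMoment hα 0).sub ((integrableOn_limMoment hα 1).const_mul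
      (2 * t))).add ((integrableOn_limMoment hα 2).const_mul (t ^ 2))).congr
      (.of_forall fun y => ?_)
    simp only [Pi.add_apply, Pi.sub_apply]
    ring
  · have hy0 : 0 ≤ y := (show (0 : ℝ) ≤ (1 / t) ^ α⁻¹ by positivity).trans hy.le
    rw [Real.rpow_inv_lt_iff_of_pos (by positivity) hy0 hα, div_lt_iff₀ ht] at hy
    exact mul_pos (sq_pos_of_neg (by linarith)) (logisticDensity_pos _)

/- The quadratic form `∫ (1 - t y ^ α) ^ 2 D(y ^ α) dy`, minimised over `t`. -/
lemma limMoment_variance_pos (hα : 0 < α) :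
    0 < limMoment α 0 - limMoment α 1 ^ 2 / limMoment α 2 := by
  have h₁ := limMoment_pos hα 1
  have h₂ := limMoment_pos hα 2
  convert limMoment_quadratic_pos hα (div_pos h₁ h₂) using 1
  field_simp
  ring

end LimitConstants

section CharacteristicFunction

variable {p : ℝ}

/-- The characteristic function at `x` of a Bernoulli variable with parameter `p`. -/
noncomputable def bernChar (p x : ℝ) : ℂ := 1 - p + p * Complex.exp (x * Complex.I)

@[fun_prop]
lemma continuous_bernChar (p : ℝ) : Continuous (bernChar p) := by
  unfold bernChar
  fun_prop

lemma sq_norm_bernChar (p x : ℝ) :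
    ‖bernChar p x‖ ^ 2 = 1 - 2 * (p * (1 - p) * (1 - Real.cos x)) := by
  have hre : (bernChar p x).re = 1 - p + p * Real.cos x := by
    simp [bernChar, Complex.exp_ofReal_mul_I_re]
  have him : (bernChar p x).im = p * Real.sin x := by
    simp [bernChar, Complex.exp_ofReal_mul_I_im]
  rw [← Complex.normSq_eq_norm_sq, Complex.normSq_apply, hre, him]
  linear_combination p ^ 2 * Real.sin_sq_add_cos_sq x

lemma norm_bernChar_le (p x : ℝ) :
    ‖bernChar p x‖ ≤ Real.exp (-(p * (1 - p) * (1 - Real.cos x))) := by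
  refine le_of_sq_le_sq ?_ (Real.exp_pos _).le
  rw [sq_norm_bernChar, ← Real.exp_nat_mul]
  refine le_trans (le_of_eq ?_) (Real.add_one_le_exp _)
  push_cast
  ring

lemma norm_bernChar_le_one (h0 : 0 ≤ p) (h1 : p ≤ 1) (x : ℝ) : ‖bernChar p x‖ ≤ 1 := by
  refine (norm_bernChar_le p x).trans (Real.exp_le_one_iff.2 (neg_nonpos.2 ?_))
  exact mul_nonneg (mul_nonneg h0 (sub_nonneg.2 h1)) (sub_nonneg.2 (Real.cos_le_one x))

lemma norm_exp_mul_I_sub_le (y : ℝ) :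
    ‖Complex.exp (y * Complex.I) - (1 + y * Complex.I - y ^ 2 / 2)‖ ≤ 4 * |y| ^ 3 := by
  have hnorm : ‖(y * Complex.I : ℂ)‖ = |y| := by simp
  rcases le_or_gt |y| 1 with hy | hy
  · have hbound := Complex.exp_bound (x := y * Complex.I) (by rwa [hnorm]) (n := 3) (by norm_num)
    have htaylor : ∑ m ∈ Finset.range 3, (y * Complex.I : ℂ) ^ m / m.factorial
        = 1 + y * Complex.I - y ^ 2 / 2 := by
      simp only [Finset.sum_range_succ, Finset.sum_range_zero, Nat.factorial]
      push_cast
      linear_combination ((y : ℂ) ^ 2 / 2) * Complex.I_sq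
    rw [hnorm, htaylor] at hbound
    refine hbound.trans ?_
    norm_num [Nat.factorial]
    nlinarith [pow_nonneg (abs_nonneg y) 3]
  · calc ‖Complex.exp (y * Complex.I) - (1 + y * Complex.I - y ^ 2 / 2)‖
        ≤ ‖Complex.exp (y * Complex.I)‖ + (‖(1 : ℂ)‖ + ‖(y * Complex.I : ℂ)‖
            + ‖(y : ℂ) ^ 2 / 2‖) := by
          refine (norm_sub_le _ _).trans ?_
          gcongr
          refine (norm_sub_le _ _).trans ?_
          gcongr
          exact norm_add_le _ _
      _ = 2 + |y| + |y| ^ 2 / 2 := by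
          rw [Complex.norm_exp_ofReal_mul_I, hnorm, norm_one]
          simp
          ring
      _ ≤ 4 * |y| ^ 3 := by
          nlinarith [mul_pos (sub_pos.2 hy) (sub_pos.2 hy), pow_pos (lt_trans one_pos hy) 2,
            mul_pos (sub_pos.2 hy) (pow_pos (lt_trans one_pos hy) 2)]

lemma abs_exp_neg_sub_le {u : ℝ} (hu : 0 ≤ u) :
    |Real.exp (-u) - (1 - u)| ≤ min u (u ^ 2) := by
  have hlower := Real.add_one_le_exp (-u)
  have hupper : Real.exp (-u) ≤ 1 := Real.exp_le_one_iff.2 (neg_nonpos.2 hu)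
  rw [abs_of_nonneg (by linarith), le_min_iff]
  refine ⟨by linarith, ?_⟩
  rcases le_or_gt u 1 with h | h
  · have := (abs_le.1 (Real.abs_exp_sub_one_sub_id_le (x := -u)
      (by rwa [abs_neg, abs_of_nonneg hu]))).2
    nlinarith
  · nlinarith

lemma abs_exp_neg_sq_sub_le {v : ℝ} (hv0 : 0 ≤ v) (hv1 : v ≤ 1) (x : ℝ) :
    |Real.exp (-(v * x ^ 2 / 2)) - (1 - v * x ^ 2 / 2)| ≤ v * |x| ^ 3 := by
  have hvx : 0 ≤ v * |x| ^ 3 := by positivity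
  refine (abs_exp_neg_sub_le (by positivity)).trans ?_
  rw [← sq_abs x]
  rcases le_or_gt |x| 1 with hx | hx
  · have hpow : |x| ^ 4 ≤ |x| ^ 3 := pow_le_pow_of_le_one (abs_nonneg _) hx (by norm_num)
    calc min (v * |x| ^ 2 / 2) ((v * |x| ^ 2 / 2) ^ 2) ≤ (v * |x| ^ 2 / 2) ^ 2 := min_le_right _ _
      _ = v * (v * |x| ^ 4) / 4 := by ring
      _ ≤ v * (1 * |x| ^ 3) / 4 := by gcongr
      _ ≤ v * |x| ^ 3 := by linarith
  · have hpow : v * |x| ^ 2 ≤ v * |x| ^ 3 := by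
      gcongr
      · exact hx.le
      · norm_num
    exact (min_le_left _ _).trans (by linarith [mul_nonneg hv0 (sq_nonneg |x|)])

lemma bernChar_mul_exp (p x : ℝ) :
    bernChar p x * Complex.exp ((-(p * x) : ℝ) * Complex.I)
      = (1 - p : ℝ) * Complex.exp ((-(p * x) : ℝ) * Complex.I)
        + p * Complex.exp (((1 - p) * x : ℝ) * Complex.I) := by
  have hexp : Complex.exp (x * Complex.I) * Complex.exp ((-(p * x) : ℝ) * Complex.I)
      = Complex.exp (((1 - p) * x : ℝ) * Complex.I) := by
    rw [← Complex.exp_add, ← add_mul, ← Complex.ofReal_add]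
    ring_nf
  rw [bernChar, add_mul, mul_assoc, hexp]
  push_cast
  rfl

/- Second order Taylor expansion of the centred characteristic function: the linear terms of the two
exponentials of `bernChar_mul_exp` cancel and the quadratic ones add up to the variance. -/
lemma norm_bernChar_mul_exp_sub_le (h0 : 0 ≤ p) (h1 : p ≤ 1) (x : ℝ) :
    ‖bernChar p x * Complex.exp ((-(p * x) : ℝ) * Complex.I)
      - (Real.exp (-(p * (1 - p) * x ^ 2 / 2)) : ℝ)‖ ≤ 5 * (p * (1 - p) * |x| ^ 3) := by
  obtain ⟨q, hq⟩ : ∃ q, 1 - p = q := ⟨_, rfl⟩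
  have hq0 : 0 ≤ q := by linarith
  have hpq : 0 ≤ p * q := mul_nonneg h0 hq0
  set R : ℝ → ℂ := fun y => Complex.exp (y * Complex.I) - (1 + y * Complex.I - y ^ 2 / 2) with hR
  have hsplit : bernChar p x * Complex.exp ((-(p * x) : ℝ) * Complex.I)
      - (Real.exp (-(p * q * x ^ 2 / 2)) : ℝ)
      = q * R (-(p * x)) + p * R (q * x)
        - (Real.exp (-(p * q * x ^ 2 / 2)) - (1 - p * q * x ^ 2 / 2) : ℝ) := by
    have hsum : (p : ℂ) + q = 1 := by exact_mod_cast (by linarith : p + q = 1)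
    rw [bernChar_mul_exp, hq]
    simp only [hR]
    push_cast
    linear_combination (1 - p * q * x ^ 2 / 2 : ℂ) * hsum
  have hR₁ : ‖R (-(p * x))‖ ≤ 4 * (p ^ 3 * |x| ^ 3) := by
    refine (norm_exp_mul_I_sub_le _).trans_eq ?_
    rw [abs_neg, abs_mul, abs_of_nonneg h0, mul_pow]
  have hR₂ : ‖R (q * x)‖ ≤ 4 * (q ^ 3 * |x| ^ 3) := by
    refine (norm_exp_mul_I_sub_le _).trans_eq ?_
    rw [abs_mul, abs_of_nonneg hq0, mul_pow]
  rw [hq, hsplit]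
  calc _ ≤ q * (4 * (p ^ 3 * |x| ^ 3)) + p * (4 * (q ^ 3 * |x| ^ 3)) + p * q * |x| ^ 3 := by
        refine (norm_sub_le _ _).trans (add_le_add ((norm_add_le _ _).trans ?_) ?_)
        · rw [norm_mul, norm_mul, Complex.norm_real, Complex.norm_real, Real.norm_of_nonneg h0,
            Real.norm_of_nonneg hq0]
          gcongr
        · rw [Complex.norm_real]
          exact abs_exp_neg_sq_sub_le hpq (by nlinarith) x
    _ = (4 * (p ^ 2 + q ^ 2) + 1) * (p * q * |x| ^ 3) := by ring
    _ ≤ 5 * (p * q * |x| ^ 3) := by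
        gcongr
        nlinarith

end CharacteristicFunction

section BernoulliProducts

variable {ι : Type*} {s : Finset ι}

lemma norm_prod_sub_prod_le {a b : ι → ℂ} (ha : ∀ i, ‖a i‖ ≤ 1) (hb : ∀ i, ‖b i‖ ≤ 1) :
    ‖∏ i ∈ s, a i - ∏ i ∈ s, b i‖ ≤ ∑ i ∈ s, ‖a i - b i‖ := by
  classical
  induction s using Finset.induction_on with
  | empty => simp
  | insert j s hj ih =>
    rw [Finset.prod_insert hj, Finset.prod_insert hj, Finset.sum_insert hj]
    have hprod : ‖∏ i ∈ s, b i‖ ≤ 1 := by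
      rw [norm_prod]
      exact Finset.prod_le_one (fun _ _ => norm_nonneg _) fun i _ => hb i
    calc ‖a j * ∏ i ∈ s, a i - b j * ∏ i ∈ s, b i‖
        = ‖a j * (∏ i ∈ s, a i - ∏ i ∈ s, b i) + (a j - b j) * ∏ i ∈ s, b i‖ := by
          congr 1
          ring
      _ ≤ ‖a j‖ * ‖∏ i ∈ s, a i - ∏ i ∈ s, b i‖ + ‖a j - b j‖ * ‖∏ i ∈ s, b i‖ := by
          rw [← norm_mul, ← norm_mul]
          exact norm_add_le _ _
      _ ≤ 1 * ‖∏ i ∈ s, a i - ∏ i ∈ s, b i‖ + ‖a j - b j‖ * 1 := by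
          gcongr
          exact ha j
      _ ≤ ‖a j - b j‖ + ∑ i ∈ s, ‖a i - b i‖ := by linarith

variable {p : ι → ℝ}

lemma norm_prod_bernChar_le (x : ι → ℝ) :
    ‖∏ i ∈ s, bernChar (p i) (x i)‖
      ≤ Real.exp (-∑ i ∈ s, p i * (1 - p i) * (1 - Real.cos (x i))) := by
  rw [norm_prod, ← Finset.sum_neg_distrib, Real.exp_sum]
  exact Finset.prod_le_prod (fun _ _ => norm_nonneg _) fun i _ => norm_bernChar_le _ _

lemma norm_prod_bernChar_mul_exp_sub_le (h0 : ∀ i, 0 ≤ p i) (h1 : ∀ i, p i ≤ 1) (x : ι → ℝ) :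
    ‖(∏ i ∈ s, bernChar (p i) (x i)) * Complex.exp ((-∑ i ∈ s, p i * x i : ℝ) * Complex.I)
      - (Real.exp (-(∑ i ∈ s, p i * (1 - p i) * x i ^ 2) / 2) : ℝ)‖
      ≤ 5 * ∑ i ∈ s, p i * (1 - p i) * |x i| ^ 3 := by
  have hphase : Complex.exp ((-∑ i ∈ s, p i * x i : ℝ) * Complex.I)
      = ∏ i ∈ s, Complex.exp ((-(p i * x i) : ℝ) * Complex.I) := by
    rw [← Complex.exp_sum, ← Finset.sum_mul, ← Complex.ofReal_sum, Finset.sum_neg_distrib]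
  have hgauss : Real.exp (-(∑ i ∈ s, p i * (1 - p i) * x i ^ 2) / 2)
      = ∏ i ∈ s, Real.exp (-(p i * (1 - p i) * x i ^ 2 / 2)) := by
    rw [← Real.exp_sum, Finset.sum_neg_distrib, ← Finset.sum_div, neg_div]
  rw [hphase, hgauss, Complex.ofReal_prod, ← Finset.prod_mul_distrib, Finset.mul_sum]
  refine (norm_prod_sub_prod_le (fun i => ?_) (fun i => ?_)).trans
    (Finset.sum_le_sum fun i _ => norm_bernChar_mul_exp_sub_le (h0 i) (h1 i) _)
  · rw [norm_mul, Complex.norm_exp_ofReal_mul_I, mul_one]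
    exact norm_bernChar_le_one (h0 i) (h1 i) _
  · have hvar : 0 ≤ p i * (1 - p i) := mul_nonneg (h0 i) (sub_nonneg.2 (h1 i))
    rw [Complex.norm_real, Real.norm_of_nonneg (Real.exp_pos _).le, Real.exp_le_one_iff,
      neg_nonpos]
    positivity

end BernoulliProducts

section FourierInversion

variable {ι : Type*} [DecidableEq ι]

/-- The probability that `∑ i ∈ s, k i * X i = n` for independent Bernoulli variables `X i` with
parameters `p i`. -/
noncomputable def bernMass (s : Finset ι) (p : ι → ℝ) (k : ι → ℕ) (n : ℕ) : ℝ :=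
  ∑ S ∈ s.powerset with ∑ i ∈ S, k i = n, (∏ i ∈ S, p i) * ∏ i ∈ s \ S, (1 - p i)

lemma integral_exp_int_mul (m : ℤ) :
    ∫ θ in (-Real.pi)..Real.pi, Complex.exp ((m * θ : ℝ) * Complex.I)
      = if m = 0 then 2 * (Real.pi : ℂ) else 0 := by
  split_ifs with h
  · simp [h, two_mul]
  · have hm : (m * Complex.I : ℂ) ≠ 0 := mul_ne_zero (by exact_mod_cast h) Complex.I_ne_zero
    have hcomm : ∀ θ : ℝ, ((m * θ : ℝ) * Complex.I : ℂ) = m * Complex.I * θ := fun θ => by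
      push_cast
      ring
    simp only [hcomm]
    rw [integral_exp_mul_complex hm, div_eq_zero_iff, sub_eq_zero,
      Complex.exp_eq_exp_iff_exists_int]
    refine Or.inl ⟨m, ?_⟩
    push_cast
    ring

lemma prod_bernChar_mul_exp_eq_sum (s : Finset ι) (p : ι → ℝ) (k : ι → ℕ) (n : ℕ) (θ : ℝ) :
    (∏ i ∈ s, bernChar (p i) (θ * k i)) * Complex.exp ((-(n * θ) : ℝ) * Complex.I)
      = ∑ S ∈ s.powerset, ((∏ i ∈ S, p i) * ∏ i ∈ s \ S, (1 - p i) : ℝ) *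
        Complex.exp ((((∑ i ∈ S, k i : ℕ) - n : ℤ) * θ : ℝ) * Complex.I) := by
  have hcomm : ∀ i, bernChar (p i) (θ * k i)
      = p i * Complex.exp ((θ * k i : ℝ) * Complex.I) + (1 - p i) := fun i => add_comm _ _
  simp only [hcomm, Finset.prod_add, Finset.sum_mul]
  refine Finset.sum_congr rfl fun S _ => ?_
  have hexp : (∏ i ∈ S, Complex.exp ((θ * k i : ℝ) * Complex.I))
      * Complex.exp ((-(n * θ) : ℝ) * Complex.I)
      = Complex.exp ((((∑ i ∈ S, k i : ℕ) - n : ℤ) * θ : ℝ) * Complex.I) := by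
    rw [← Complex.exp_sum, ← Complex.exp_add, ← Finset.sum_mul, ← Complex.ofReal_sum, ← add_mul,
      ← Complex.ofReal_add, ← Finset.mul_sum]
    push_cast
    ring_nf
  rw [Finset.prod_mul_distrib, ← hexp]
  push_cast
  ring

theorem two_pi_mul_bernMass (s : Finset ι) (p : ι → ℝ) (k : ι → ℕ) (n : ℕ) :
    (2 * Real.pi * bernMass s p k n : ℝ) = ∫ θ in (-Real.pi)..Real.pi,
      (∏ i ∈ s, bernChar (p i) (θ * k i)) * Complex.exp ((-(n * θ) : ℝ) * Complex.I) := by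
  simp only [prod_bernChar_mul_exp_eq_sum]
  rw [intervalIntegral.integral_finsetSum fun S _ =>
    Continuous.intervalIntegrable (by fun_prop) _ _]
  simp only [intervalIntegral.integral_const_mul, integral_exp_int_mul, sub_eq_zero,
    Nat.cast_inj, mul_ite, mul_zero]
  rw [bernMass, Finset.sum_filter, Finset.mul_sum, Complex.ofReal_sum]
  refine Finset.sum_congr rfl fun S _ => ?_
  split_ifs <;> push_cast <;> ring

end FourierInversion

section LocalLimit

lemma integral_gaussian_mul_exp {B : ℝ} (hB : 0 < B) (t : ℝ) :
    ∫ θ : ℝ, (Real.exp (-(B * θ ^ 2) / 2) : ℝ) * Complex.exp ((-(t * θ) : ℝ) * Complex.I)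
      = (√(2 * Real.pi / B) * Real.exp (-t ^ 2 / (2 * B)) : ℝ) := by
  have hfourier :=
    fourierIntegral_gaussian (b := (B / 2 : ℝ)) (by simpa using half_pos hB) (-t : ℂ)
  have hcomm : ∀ θ : ℝ, (Real.exp (-(B * θ ^ 2) / 2) : ℝ) *
      Complex.exp ((-(t * θ) : ℝ) * Complex.I)
      = Complex.exp (Complex.I * -t * θ) * Complex.exp (-(B / 2 : ℝ) * θ ^ 2) := fun θ => by
    rw [mul_comm, Complex.ofReal_exp]
    push_cast
    ring_nf
  simp only [hcomm]
  rw [hfourier, Real.sqrt_eq_rpow, Complex.ofReal_mul, Complex.ofReal_cpow (by positivity),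
    Complex.ofReal_exp]
  push_cast
  congr 2
  · field_simp
  · field_simp
    ring

variable {f γ : ℝ → ℂ} {θ₀ K E B : ℝ}

lemma norm_indicator_sub_le (hθ : 0 ≤ θ₀) (hθπ : θ₀ < Real.pi) (hK : 0 ≤ K) (hE : 0 ≤ E)
    (hB : 0 ≤ B) (hγ : ∀ θ, ‖γ θ‖ ≤ Real.exp (-(B / 2) * θ ^ 2))
    (hmajor : ∀ θ, ‖f θ - γ θ‖ ≤ K * |θ| ^ 3)
    (hminor : ∀ θ, θ₀ ≤ |θ| → |θ| ≤ Real.pi → ‖f θ‖ ≤ E) (θ : ℝ) :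
    ‖(Set.Ioc (-Real.pi) Real.pi).indicator f θ - γ θ‖ ≤
      (Set.Icc (-θ₀) θ₀).indicator (fun _ => K * θ₀ ^ 3) θ
      + (Set.Ioc (-Real.pi) Real.pi).indicator (fun _ => E) θ
      + Real.exp (-(θ₀ ^ 2 * B / 4)) * Real.exp (-(B / 4) * θ ^ 2) := by
  by_cases hmem : θ ∈ Set.Icc (-θ₀) θ₀
  · have hπ : θ ∈ Set.Ioc (-Real.pi) Real.pi := ⟨by linarith [hmem.1], by linarith [hmem.2]⟩
    have hpow : K * |θ| ^ 3 ≤ K * θ₀ ^ 3 := by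
      gcongr
      exact abs_le.2 hmem
    rw [Set.indicator_of_mem hmem, Set.indicator_of_mem hπ, Set.indicator_of_mem hπ, add_assoc]
    exact (hmajor θ).trans (hpow.trans (le_add_of_nonneg_right (by positivity)))
  · have hθ' : θ₀ ≤ |θ| := (not_le.1 fun h => hmem (abs_le.1 h)).le
    have htail : ‖γ θ‖ ≤ Real.exp (-(θ₀ ^ 2 * B / 4)) * Real.exp (-(B / 4) * θ ^ 2) := by
      have hsq : B * θ₀ ^ 2 ≤ B * θ ^ 2 := by
        rw [← sq_abs θ]
        gcongr
      rw [← Real.exp_add]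
      exact (hγ θ).trans (Real.exp_le_exp.2 (by linarith))
    rw [Set.indicator_of_notMem hmem, zero_add]
    by_cases hπ : θ ∈ Set.Ioc (-Real.pi) Real.pi
    · rw [Set.indicator_of_mem hπ, Set.indicator_of_mem hπ]
      exact (norm_sub_le _ _).trans
        (add_le_add (hminor θ hθ' (abs_le.2 ⟨hπ.1.le, hπ.2⟩)) htail)
    · rwa [Set.indicator_of_notMem hπ, Set.indicator_of_notMem hπ, zero_sub, norm_neg, zero_add]

lemma norm_intervalIntegral_sub_integral_le (hf : Continuous f) (hγc : Continuous γ)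
    (hθ : 0 ≤ θ₀) (hθπ : θ₀ < Real.pi) (hK : 0 ≤ K) (hE : 0 ≤ E) (hB : 0 < B)
    (hγ : ∀ θ, ‖γ θ‖ ≤ Real.exp (-(B / 2) * θ ^ 2))
    (hmajor : ∀ θ, ‖f θ - γ θ‖ ≤ K * |θ| ^ 3)
    (hminor : ∀ θ, θ₀ ≤ |θ| → |θ| ≤ Real.pi → ‖f θ‖ ≤ E) :
    ‖(∫ θ in (-Real.pi)..Real.pi, f θ) - ∫ θ, γ θ‖
      ≤ 2 * K * θ₀ ^ 4 + 2 * Real.pi * E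
        + Real.exp (-(θ₀ ^ 2 * B / 4)) * √(4 * Real.pi / B) := by
  have hγi : Integrable γ :=
    (integrable_exp_neg_mul_sq (half_pos hB)).mono' hγc.aestronglyMeasurable (.of_forall hγ)
  have hfi : Integrable ((Set.Ioc (-Real.pi) Real.pi).indicator f) :=
    ((hf.integrableOn_Icc).mono_set Set.Ioc_subset_Icc_self).integrable_indicator
      measurableSet_Ioc
  have hmajor_int : Integrable ((Set.Icc (-θ₀) θ₀).indicator fun _ => K * θ₀ ^ 3) :=
    (integrableOn_const (by simp)).integrable_indicator measurableSet_Icc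
  have hminor_int : Integrable ((Set.Ioc (-Real.pi) Real.pi).indicator fun _ => E) :=
    (integrableOn_const (by simp)).integrable_indicator measurableSet_Ioc
  have htail_int : Integrable fun θ : ℝ =>
      Real.exp (-(θ₀ ^ 2 * B / 4)) * Real.exp (-(B / 4) * θ ^ 2) :=
    (integrable_exp_neg_mul_sq (show 0 < B / 4 by positivity)).const_mul _
  rw [intervalIntegral.integral_of_le (by linarith [Real.pi_pos]),
    ← integral_indicator measurableSet_Ioc, ← integral_sub hfi hγi]
  refine (norm_integral_le_of_norm_le ((hmajor_int.add hminor_int).add htail_int)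
    (.of_forall (norm_indicator_sub_le hθ hθπ hK hE hB.le hγ hmajor hminor))).trans_eq ?_
  simp only [Pi.add_apply]
  rw [integral_add (by exact hmajor_int.add hminor_int) htail_int,
    integral_add hmajor_int hminor_int,
    integral_indicator measurableSet_Icc, integral_indicator measurableSet_Ioc,
    integral_const_mul (Real.exp (-(θ₀ ^ 2 * B / 4))), integral_gaussian]
  simp only [setIntegral_const, smul_eq_mul, Real.volume_real_Icc, Real.volume_real_Ioc]
  rw [max_eq_left (by linarith), max_eq_left (by linarith [Real.pi_pos]),
    show Real.pi / (B / 4) = 4 * Real.pi / B by field_simp]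
  ring

variable {ι : Type*} {s : Finset ι} {p : ι → ℝ} {k : ι → ℕ} {m : ℝ}

lemma norm_prod_bernChar_mul_exp_sub_gaussian_le (n : ℕ) (h0 : ∀ i, 0 ≤ p i) (h1 : ∀ i, p i ≤ 1)
    (hm : ∑ i ∈ s, p i * k i = m) (hB : ∑ i ∈ s, p i * (1 - p i) * k i ^ 2 = B) (θ : ℝ) :
    ‖(∏ i ∈ s, bernChar (p i) (θ * k i)) * Complex.exp ((-(n * θ) : ℝ) * Complex.I)
        - (Real.exp (-(B * θ ^ 2) / 2) : ℝ) * Complex.exp ((-((n - m) * θ) : ℝ) * Complex.I)‖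
      ≤ 5 * (∑ i ∈ s, p i * (1 - p i) * k i ^ 3) * |θ| ^ 3 := by
  have hmean : ∑ i ∈ s, p i * (θ * k i) = m * θ := by
    rw [← hm, Finset.sum_mul]
    exact Finset.sum_congr rfl fun i _ => by ring
  have hvar : ∑ i ∈ s, p i * (1 - p i) * (θ * k i) ^ 2 = B * θ ^ 2 := by
    rw [← hB, Finset.sum_mul]
    exact Finset.sum_congr rfl fun i _ => by ring
  have hthird : 5 * ∑ i ∈ s, p i * (1 - p i) * |θ * k i| ^ 3
      = 5 * (∑ i ∈ s, p i * (1 - p i) * k i ^ 3) * |θ| ^ 3 := by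
    rw [mul_assoc, Finset.sum_mul]
    congr 1
    refine Finset.sum_congr rfl fun i _ => ?_
    rw [abs_mul, mul_pow, Nat.abs_cast]
    ring
  have hphase : Complex.exp ((-(n * θ) : ℝ) * Complex.I)
      = Complex.exp ((-(m * θ) : ℝ) * Complex.I)
        * Complex.exp ((-((n - m) * θ) : ℝ) * Complex.I) := by
    rw [← Complex.exp_add, ← add_mul, ← Complex.ofReal_add]
    ring_nf
  have h := norm_prod_bernChar_mul_exp_sub_le (s := s) h0 h1 fun i => θ * k i
  rw [hmean, hvar, hthird] at h
  rwa [hphase, ← mul_assoc, ← sub_mul, norm_mul, Complex.norm_exp_ofReal_mul_I, mul_one]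

theorem abs_bernMass_sub_le [DecidableEq ι] (n : ℕ) (h0 : ∀ i, 0 ≤ p i) (h1 : ∀ i, p i ≤ 1)
    {D : ℝ} (hθ : 0 ≤ θ₀) (hθπ : θ₀ < Real.pi) (hm : ∑ i ∈ s, p i * k i = m)
    (hB : ∑ i ∈ s, p i * (1 - p i) * k i ^ 2 = B) (hB0 : 0 < B)
    (hD : ∀ θ : ℝ, θ₀ ≤ |θ| → |θ| ≤ Real.pi →
      D ≤ ∑ i ∈ s, p i * (1 - p i) * (1 - Real.cos (θ * k i))) :
    |2 * Real.pi * bernMass s p k n - √(2 * Real.pi / B) * Real.exp (-(n - m) ^ 2 / (2 * B))|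
      ≤ 10 * (∑ i ∈ s, p i * (1 - p i) * k i ^ 3) * θ₀ ^ 4 + 2 * Real.pi * Real.exp (-D)
        + Real.exp (-(θ₀ ^ 2 * B / 4)) * √(4 * Real.pi / B) := by
  have hL : 0 ≤ ∑ i ∈ s, p i * (1 - p i) * k i ^ 3 := Finset.sum_nonneg fun i _ =>
    mul_nonneg (mul_nonneg (h0 i) (sub_nonneg.2 (h1 i))) (by positivity)
  rw [← Real.norm_eq_abs, ← Complex.norm_real, Complex.ofReal_sub, two_pi_mul_bernMass,
    ← integral_gaussian_mul_exp hB0]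
  refine (norm_intervalIntegral_sub_integral_le (E := Real.exp (-D)) (by fun_prop)
    (by fun_prop) hθ hθπ (mul_nonneg (by norm_num) hL) (Real.exp_pos _).le hB0 (fun θ => ?_)
    (norm_prod_bernChar_mul_exp_sub_gaussian_le n h0 h1 hm hB)
    fun θ h h' => ?_).trans_eq (by ring)
  · rw [norm_mul, Complex.norm_exp_ofReal_mul_I, mul_one, Complex.norm_real,
      Real.norm_of_nonneg (Real.exp_pos _).le]
    exact (congr_arg Real.exp (by ring)).le
  · rw [norm_mul, Complex.norm_exp_ofReal_mul_I, mul_one]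
    exact (norm_prod_bernChar_le _).trans (Real.exp_le_exp.2 (neg_le_neg (hD θ h h')))

end LocalLimit

section CosineSums

variable {K : ℕ} {θ : ℝ}

lemma card_Ioc_two_mul (K : ℕ) : (Finset.Ioc K (2 * K)).card = K := by
  rw [Nat.card_Ioc, two_mul, Nat.add_sub_cancel]

lemma sum_cos_Ioc_mul_sin (K M : ℕ) (θ : ℝ) :
    (∑ k ∈ Finset.Ioc K (K + M), Real.cos (θ * k)) * (2 * Real.sin (θ / 2))
      = Real.sin ((K + M + 1 / 2) * θ) - Real.sin ((K + 1 / 2) * θ) := by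
  induction M with
  | zero => simp
  | succ M ih =>
    rw [← add_assoc, Finset.sum_Ioc_succ_top (by omega), add_mul, ih]
    have hnext : ((K : ℝ) + (M + 1 : ℕ) + 1 / 2) * θ = θ * (K + M + 1 : ℕ) + θ / 2 := by
      push_cast
      ring
    have hprev : ((K : ℝ) + M + 1 / 2) * θ = θ * (K + M + 1 : ℕ) - θ / 2 := by
      push_cast
      ring
    rw [hnext, hprev, Real.sin_add, Real.sin_sub]
    ring

lemma sum_cos_Ioc_le (K M : ℕ) (h0 : 0 < θ) (hπ : θ ≤ Real.pi) :
    ∑ k ∈ Finset.Ioc K (K + M), Real.cos (θ * k) ≤ Real.pi / θ := by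
  have hsin : θ / Real.pi ≤ Real.sin (θ / 2) :=
    (Real.mul_le_sin (by linarith) (by linarith)).trans_eq' (by ring)
  have hpos : 0 < Real.sin (θ / 2) := (div_pos h0 Real.pi_pos).trans_le hsin
  have hsum : (∑ k ∈ Finset.Ioc K (K + M), Real.cos (θ * k)) * Real.sin (θ / 2) ≤ 1 := by
    linarith [sum_cos_Ioc_mul_sin K M θ, Real.sin_le_one (((K : ℝ) + M + 1 / 2) * θ),
      Real.neg_one_le_sin (((K : ℝ) + 1 / 2) * θ)]
  calc ∑ k ∈ Finset.Ioc K (K + M), Real.cos (θ * k) ≤ 1 / Real.sin (θ / 2) :=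
        (le_div_iff₀ hpos).2 hsum
    _ ≤ 1 / (θ / Real.pi) := one_div_le_one_div_of_le (div_pos h0 Real.pi_pos) hsin
    _ = Real.pi / θ := one_div_div _ _

lemma le_sum_one_sub_cos_of_small (h : |θ| * (2 * K) ≤ Real.pi) :
    2 / Real.pi ^ 2 * K ^ 3 * θ ^ 2 ≤ ∑ k ∈ Finset.Ioc K (2 * K), (1 - Real.cos (θ * k)) := by
  have hterm : ∀ k ∈ Finset.Ioc K (2 * K),
      2 / Real.pi ^ 2 * K ^ 2 * θ ^ 2 ≤ 1 - Real.cos (θ * k) := by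
    intro k hk
    rw [Finset.mem_Ioc] at hk
    have hKk : (K : ℝ) ≤ k := by exact_mod_cast hk.1.le
    have hk2 : (k : ℝ) ≤ 2 * K := by exact_mod_cast hk.2
    have hcos := Real.cos_le_one_sub_mul_cos_sq (x := θ * k) (by
      rw [abs_mul, Nat.abs_cast]
      exact (mul_le_mul_of_nonneg_left hk2 (abs_nonneg _)).trans h)
    have hsq : 2 / Real.pi ^ 2 * K ^ 2 * θ ^ 2 ≤ 2 / Real.pi ^ 2 * (θ * k) ^ 2 := by
      rw [mul_pow, mul_assoc, mul_comm (θ ^ 2)]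
      gcongr
    linarith
  calc 2 / Real.pi ^ 2 * K ^ 3 * θ ^ 2
      = ∑ k ∈ Finset.Ioc K (2 * K), 2 / Real.pi ^ 2 * K ^ 2 * θ ^ 2 := by
        rw [Finset.sum_const, nsmul_eq_mul, card_Ioc_two_mul]
        ring
    _ ≤ ∑ k ∈ Finset.Ioc K (2 * K), (1 - Real.cos (θ * k)) := Finset.sum_le_sum hterm

lemma le_sum_one_sub_cos_of_large (h : 2 * Real.pi ≤ |θ| * K) (hπ : |θ| ≤ Real.pi) :
    (K : ℝ) / 2 ≤ ∑ k ∈ Finset.Ioc K (2 * K), (1 - Real.cos (θ * k)) := by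
  have h0 : 0 < |θ| :=
    pos_of_mul_pos_left (lt_of_lt_of_le Real.two_pi_pos h) K.cast_nonneg
  have heven : ∀ k : ℕ, Real.cos (θ * k) = Real.cos (|θ| * k) := fun k => by
    rw [← Real.cos_abs, abs_mul, Nat.abs_cast]
  have hsum : ∑ k ∈ Finset.Ioc K (2 * K), Real.cos (|θ| * k) ≤ Real.pi / |θ| := by
    rw [two_mul]
    exact sum_cos_Ioc_le K K h0 hπ
  have hhalf : Real.pi / |θ| ≤ K / 2 := by
    rw [div_le_div_iff₀ h0 two_pos]
    linarith
  simp only [heven]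
  rw [Finset.sum_sub_distrib, Finset.sum_const, nsmul_eq_mul, card_Ioc_two_mul, mul_one]
  linarith

end CosineSums

section Taylor

/-- The softplus function `log (1 + e ^ x)`: the logarithm of the normalising factor of a Bernoulli
variable with parameter `Real.sigmoid x`. -/
noncomputable def softplus (x : ℝ) : ℝ := Real.log (1 + Real.exp x)

lemma softplus_nonneg (x : ℝ) : 0 ≤ softplus x :=
  Real.log_nonneg (by linarith [Real.exp_pos x])

lemma softplus_le_exp (x : ℝ) : softplus x ≤ Real.exp x := by
  have := Real.log_le_sub_one_of_pos (show 0 < 1 + Real.exp x by positivity)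
  unfold softplus
  linarith

lemma exp_softplus (x : ℝ) : Real.exp (softplus x) = 1 + Real.exp x :=
  Real.exp_log (by positivity)

lemma hasDerivAt_softplus (x : ℝ) : HasDerivAt softplus (Real.sigmoid x) x := by
  refine (((Real.hasDerivAt_exp x).const_add 1).log (by positivity)).congr_deriv ?_
  rw [Real.sigmoid_def, Real.exp_neg]
  field_simp
  ring

lemma exp_neg_abs_le_logisticDensity (x : ℝ) : Real.exp (-|x|) / 4 ≤ logisticDensity x := by
  wlog hx : 0 ≤ x
  · simpa [logisticDensity_neg] using this (-x) (by linarith)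
  have hexp : 1 ≤ Real.exp x := Real.one_le_exp hx
  rw [abs_of_nonneg hx, logisticDensity_eq, Real.exp_neg,
    div_le_div_iff₀ (by norm_num) (by positivity), inv_mul_le_iff₀ (by positivity)]
  nlinarith

lemma abs_logisticDensity_deriv_le (x : ℝ) :
    |logisticDensity x * (Real.sigmoid (-x) - Real.sigmoid x)| ≤ logisticDensity x := by
  rw [abs_mul, abs_of_pos (logisticDensity_pos x)]
  refine mul_le_of_le_one_right (logisticDensity_pos x).le (abs_le.2 ⟨?_, ?_⟩) <;>
    linarith [Real.sigmoid_nonneg x, Real.sigmoid_nonneg (-x), Real.sigmoid_le_one x,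
      Real.sigmoid_le_one (-x)]

lemma abs_sub_le_of_hasDerivAt {f f' : ℝ → ℝ} {M d : ℝ} (hf : ∀ t, HasDerivAt f (f' t) t)
    (hM : ∀ t, |t| ≤ |d| → |f' t| ≤ M) : |f d - f 0| ≤ M * |d| := by
  simpa using Convex.norm_image_sub_le_of_norm_hasDerivWithin_le (f := f) (f' := f')
    (s := Set.Icc (-|d|) |d|) (C := M) (x := 0) (y := d) (fun t _ => (hf t).hasDerivWithinAt)
    (fun t ht => hM t (abs_le.2 ht)) (convex_Icc _ _) ⟨by simp, by simp⟩ (abs_le.1 le_rfl)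

variable {x d M : ℝ} (hM : ∀ t, |t| ≤ |d| → logisticDensity (x + t) ≤ M)
include hM

lemma abs_logisticDensity_add_sub_le :
    |logisticDensity (x + d) - logisticDensity x| ≤ M * |d| := by
  simpa using abs_sub_le_of_hasDerivAt (f := fun t => logisticDensity (x + t))
    (fun t => (hasDerivAt_logisticDensity (x + t)).comp_const_add x t)
    fun t ht => (abs_logisticDensity_deriv_le _).trans (hM t ht)

lemma abs_sigmoid_add_sub_le :
    |Real.sigmoid (x + d) - Real.sigmoid x - d * logisticDensity x| ≤ M * |d| ^ 2 := by
  have hM0 : 0 ≤ M := (logisticDensity_pos _).le.trans (hM 0 (by simp))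
  have h := abs_sub_le_of_hasDerivAt
    (f := fun t => Real.sigmoid (x + t) - t * logisticDensity x) (d := d) (M := M * |d|)
    (fun t => ((hasDerivAt_sigmoid_logisticDensity (x + t)).comp_const_add x t).sub
      ((hasDerivAt_id t).mul_const (logisticDensity x))) fun t ht => by
      rw [one_mul]
      exact (abs_logisticDensity_add_sub_le fun u hu => hM u (hu.trans ht)).trans (by gcongr)
  simp only [add_zero, zero_mul, sub_zero] at h
  rwa [sub_right_comm, pow_two, ← mul_assoc]

lemma abs_softplus_add_sub_le :
    |softplus (x + d) - softplus x - d * Real.sigmoid x - d ^ 2 * logisticDensity x / 2|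
      ≤ M * |d| ^ 3 := by
  have hM0 : 0 ≤ M := (logisticDensity_pos _).le.trans (hM 0 (by simp))
  have h := abs_sub_le_of_hasDerivAt (f := fun t => softplus (x + t) - t * Real.sigmoid x
      - t ^ 2 * (logisticDensity x / 2)) (d := d) (M := M * |d| ^ 2)
    (fun t => (((hasDerivAt_softplus (x + t)).comp_const_add x t).sub
      ((hasDerivAt_id t).mul_const (Real.sigmoid x))).sub
      ((hasDerivAt_pow 2 t).mul_const (logisticDensity x / 2))) fun t ht => by
      have hbound := abs_sigmoid_add_sub_le fun u hu => hM u (hu.trans ht)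
      refine (le_of_eq ?_).trans (hbound.trans (by gcongr))
      norm_num
      ring_nf
  rw [pow_succ |d| 2, ← mul_assoc]
  refine (congr_arg abs ?_).trans_le h
  simp only [add_zero]
  ring

end Taylor

section Series

variable {α η : ℝ} (hα : 0 < α) (hη : 0 < η)
include hα hη

lemma summable_pow_mul_comp_part (j : ℕ) {f : ℝ → ℝ} (hf : ∀ x, |f x| ≤ Real.exp (-x)) :
    Summable fun a => (part α a : ℝ) ^ j * f (η * part α a) := by
  have h := summable_comp_part hα hη one_half_pos (h := fun x => x ^ j * f x) (abs_pow_mul_le j hf)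
  refine (h.mul_left (η ^ j)⁻¹).congr fun a => ?_
  rw [mul_pow]
  field_simp

lemma summable_pow_mul_logisticDensity (j : ℕ) :
    Summable fun a => (part α a : ℝ) ^ j * logisticDensity (η * part α a) :=
  summable_pow_mul_comp_part hα hη j abs_logisticDensity_le

lemma summable_pow_mul_sigmoid_neg (j : ℕ) :
    Summable fun a => (part α a : ℝ) ^ j * Real.sigmoid (-(η * part α a)) :=
  summable_pow_mul_comp_part (f := fun x => Real.sigmoid (-x)) hα hη j abs_sigmoid_neg_le

lemma mu_eq_tsum : mu α η = ∑' a, Real.sigmoid (-(η * part α a)) := by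
  have h := hasSum_g_mul hα (f := fun k => Real.sigmoid (-(η * k))) (by
    simpa using summable_pow_mul_sigmoid_neg hα hη 0)
  rw [← h.tsum_eq, mu]
  exact tsum_congr fun k => by rw [sigmoid_neg_eq, mul_one_div]

lemma momentSum_eq_tsum (j : ℕ) :
    momentSum α η j = ∑' a, (part α a : ℝ) ^ j * logisticDensity (η * part α a) := by
  have h := hasSum_g_mul hα (f := fun k => (k : ℝ) ^ j * logisticDensity (η * k))
    (summable_pow_mul_logisticDensity hα hη j)
  rw [← h.tsum_eq, momentSum]
  refine tsum_congr fun k => ?_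
  rw [logisticDensity_eq]
  ring

lemma momentSum_pos (j : ℕ) : 0 < momentSum α η j := by
  rw [momentSum_eq_tsum hα hη]
  have hpos : ∀ a, 0 < (part α a : ℝ) ^ j * logisticDensity (η * part α a) := fun a =>
    mul_pos (pow_pos (by exact_mod_cast one_le_part hα.le a) j) (logisticDensity_pos _)
  exact (summable_pow_mul_logisticDensity hα hη j).tsum_pos (fun a => (hpos a).le) 0 (hpos 0)

omit hα hη in
/-- The expected size `∑ k g(k) / (e ^ (η k) + 1)` in the model in which each integer `a ≥ 1` is
present independently with odds `e ^ (-η ⌊a ^ α⌋)`; the saddle point makes it equal to `n`. -/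
noncomputable def meanSize (α η : ℝ) : ℝ :=
  ∑' a, (part α a : ℝ) * Real.sigmoid (-(η * part α a))

lemma summable_meanSize : Summable fun a => (part α a : ℝ) * Real.sigmoid (-(η * part α a)) := by
  simpa using summable_pow_mul_sigmoid_neg hα hη 1

omit hη in
lemma isSaddlePoint_iff (n : ℕ) : IsSaddlePoint α n η ↔ 0 < η ∧ meanSize α η = n := by
  refine and_congr_right fun hη => ?_
  have h := hasSum_g_mul hα (f := fun k => (k : ℝ) * Real.sigmoid (-(η * k)))
    (summable_meanSize hα hη)
  have e : (fun k : ℕ+ => (k : ℝ) * g α k / (Real.exp (η * k) + 1))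
      = fun k : ℕ+ => g α k * ((k : ℕ) * Real.sigmoid (-(η * (k : ℕ)))) := by
    ext k
    rw [sigmoid_neg_eq]
    ring
  rw [e]
  exact ⟨fun h' => h.unique h', fun h' => h' ▸ h⟩

end Series

section Asymptotics

variable {α : ℝ} (hα : 0 < α)
include hα

lemma tendsto_mu :
    Tendsto (fun η => η ^ (1 / α) * mu α η) (𝓝[>] 0)
      (𝓝 (-(1 / α) * polylog (1 / α) (-1) * Real.Gamma (1 / α))) := by
  rw [← integral_sigmoid_neg_rpow hα]
  refine (tendsto_rpow_mul_tsum_part hα (C := 1) one_half_pos continuous_sigmoid_neg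
    (by simpa using abs_pow_mul_le 0 abs_sigmoid_neg_le)).congr' ?_
  filter_upwards [self_mem_nhdsWithin] with η hη
  rw [mu_eq_tsum hα hη]

lemma tendsto_meanSize :
    Tendsto (fun η => η ^ (1 / α) * (η * meanSize α η)) (𝓝[>] 0) (𝓝 (constA (1 / α))) := by
  rw [← integral_rpow_mul_sigmoid_neg_rpow hα]
  refine (tendsto_rpow_mul_tsum_part hα (h := fun x => x * Real.sigmoid (-x)) one_half_pos
    (by fun_prop) (by simpa using abs_pow_mul_le 1 abs_sigmoid_neg_le)).congr fun η => ?_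
  rw [meanSize, ← tsum_mul_left (a := η)]
  congr 1
  exact tsum_congr fun a => mul_assoc _ _ _

lemma tendsto_momentSum (j : ℕ) :
    Tendsto (fun η => η ^ (1 / α) * (η ^ j * momentSum α η j)) (𝓝[>] 0)
      (𝓝 (limMoment α j)) := by
  refine (tendsto_rpow_mul_tsum_part hα (h := fun x => x ^ j * logisticDensity x) one_half_pos
    (by fun_prop) (abs_pow_mul_le j abs_logisticDensity_le)).congr' ?_
  filter_upwards [self_mem_nhdsWithin] with η hη
  rw [momentSum_eq_tsum hα hη, ← tsum_mul_left (a := η ^ j)]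
  congr 1
  exact tsum_congr fun a => by ring

lemma tendsto_sigmaSq :
    Tendsto (fun η => η ^ (1 / α) * sigmaSq α η) (𝓝[>] 0)
      (𝓝 (limMoment α 0 - limMoment α 1 ^ 2 / limMoment α 2)) := by
  refine ((tendsto_momentSum hα 0).sub (((tendsto_momentSum hα 1).pow 2).div
    (tendsto_momentSum hα 2) (limMoment_pos hα 2).ne')).congr' ?_
  filter_upwards [self_mem_nhdsWithin] with η (hη : 0 < η)
  have h2 := (momentSum_pos hα hη 2).ne'
  simp only [Pi.div_apply, sigmaSq]
  field_simp

end Asymptotics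

section Envelope

/-- The function `(1 + y) ^ 5 e ^ (-y / 2)`, which at `y = η * part α a` dominates the error term
of each part `a` in all the expansions in the tilt. -/
noncomputable def envelope (y : ℝ) : ℝ := (1 + y) ^ 5 * Real.exp (-y / 2)

lemma continuous_envelope : Continuous envelope := by
  unfold envelope
  fun_prop

lemma exists_abs_envelope_le :
    ∃ C : ℝ, ∀ y, 0 ≤ y → |envelope y| ≤ C * Real.exp (-(1 / 4) * y) := by
  refine ⟨(5 : ℕ).factorial * 4 ^ 5 * Real.exp (1 / 4), fun y hy => ?_⟩
  have h : (1 + y) ^ 5 ≤ (5 : ℕ).factorial * 4 ^ 5 * Real.exp ((1 + y) / 4) := by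
    have := Real.pow_div_factorial_le_exp ((1 + y) / 4) (by positivity) 5
    rw [div_pow, div_div, div_le_iff₀ (by positivity)] at this
    linarith
  calc |envelope y| = (1 + y) ^ 5 * Real.exp (-y / 2) := by
        rw [envelope, abs_of_nonneg (by positivity)]
    _ ≤ (5 : ℕ).factorial * 4 ^ 5 * Real.exp ((1 + y) / 4) * Real.exp (-y / 2) := by gcongr
    _ = (5 : ℕ).factorial * 4 ^ 5 * Real.exp (1 / 4) * Real.exp (-(1 / 4) * y) := by
      rw [mul_assoc, ← Real.exp_add, mul_assoc _ (Real.exp (1 / 4)), ← Real.exp_add]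
      ring_nf

lemma pow_mul_pow_le_envelope {i j : ℕ} (hij : i + j ≤ 5) {y : ℝ} (hy : 0 ≤ y) :
    (1 + y) ^ i * y ^ j * Real.exp (-y / 2) ≤ envelope y := by
  unfold envelope
  gcongr
  calc (1 + y) ^ i * y ^ j ≤ (1 + y) ^ i * (1 + y) ^ j := by gcongr; linarith
    _ = (1 + y) ^ (i + j) := (pow_add _ _ _).symm
    _ ≤ (1 + y) ^ 5 := pow_le_pow_right₀ (by linarith) hij

lemma summable_envelope {α η : ℝ} (hα : 0 < α) (hη : 0 < η) :
    Summable fun a => envelope (η * part α a) := by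
  obtain ⟨C, hC⟩ := exists_abs_envelope_le
  exact summable_comp_part hα hη (by norm_num) hC

end Envelope

section PartsInDyadicRange

variable {α : ℝ}

lemma one_le_g (hα : 0 < α) (hα1 : α ≤ 1) (k : ℕ) : 1 ≤ g α k := by
  have h : (k : ℝ) ^ (1 / α) + 1 ≤ ((k : ℝ) + 1) ^ (1 / α) := by
    simpa using Real.add_rpow_le_rpow_add k.cast_nonneg zero_le_one ((one_le_div hα).2 hα1)
  have h' : ⌈(k : ℝ) ^ (1 / α)⌉ + 1 ≤ ⌈((k : ℝ) + 1) ^ (1 / α)⌉ := by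
    rw [← Int.ceil_add_one]
    exact Int.ceil_mono h
  have : (⌈(k : ℝ) ^ (1 / α)⌉ : ℝ) + 1 ≤ ⌈((k : ℝ) + 1) ^ (1 / α)⌉ := by exact_mod_cast h'
  rw [g]
  linarith

lemma mul_rpow_sub_one_le_g (hα : 0 < α) (hα1 : α ≤ 1) {k : ℕ} (hk : 1 ≤ k) :
    1 / α * (k : ℝ) ^ (1 / α - 1) - 1 ≤ g α k := by
  have hk0 : (0 : ℝ) < k := by exact_mod_cast hk
  have bernoulli : (k : ℝ) ^ (1 / α) + 1 / α * (k : ℝ) ^ (1 / α - 1) ≤ ((k : ℝ) + 1) ^ (1 / α) :=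
    calc (k : ℝ) ^ (1 / α) + 1 / α * (k : ℝ) ^ (1 / α - 1)
        = (k : ℝ) ^ (1 / α) * (1 + 1 / α * (1 / k)) := by
          rw [Real.rpow_sub_one hk0.ne']
          ring
      _ ≤ (k : ℝ) ^ (1 / α) * (1 + 1 / k) ^ (1 / α) := by
          gcongr
          exact one_add_mul_self_le_rpow_one_add
            (by linarith [show (0 : ℝ) ≤ 1 / k by positivity]) ((one_le_div hα).2 hα1)
      _ = ((k : ℝ) + 1) ^ (1 / α) := by
          rw [← Real.mul_rpow hk0.le (by positivity), mul_add, mul_one, mul_one_div_cancel hk0.ne']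
  rw [g]
  linarith [Int.le_ceil (((k : ℝ) + 1) ^ (1 / α)), Int.ceil_lt_add_one ((k : ℝ) ^ (1 / α))]

lemma rpow_le_g (hα : 0 < α) (hα1 : α ≤ 1) {k : ℕ} (hk : 1 ≤ k) :
    1 / α / 2 * (k : ℝ) ^ (1 / α - 1) ≤ g α k := by
  linarith [one_le_g hα hα1 k, mul_rpow_sub_one_le_g hα hα1 hk]

lemma tendsto_part_atTop (hα : 0 < α) : Tendsto (part α) atTop atTop :=
  tendsto_nat_floor_atTop.comp <| (tendsto_rpow_atTop hα).comp <|
    tendsto_atTop_add_const_right _ _ tendsto_natCast_atTop_atTop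

lemma eventually_card_filter_part_eq (hα : 0 < α) (L : ℕ) :
    ∀ᶠ M in atTop, ∀ k, 1 ≤ k → k ≤ L →
      (((Finset.range M).filter (part α · = k)).card : ℝ) = g α k := by
  obtain ⟨N, hN⟩ := eventually_atTop.1 ((tendsto_part_atTop hα).eventually_gt_atTop L)
  filter_upwards [eventually_ge_atTop N] with M hM k hk hkL
  rw [← card_part_fiber hα hk, Nat.card_coe_set_eq, ← Set.ncard_coe_finset]
  congr 2
  ext a
  simp only [Finset.coe_filter, Finset.mem_range, Set.mem_ofPred_eq, and_iff_right_iff_imp]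
  rintro rfl
  by_contra! haM
  exact (hN a (hM.trans haM)).not_ge hkL

lemma eventually_sum_Ioc_le_sum_part (hα : 0 < α) (hα1 : α ≤ 1) {K : ℕ} (hK : 1 ≤ K) :
    ∀ᶠ M in atTop, ∀ f : ℕ → ℝ, (∀ k, 0 ≤ f k) →
      1 / α / 2 * (K : ℝ) ^ (1 / α - 1) * ∑ k ∈ Finset.Ioc K (2 * K), f k
        ≤ ∑ a ∈ Finset.range M with part α a ∈ Finset.Ioc K (2 * K), f (part α a) := by
  filter_upwards [eventually_card_filter_part_eq hα (2 * K)] with M hM f hf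
  rw [Finset.mul_sum, ← Finset.sum_fiberwise_of_maps_to (t := Finset.Ioc K (2 * K))
    (g := part α) (fun a ha => (Finset.mem_filter.1 ha).2)]
  refine Finset.sum_le_sum fun k hk => ?_
  obtain ⟨hKk, hkK⟩ := Finset.mem_Ioc.1 hk
  have hfiber : ((Finset.range M).filter (part α · ∈ Finset.Ioc K (2 * K))).filter (part α · = k)
      = (Finset.range M).filter (part α · = k) := by
    rw [Finset.filter_filter]
    exact Finset.filter_congr fun a _ => and_iff_right_of_imp fun h => h ▸ hk
  have hβ : 0 ≤ 1 / α - 1 := sub_nonneg.2 ((one_le_div hα).2 hα1)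
  calc 1 / α / 2 * (K : ℝ) ^ (1 / α - 1) * f k ≤ 1 / α / 2 * (k : ℝ) ^ (1 / α - 1) * f k := by
        gcongr
        exact hf k
    _ ≤ g α k * f k := mul_le_mul_of_nonneg_right (rpow_le_g hα hα1 (by omega)) (hf k)
    _ = _ := by
        rw [hfiber, Finset.sum_congr rfl (g := fun _ => f k) fun a ha => by
          rw [(Finset.mem_filter.1 ha).2], Finset.sum_const, nsmul_eq_mul, hM k (by omega) hkK]

end PartsInDyadicRange

section Tilt

/-- The order of magnitude `η ^ (-1 / α)` of all cumulants of the number of summands. -/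
noncomputable def vol (α η : ℝ) : ℝ := η ^ (-(1 / α))

/-- The regression coefficient of the number of summands on the size. -/
noncomputable def slope (α η : ℝ) : ℝ := momentSum α η 1 / momentSum α η 2

/-- The contribution of a single part to the number of summands, after regression on the size. -/
noncomputable def weight (α η : ℝ) (a : ℕ) : ℝ := 1 - slope α η * part α a

/-- The log-odds of the part `a` in the tilted model, in which `a` is present with probability
`Real.sigmoid (tiltArg α η s a)`. -/
noncomputable def tiltArg (α η s : ℝ) (a : ℕ) : ℝ := -(η * part α a) + s * weight α η a

/-- The mean size in the tilted model. -/
noncomputable def tiltMean (α η s : ℝ) : ℝ := ∑' a, part α a * Real.sigmoid (tiltArg α η s a)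

/-- The sums `∑ k ^ j p (1 - p)` over the parts of the tilted model. -/
noncomputable def tiltMoment (α η s : ℝ) (j : ℕ) : ℝ :=
  ∑' a, part α a ^ j * logisticDensity (tiltArg α η s a)

/-- The cumulant generating function, at `s`, of the number of summands after regression on the
size. -/
noncomputable def tiltCumulant (α η s : ℝ) : ℝ :=
  ∑' a, (softplus (tiltArg α η s a) - softplus (-(η * part α a)))

/-- Bounds with constant `C`, valid for all small `η`, on the untilted model. -/
structure TiltBounds (α η C : ℝ) : Prop where
  pos : 0 < η
  le_one : η ≤ 1
  one_le : 1 ≤ C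
  abs_weight_le : ∀ a, |weight α η a| ≤ C * (1 + η * part α a)
  tsum_envelope_le : ∑' a, envelope (η * part α a) ≤ C * vol α η
  le_momentSum : vol α η ≤ C * (η ^ 2 * momentSum α η 2)
  le_sigmaSq : vol α η ≤ C * sigmaSq α η
  momentSum_le : η ^ 2 * momentSum α η 2 ≤ C * vol α η

variable {α : ℝ}

lemma vol_pos {η : ℝ} (hη : 0 < η) : 0 < vol α η := by
  unfold vol
  positivity

lemma rpow_mul_vol {η : ℝ} (hη : 0 < η) : η ^ (1 / α) * vol α η = 1 := by
  rw [vol, ← Real.rpow_add hη, add_neg_cancel, Real.rpow_zero]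

lemma eventually_le_mul_vol {l : ℝ} {f : ℝ → ℝ}
    (h : Tendsto (fun η => η ^ (1 / α) * f η) (𝓝[>] 0) (𝓝 l)) :
    ∀ᶠ C in atTop, ∀ᶠ η in 𝓝[>] 0, f η ≤ C * vol α η := by
  filter_upwards [eventually_gt_atTop l] with C hC
  filter_upwards [h.eventually_lt_const hC, self_mem_nhdsWithin] with η h1 (hη : 0 < η)
  refine le_of_mul_le_mul_left (a := η ^ (1 / α)) ?_ (by positivity)
  rw [mul_left_comm, rpow_mul_vol hη, mul_one]
  exact h1.le

lemma eventually_vol_le_mul {l : ℝ} {f : ℝ → ℝ}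
    (h : Tendsto (fun η => η ^ (1 / α) * f η) (𝓝[>] 0) (𝓝 l)) (hl : 0 < l) :
    ∀ᶠ C in atTop, ∀ᶠ η in 𝓝[>] 0, vol α η ≤ C * f η := by
  filter_upwards [eventually_gt_atTop l⁻¹] with C hC
  have hCl : C⁻¹ < l := inv_lt_of_inv_lt₀ hl hC
  have hC0 : 0 < C := (inv_pos.2 hl).trans hC
  filter_upwards [h.eventually_const_lt hCl, self_mem_nhdsWithin] with η h1 (hη : 0 < η)
  refine le_of_mul_le_mul_left (a := η ^ (1 / α)) ?_ (by positivity)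
  rw [rpow_mul_vol hη, mul_left_comm]
  exact ((inv_lt_iff_one_lt_mul₀' hC0).1 h1).le

lemma tendsto_slope_div (hα : 0 < α) :
    Tendsto (fun η => slope α η / η) (𝓝[>] 0) (𝓝 (limMoment α 1 / limMoment α 2)) := by
  refine ((tendsto_momentSum hα 1).div (tendsto_momentSum hα 2) (limMoment_pos hα 2).ne').congr' ?_
  filter_upwards [self_mem_nhdsWithin] with η (hη : 0 < η)
  have := momentSum_pos hα hη 2
  rw [Pi.div_apply, slope]
  field_simp

lemma eventually_abs_weight_le (hα : 0 < α) :
    ∀ᶠ C in atTop, ∀ᶠ η in 𝓝[>] 0, ∀ a, |weight α η a| ≤ C * (1 + η * part α a) := by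
  filter_upwards [eventually_gt_atTop (limMoment α 1 / limMoment α 2), eventually_ge_atTop 1]
    with C hC hC1
  filter_upwards [(tendsto_slope_div hα).eventually_lt_const hC, self_mem_nhdsWithin]
    with η hslope (hη : 0 < η) a
  have hslope0 : 0 ≤ slope α η := div_nonneg (momentSum_pos hα hη 1).le (momentSum_pos hα hη 2).le
  calc |weight α η a| ≤ 1 + slope α η * part α a := by
        rw [weight]
        refine (abs_sub _ _).trans_eq ?_
        rw [abs_one, abs_of_nonneg (by positivity)]
    _ ≤ C + C * η * part α a := by
        gcongr
        exact ((div_lt_iff₀ hη).1 hslope).le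
    _ = C * (1 + η * part α a) := by ring

lemma exists_tiltBounds (hα : 0 < α) : ∃ C, ∀ᶠ η in 𝓝[>] 0, TiltBounds α η C := by
  obtain ⟨B, hB⟩ := exists_abs_envelope_le
  have henv := tendsto_rpow_mul_tsum_part hα (by norm_num) continuous_envelope hB
  obtain ⟨C, h1, hweight, henv, hle2, hleσ, h2le⟩ :=
    ((eventually_ge_atTop 1).and <| (eventually_abs_weight_le hα).and <|
      (eventually_le_mul_vol henv).and <|
      (eventually_vol_le_mul (tendsto_momentSum hα 2) (limMoment_pos hα 2)).and <|
      (eventually_vol_le_mul (tendsto_sigmaSq hα) (limMoment_variance_pos hα)).and <|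
      eventually_le_mul_vol (tendsto_momentSum hα 2)).exists
  refine ⟨C, ?_⟩
  filter_upwards [Ioc_mem_nhdsGT zero_lt_one, hweight, henv, hle2, hleσ, h2le]
    with η hη hweight henv hle2 hleσ h2le
  exact ⟨hη.1, hη.2, h1, hweight, henv, hle2, hleσ, h2le⟩

end Tilt

section Regression

variable {α η : ℝ} (hα : 0 < α) (hη : 0 < η) (s : ℝ)
include hα hη

/-- The weight is orthogonal to the size, so that tilting moves the mean size only to second
order. -/
lemma hasSum_mul_weight_mul_logisticDensity :
    HasSum (fun a => part α a * (s * weight α η a * logisticDensity (-(η * part α a)))) 0 := by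
  have h1 := (summable_pow_mul_logisticDensity hα hη 1).hasSum
  have h2 := (summable_pow_mul_logisticDensity hα hη 2).hasSum
  rw [← momentSum_eq_tsum hα hη] at h1 h2
  have hsum := (h1.sub (h2.mul_left (slope α η))).mul_left s
  rw [slope, div_mul_cancel₀ _ (momentSum_pos hα hη 2).ne', sub_self, mul_zero] at hsum
  refine hsum.congr_fun fun a => ?_
  rw [weight, slope, logisticDensity_neg]
  ring

lemma hasSum_mul_weight_mul_sigmoid :
    HasSum (fun a => s * weight α η a * Real.sigmoid (-(η * part α a)))
      (s * (mu α η - slope α η * meanSize α η)) := by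
  have h0 : Summable fun a => Real.sigmoid (-(η * part α a)) := by
    simpa using summable_pow_mul_sigmoid_neg hα hη 0
  rw [mu_eq_tsum hα hη, meanSize]
  refine ((h0.hasSum.sub ((summable_meanSize hα hη).hasSum.mul_left (slope α η))).mul_left
    s).congr_fun fun a => ?_
  rw [weight]
  ring

lemma hasSum_sq_mul_weight_mul_logisticDensity :
    HasSum (fun a => (s * weight α η a) ^ 2 * logisticDensity (-(η * part α a)) / 2)
      (s ^ 2 * sigmaSq α η / 2) := by
  have hM2 := momentSum_pos hα hη 2
  have hsum (j : ℕ) := (summable_pow_mul_logisticDensity hα hη j).hasSum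
  simp only [← momentSum_eq_tsum hα hη] at hsum
  have hquad : HasSum _ (s ^ 2 / 2 * (momentSum α η 0 - 2 * slope α η * momentSum α η 1
      + slope α η ^ 2 * momentSum α η 2)) :=
    (((hsum 0).sub ((hsum 1).mul_left (2 * slope α η))).add
      ((hsum 2).mul_left (slope α η ^ 2))).mul_left (s ^ 2 / 2)
  convert hquad.congr_fun fun a => ?_ using 1
  · rw [slope, sigmaSq]
    field_simp
    ring
  · rw [weight, logisticDensity_neg]
    ring

end Regression

namespace TiltBounds

variable {α η C s : ℝ} (h : TiltBounds α η C)
include h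

lemma part_nonneg (a : ℕ) : 0 ≤ η * part α a := mul_nonneg h.pos.le (Nat.cast_nonneg _)

lemma C_pos : 0 < C := lt_of_lt_of_le one_pos h.one_le

lemma abs_mul_weight_le (s : ℝ) (a : ℕ) :
    |s * weight α η a| ≤ C * |s| * (1 + η * part α a) := by
  rw [abs_mul, mul_comm C, mul_assoc]
  gcongr
  exact h.abs_weight_le a

lemma exp_mul_pow_le_envelope {i j : ℕ} (hij : i + j ≤ 5) (s : ℝ) (a : ℕ) :
    2 * Real.exp (-(η * part α a) / 2) * |s * weight α η a| ^ i * part α a ^ j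
      ≤ 2 * C ^ i * |s| ^ i / η ^ j * envelope (η * part α a) := by
  have hη := h.pos
  have hC := h.C_pos
  calc _ ≤ 2 * Real.exp (-(η * part α a) / 2) * (C * |s| * (1 + η * part α a)) ^ i
        * part α a ^ j := by
        gcongr
        exact h.abs_mul_weight_le s a
    _ = 2 * C ^ i * |s| ^ i / η ^ j
        * ((1 + η * part α a) ^ i * (η * part α a) ^ j * Real.exp (-(η * part α a) / 2)) := by
        rw [mul_pow η, mul_pow (C * |s|), mul_pow C]
        field_simp
    _ ≤ _ := by
        gcongr
        exact pow_mul_pow_le_envelope hij (h.part_nonneg a)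

lemma summable_of_abs_le (hα : 0 < α) {i j : ℕ} (hij : i + j ≤ 5) {f : ℕ → ℝ}
    (hf : ∀ a, |f a| ≤ 2 * Real.exp (-(η * part α a) / 2) * |s * weight α η a| ^ i * part α a ^ j) :
    Summable f :=
  Summable.of_norm_bounded ((summable_envelope hα h.pos).mul_left _) fun a =>
    (hf a).trans (h.exp_mul_pow_le_envelope hij s a)

lemma abs_tsum_le (hα : 0 < α) {i j : ℕ} (hij : i + j ≤ 5) {f : ℕ → ℝ}
    (hf : ∀ a, |f a| ≤ 2 * Real.exp (-(η * part α a) / 2) * |s * weight α η a| ^ i * part α a ^ j) :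
    |∑' a, f a| ≤ 2 * C ^ (i + 1) * |s| ^ i * vol α η / η ^ j := by
  have hη := h.pos
  have hC := h.C_pos
  calc |∑' a, f a| ≤ ∑' a, 2 * C ^ i * |s| ^ i / η ^ j * envelope (η * part α a) :=
        tsum_of_norm_bounded (f := f) ((summable_envelope hα hη).mul_left _).hasSum fun a =>
          (hf a).trans (h.exp_mul_pow_le_envelope hij s a)
    _ = 2 * C ^ i * |s| ^ i / η ^ j * ∑' a, envelope (η * part α a) := tsum_mul_left
    _ ≤ 2 * C ^ i * |s| ^ i / η ^ j * (C * vol α η) := by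
        gcongr
        exact h.tsum_envelope_le
    _ = _ := by ring

section SmallTilt

variable (hs : C * |s| ≤ 1 / 2)
include hs

lemma abs_mul_weight_le_half (a : ℕ) : |s * weight α η a| ≤ (1 + η * part α a) / 2 := by
  refine (h.abs_mul_weight_le s a).trans ?_
  nlinarith [h.part_nonneg a]

lemma exp_add_le (a : ℕ) {t : ℝ} (ht : |t| ≤ |s * weight α η a|) :
    Real.exp (-(η * part α a) + t) ≤ 2 * Real.exp (-(η * part α a) / 2) := by
  have hexp : Real.exp (1 / 2) ≤ 2 := by
    rw [← Real.le_log_iff_exp_le two_pos]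
    linarith [Real.log_two_gt_d9]
  calc Real.exp (-(η * part α a) + t) ≤ Real.exp (1 / 2 + -(η * part α a) / 2) := by
        refine Real.exp_le_exp.2 ?_
        linarith [le_abs_self t, ht.trans (h.abs_mul_weight_le_half hs a)]
    _ = Real.exp (1 / 2) * Real.exp (-(η * part α a) / 2) := Real.exp_add _ _
    _ ≤ _ := by gcongr

lemma exp_tiltArg_le (a : ℕ) :
    Real.exp (tiltArg α η s a) ≤ 2 * Real.exp (-(η * part α a) / 2) :=
  h.exp_add_le hs a le_rfl

lemma logisticDensity_add_le (a : ℕ) (t : ℝ) (ht : |t| ≤ |s * weight α η a|) :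
    logisticDensity (-(η * part α a) + t) ≤ 2 * Real.exp (-(η * part α a) / 2) :=
  (logisticDensity_le_exp _).trans (h.exp_add_le hs a ht)

lemma abs_pow_mul_comp_tiltArg_le {f : ℝ → ℝ} (hf : ∀ x, |f x| ≤ Real.exp x) (j a : ℕ) :
    |part α a ^ j * f (tiltArg α η s a)|
      ≤ 2 * Real.exp (-(η * part α a) / 2) * |s * weight α η a| ^ 0 * part α a ^ j := by
  rw [pow_zero, mul_one, mul_comm, abs_mul, abs_of_nonneg (by positivity : (0 : ℝ) ≤ part α a ^ j)]
  gcongr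
  exact (hf _).trans (h.exp_tiltArg_le hs a)

lemma summable_pow_mul_comp_tiltArg (hα : 0 < α) {j : ℕ} (hj : j ≤ 5) {f : ℝ → ℝ}
    (hf : ∀ x, |f x| ≤ Real.exp x) : Summable fun a => part α a ^ j * f (tiltArg α η s a) :=
  h.summable_of_abs_le hα (by omega : 0 + j ≤ 5) (h.abs_pow_mul_comp_tiltArg_le hs hf j)

lemma summable_tiltMean (hα : 0 < α) :
    Summable fun a => part α a * Real.sigmoid (tiltArg α η s a) := by
  simpa using h.summable_pow_mul_comp_tiltArg hs hα (j := 1) (by norm_num)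
    fun x => (abs_of_pos (Real.sigmoid_pos x)).trans_le (sigmoid_le_exp x)

lemma summable_tiltMoment (hα : 0 < α) {j : ℕ} (hj : j ≤ 5) :
    Summable fun a => part α a ^ j * logisticDensity (tiltArg α η s a) :=
  h.summable_pow_mul_comp_tiltArg hs hα hj
    fun x => (abs_of_pos (logisticDensity_pos x)).trans_le (logisticDensity_le_exp x)

lemma summable_softplus_tiltArg (hα : 0 < α) :
    Summable fun a => softplus (tiltArg α η s a) := by
  simpa using h.summable_pow_mul_comp_tiltArg hs hα (j := 0) (by norm_num)
    fun x => (abs_of_nonneg (softplus_nonneg x)).trans_le (softplus_le_exp x)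

lemma tiltMoment_three_le (hα : 0 < α) : tiltMoment α η s 3 ≤ 2 * C * vol α η / η ^ 3 := by
  refine (le_abs_self _).trans ((h.abs_tsum_le hα (by norm_num : 0 + 3 ≤ 5)
    (h.abs_pow_mul_comp_tiltArg_le hs (fun x =>
      (abs_of_pos (logisticDensity_pos x)).trans_le (logisticDensity_le_exp x)) 3)).trans_eq ?_)
  ring

lemma abs_tiltMoment_two_sub_le (hα : 0 < α) :
    |tiltMoment α η s 2 - momentSum α η 2| ≤ 2 * C ^ 2 * |s| * vol α η / η ^ 2 := by
  rw [tiltMoment, momentSum_eq_tsum hα h.pos, ← (h.summable_tiltMoment hs hα (by norm_num)).tsum_sub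
    (summable_pow_mul_logisticDensity hα h.pos 2)]
  refine (h.abs_tsum_le (s := s) hα (by norm_num : 1 + 2 ≤ 5) fun a => ?_).trans_eq
    (by rw [pow_one])
  rw [← mul_sub, mul_comm, abs_mul, abs_of_nonneg (by positivity : (0 : ℝ) ≤ part α a ^ 2),
    ← logisticDensity_neg (η * _), pow_one]
  gcongr
  exact abs_logisticDensity_add_sub_le (h.logisticDensity_add_le hs a)

lemma abs_tiltMean_sub_le (hα : 0 < α) :
    |tiltMean α η s - meanSize α η| ≤ 2 * C ^ 3 * |s| ^ 2 * vol α η / η := by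
  have horth := hasSum_mul_weight_mul_logisticDensity hα h.pos s
  have htilt := h.summable_tiltMean hs hα
  have hmean := summable_meanSize hα h.pos
  rw [← sub_zero (tiltMean α η s - _), ← horth.tsum_eq, tiltMean, meanSize, ← htilt.tsum_sub hmean,
    ← (htilt.sub hmean).tsum_sub horth.summable]
  refine (h.abs_tsum_le (s := s) hα (by norm_num : 2 + 1 ≤ 5) fun a => ?_).trans_eq
    (by rw [pow_one])
  rw [← mul_sub, ← mul_sub, mul_comm, abs_mul, Nat.abs_cast, pow_one]
  gcongr
  exact abs_sigmoid_add_sub_le (h.logisticDensity_add_le hs a)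

lemma abs_tiltCumulant_sub_le (hα : 0 < α) :
    |tiltCumulant α η s - (s * (mu α η - slope α η * meanSize α η) + s ^ 2 * sigmaSq α η / 2)|
      ≤ 2 * C ^ 4 * |s| ^ 3 * vol α η := by
  have hlin := hasSum_mul_weight_mul_sigmoid hα h.pos s
  have hquad := hasSum_sq_mul_weight_mul_logisticDensity hα h.pos s
  have h0 : Summable fun a => softplus (-(η * part α a)) := by
    simpa [tiltArg] using h.summable_softplus_tiltArg (s := 0) (by simp) hα
  have hdiff := (h.summable_softplus_tiltArg hs hα).sub h0
  rw [← sub_sub, tiltCumulant, ← hlin.tsum_eq, ← hquad.tsum_eq, ← hdiff.tsum_sub hlin.summable,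
    ← (hdiff.sub hlin.summable).tsum_sub hquad.summable]
  refine (h.abs_tsum_le (s := s) hα (by norm_num : 3 + 0 ≤ 5) fun a => ?_).trans_eq
    (by rw [pow_zero, div_one])
  rw [pow_zero, mul_one]
  exact abs_softplus_add_sub_le (h.logisticDensity_add_le hs a)

lemma exp_le_logisticDensity_tiltArg {a : ℕ} (ha : η * part α a ≤ 16) :
    Real.exp (-25) / 4 ≤ logisticDensity (tiltArg α η s a) := by
  refine le_trans ?_ (exp_neg_abs_le_logisticDensity _)
  gcongr
  have hw := abs_le.1 (h.abs_mul_weight_le_half hs a)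
  have := h.part_nonneg a
  rw [tiltArg, abs_le]
  constructor <;> linarith

lemma eventually_sum_Ioc_one_sub_cos_le (hα : 0 < α) (hα1 : α ≤ 1) {K : ℕ} (hK : 1 ≤ η * K)
    (hK8 : η * K ≤ 8) :
    ∀ᶠ M in atTop, ∀ θ : ℝ, Real.exp (-25) / (8 * α) * (η * vol α η)
        * ∑ k ∈ Finset.Ioc K (2 * K), (1 - Real.cos (θ * k))
      ≤ ∑ a ∈ Finset.range M,
        logisticDensity (tiltArg α η s a) * (1 - Real.cos (θ * part α a)) := by
  have hη := h.pos
  have hcos : ∀ x, 0 ≤ 1 - Real.cos x := fun x => sub_nonneg.2 (Real.cos_le_one x)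
  have hK1 : 1 ≤ K := Nat.one_le_iff_ne_zero.2 (by rintro rfl; norm_num at hK)
  have hvol : η * vol α η ≤ (K : ℝ) ^ (1 / α - 1) :=
    calc η * vol α η = η⁻¹ ^ (1 / α - 1) := by
          rw [vol, Real.inv_rpow hη.le, ← Real.rpow_neg hη.le, neg_sub, sub_eq_add_neg,
            Real.rpow_add hη, Real.rpow_one]
      _ ≤ (K : ℝ) ^ (1 / α - 1) :=
          Real.rpow_le_rpow (by positivity) ((inv_le_iff_one_le_mul₀' hη).2 hK)
            (sub_nonneg.2 ((one_le_div hα).2 hα1))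
  filter_upwards [eventually_sum_Ioc_le_sum_part hα hα1 hK1] with M hM θ
  have hS : 0 ≤ ∑ k ∈ Finset.Ioc K (2 * K), (1 - Real.cos (θ * k)) :=
    Finset.sum_nonneg fun k _ => hcos _
  calc _ ≤ Real.exp (-25) / (8 * α) * (K : ℝ) ^ (1 / α - 1)
          * ∑ k ∈ Finset.Ioc K (2 * K), (1 - Real.cos (θ * k)) := by gcongr
    _ = Real.exp (-25) / 4 * (1 / α / 2 * (K : ℝ) ^ (1 / α - 1)
          * ∑ k ∈ Finset.Ioc K (2 * K), (1 - Real.cos (θ * k))) := by ring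
    _ ≤ Real.exp (-25) / 4 * ∑ a ∈ Finset.range M with part α a ∈ Finset.Ioc K (2 * K),
          (1 - Real.cos (θ * part α a)) := by
        gcongr
        exact hM _ fun k => hcos _
    _ ≤ ∑ a ∈ Finset.range M with part α a ∈ Finset.Ioc K (2 * K),
          logisticDensity (tiltArg α η s a) * (1 - Real.cos (θ * part α a)) := by
        rw [Finset.mul_sum]
        refine Finset.sum_le_sum fun a ha => mul_le_mul_of_nonneg_right
          (h.exp_le_logisticDensity_tiltArg hs ?_) (hcos _)
        have : (part α a : ℝ) ≤ 2 * K := by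
          exact_mod_cast (Finset.mem_Ioc.1 (Finset.mem_filter.1 ha).2).2
        nlinarith
    _ ≤ _ := Finset.sum_le_sum_of_subset_of_nonneg (Finset.filter_subset _ _)
        fun a _ _ => mul_nonneg (logisticDensity_pos _).le (hcos _)

/-- Small frequencies are detected by the sizes of order `1 / η`, larger ones by an interval of
sizes long enough for the cosines to cancel. -/
lemma eventually_le_sum_one_sub_cos (hα : 0 < α) (hα1 : α ≤ 1) :
    ∀ᶠ M in atTop, ∀ θ : ℝ, |θ| ≤ Real.pi →
      Real.exp (-25) / (4 * α * Real.pi ^ 2) * vol α η * min 1 ((θ / η) ^ 2)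
      ≤ ∑ a ∈ Finset.range M,
        logisticDensity (tiltArg α η s a) * (1 - Real.cos (θ * part α a)) := by
  have hη := h.pos
  have hV := vol_pos (α := α) hη
  obtain ⟨Q, hQ, hQ2⟩ : ∃ Q : ℕ, 1 ≤ η * Q ∧ η * Q ≤ 2 := by
    refine ⟨⌈η⁻¹⌉₊, (inv_le_iff_one_le_mul₀' hη).1 (Nat.le_ceil _), ?_⟩
    have := (Nat.ceil_lt_add_one (inv_pos.2 hη).le).le
    calc η * ⌈η⁻¹⌉₊ ≤ η * (η⁻¹ + 1) := by gcongr
      _ = 1 + η := by rw [mul_add, mul_inv_cancel₀ hη.ne', mul_one]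
      _ ≤ 2 := by linarith [h.le_one]
  filter_upwards [h.eventually_sum_Ioc_one_sub_cos_le hs hα hα1 (K := Q) hQ (by linarith),
    h.eventually_sum_Ioc_one_sub_cos_le hs hα hα1 (K := 4 * Q) (by push_cast; linarith)
      (by push_cast; linarith)] with M hM hM4 θ hθ
  rcases le_or_gt (|θ| * (2 * Q)) Real.pi with hsmall | hlarge
  · refine le_trans ?_ (hM θ)
    calc _ ≤ Real.exp (-25) / (4 * α * Real.pi ^ 2) * vol α η * (θ / η) ^ 2 * (η * Q) ^ 3 := by
          refine (mul_le_mul_of_nonneg_left (min_le_right _ _) (by positivity)).trans ?_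
          exact le_mul_of_one_le_right (by positivity) (one_le_pow₀ hQ)
      _ = Real.exp (-25) / (8 * α) * (η * vol α η) * (2 / Real.pi ^ 2 * Q ^ 3 * θ ^ 2) := by
          field_simp
          ring
      _ ≤ _ := by
          gcongr
          exact le_sum_one_sub_cos_of_small hsmall
  · refine le_trans ?_ (hM4 θ)
    have hpi : 1 / (4 * Real.pi ^ 2) ≤ η * Q / 4 := by
      rw [div_le_div_iff₀ (by positivity) (by norm_num)]
      nlinarith [Real.pi_gt_three]
    calc _ ≤ Real.exp (-25) / (4 * α * Real.pi ^ 2) * vol α η * 1 := by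
          gcongr
          exact min_le_left _ _
      _ = Real.exp (-25) / α * vol α η * (1 / (4 * Real.pi ^ 2)) := by field_simp
      _ ≤ Real.exp (-25) / α * vol α η * (η * Q / 4) := by gcongr
      _ = Real.exp (-25) / (8 * α) * (η * vol α η) * ((4 * Q : ℕ) / 2) := by
          push_cast
          ring
      _ ≤ _ := by
          gcongr
          exact le_sum_one_sub_cos_of_large (by push_cast; linarith) hθ

end SmallTilt

end TiltBounds

section UniformOn

variable {Ω : Type*} [MeasurableSpace Ω] [MeasurableSingletonClass Ω] {t : Set Ω}

lemma integrable_uniformOn (ht : t.Finite) (f : Ω → ℝ) : Integrable f (uniformOn t) := by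
  have hrestrict : (uniformOn t).restrict t = uniformOn t := by
    rw [uniformOn, ProbabilityTheory.cond, Measure.restrict_smul,
      Measure.restrict_restrict ht.measurableSet, Set.inter_self]
  rw [← hrestrict]
  exact IntegrableOn.of_finite ht

lemma integral_uniformOn (ht : t.Finite) (f : Ω → ℝ) :
    ∫ x, f x ∂(uniformOn t) = (∑ x ∈ ht.toFinset, f x) / t.ncard := by
  have hcount : Measure.count t = (t.ncard : ENNReal) := by
    rw [Measure.count_apply_finite _ ht, Set.ncard_eq_toFinset_card _ ht]
  have hint : IntegrableOn f t Measure.count := by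
    refine (integrableOn_finite_biUnion ht (t := fun x => {x})).2 (fun x _ => ?_) |>.mono_set ?_
    · exact (integrableOn_singleton_iff enorm_ne_top).2 (.inr (by simp))
    · rw [Set.biUnion_of_singleton]
  rw [← ht.coe_toFinset] at hint
  have hsum := setIntegral_finset _ hint
  rw [ht.coe_toFinset] at hsum
  rw [uniformOn, ProbabilityTheory.cond, integral_smul_measure, hcount, hsum]
  simp [measureReal_def, div_eq_inv_mul]

end UniformOn

/-- The generating function `∑ e ^ (s ℓ)` over the restricted partitions of `n`. -/
noncomputable def partitionSum (α : ℝ) (n : ℕ) (s : ℝ) : ℝ :=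
  ∑ᶠ S ∈ partitions α n, Real.exp (s * numSummands S)

section PartitionSum

variable {α : ℝ} (hα : 0 < α) (n : ℕ)
include hα

lemma mgf_numSummands (s : ℝ) :
    mgf numSummands (unif α n) s = partitionSum α n s / partitionSum α n 0 := by
  have hfin := partitions_finite hα n
  rw [mgf, unif, integral_uniformOn hfin, partitionSum, partitionSum,
    finsum_mem_eq_finite_toFinset_sum _ hfin, finsum_mem_eq_finite_toFinset_sum _ hfin,
    Set.ncard_eq_toFinset_card _ hfin]
  simp

lemma partitionSum_pos (hα1 : α ≤ 1) {n : ℕ} (hn : 1 ≤ n) (s : ℝ) : 0 < partitionSum α n s := by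
  rw [partitionSum, finsum_mem_eq_finite_toFinset_sum _ (partitions_finite hα n)]
  refine Finset.sum_pos (fun _ _ => Real.exp_pos _) ?_
  simpa using partitions_nonempty hα hα1 hn

omit hα in
lemma partitions_eq_image (α : ℝ) (n : ℕ) :
    partitions α n
      = (fun S => S.map (addRightEmbedding 1)) '' {S | ∑ a ∈ S, part α a = n} := by
  ext T
  constructor
  · rintro ⟨hT, hsum⟩
    have hpred : Set.InjOn (fun a => a - 1) T := fun a ha b hb hab => by
      have := hT a ha
      have := hT b hb
      simp only at hab
      omega
    refine ⟨T.image (fun a => a - 1), ?_, ?_⟩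
    · rw [Set.mem_ofPred_eq, Finset.sum_image hpred, ← hsum]
      exact Finset.sum_congr rfl fun a ha => part_pred α (hT a ha)
    · refine (Finset.map_eq_image _ _).trans ?_
      rw [Finset.image_image]
      refine (Finset.image_congr fun a ha => ?_).trans Finset.image_id
      exact Nat.sub_add_cancel (hT a ha)
  · rintro ⟨S, hS, rfl⟩
    refine ⟨fun a ha => ?_, ?_⟩
    · obtain ⟨b, -, rfl⟩ := Finset.mem_map.1 ha
      simp
    · rw [Finset.sum_map, ← hS]
      simp [part]

omit hα in
lemma partitionSum_eq_finsum (α : ℝ) (n : ℕ) (s : ℝ) :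
    partitionSum α n s = ∑ᶠ S ∈ {S | ∑ a ∈ S, part α a = n}, Real.exp (s * S.card) := by
  rw [partitionSum, partitions_eq_image,
    finsum_mem_image (Finset.map_injective (addRightEmbedding 1)).injOn]
  simp only [numSummands, Finset.card_map]

lemma eventually_partitionSum_eq (s : ℝ) :
    ∀ᶠ M in atTop, partitionSum α n s
      = ∑ S ∈ (Finset.range M).powerset with ∑ a ∈ S, part α a = n, Real.exp (s * S.card) := by
  obtain ⟨M₀, hM₀⟩ :=
    ((tendsto_part_atTop hα).eventually_gt_atTop n).exists_forall_of_atTop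
  filter_upwards [eventually_ge_atTop M₀] with M hM
  rw [partitionSum_eq_finsum, ← finsum_mem_coe_finset]
  congr! 3 with S
  refine ⟨fun hS => ?_, fun hS => (Finset.mem_filter.1 hS).2⟩
  rw [Finset.mem_coe, Finset.mem_filter, Finset.mem_powerset]
  refine ⟨fun a ha => Finset.mem_range.2 ?_, hS⟩
  have hle : part α a ≤ n := hS ▸ Finset.single_le_sum (fun _ _ => Nat.zero_le _) ha
  by_contra! hMa
  exact (hM₀ a (hM.trans hMa)).not_ge hle

end PartitionSum

section TiltedModel

lemma sigmoid_eq_exp_sub_softplus (u : ℝ) : Real.sigmoid u = Real.exp (u - softplus u) := by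
  rw [Real.exp_sub, exp_softplus, Real.sigmoid_def, Real.exp_neg]
  field_simp
  ring

lemma one_sub_sigmoid_eq_exp_neg_softplus (u : ℝ) :
    1 - Real.sigmoid u = Real.exp (-softplus u) := by
  rw [← Real.sigmoid_neg, sigmoid_neg_eq, Real.exp_neg, exp_softplus, add_comm, one_div]

lemma prod_sigmoid_mul_prod_one_sub {ι : Type*} [DecidableEq ι] {S s : Finset ι} (hS : S ⊆ s)
    (u : ι → ℝ) :
    (∏ i ∈ S, Real.sigmoid (u i)) * ∏ i ∈ s \ S, (1 - Real.sigmoid (u i))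
      = Real.exp (∑ i ∈ S, u i) * Real.exp (-∑ i ∈ s, softplus (u i)) := by
  simp only [one_sub_sigmoid_eq_exp_neg_softplus]
  simp only [sigmoid_eq_exp_sub_softplus]
  rw [← Real.exp_sum, ← Real.exp_sum, ← Real.exp_add, ← Real.exp_add, Finset.sum_sub_distrib,
    Finset.sum_neg_distrib, ← Finset.sum_sdiff hS]
  congr 1
  ring

lemma sum_tiltArg (α η s : ℝ) (S : Finset ℕ) :
    ∑ a ∈ S, tiltArg α η s a = -(η + s * slope α η) * ∑ a ∈ S, part α a + s * S.card := by
  rw [Nat.cast_sum, Finset.mul_sum, mul_comm s S.card, ← nsmul_eq_mul, ← Finset.sum_const,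
    ← Finset.sum_add_distrib]
  refine Finset.sum_congr rfl fun a _ => ?_
  rw [tiltArg, weight]
  ring

/-- The probability of size `n` in the tilted model, in which the parts are present independently
with log-odds `tiltArg α η s`. -/
noncomputable def tiltMass (α η s : ℝ) (n : ℕ) : ℝ :=
  Real.exp (-(η + s * slope α η) * n) * partitionSum α n s
    * Real.exp (-∑' a, softplus (tiltArg α η s a))

lemma eventually_bernMass_tiltArg_eq {α : ℝ} (hα : 0 < α) (η s : ℝ) (n : ℕ) :
    ∀ᶠ M in atTop, bernMass (Finset.range M) (fun a => Real.sigmoid (tiltArg α η s a)) (part α) n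
      = Real.exp (-(η + s * slope α η) * n) * partitionSum α n s
        * Real.exp (-∑ a ∈ Finset.range M, softplus (tiltArg α η s a)) := by
  filter_upwards [eventually_partitionSum_eq hα n s] with M hM
  rw [bernMass, hM, Finset.mul_sum, Finset.sum_mul]
  refine Finset.sum_congr rfl fun S hS => ?_
  obtain ⟨hSM, hSn⟩ := Finset.mem_filter.1 hS
  rw [prod_sigmoid_mul_prod_one_sub (Finset.mem_powerset.1 hSM), sum_tiltArg, hSn, Real.exp_add]

namespace TiltBounds

variable {α η C s : ℝ} (h : TiltBounds α η C) (hs : C * |s| ≤ 1 / 2) (hα : 0 < α)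
include h hs hα

lemma tendsto_bernMass (n : ℕ) :
    Tendsto (fun M => bernMass (Finset.range M) (fun a => Real.sigmoid (tiltArg α η s a))
      (part α) n) atTop (𝓝 (tiltMass α η s n)) := by
  have hsum := (h.summable_softplus_tiltArg hs hα).hasSum.tendsto_sum_nat
  refine Tendsto.congr' ?_ (((Real.continuous_exp.tendsto _).comp hsum.neg).const_mul _)
  filter_upwards [eventually_bernMass_tiltArg_eq hα η s n] with M hM
  exact hM.symm

lemma tendsto_sum_tiltMean : Tendsto (fun M => ∑ a ∈ Finset.range M,
    Real.sigmoid (tiltArg α η s a) * part α a) atTop (𝓝 (tiltMean α η s)) := by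
  simpa only [mul_comm, tiltMean] using (h.summable_tiltMean hs hα).hasSum.tendsto_sum_nat

lemma tendsto_sum_tiltMoment {j : ℕ} (hj : j ≤ 5) : Tendsto (fun M => ∑ a ∈ Finset.range M,
    Real.sigmoid (tiltArg α η s a) * (1 - Real.sigmoid (tiltArg α η s a)) * part α a ^ j) atTop
      (𝓝 (tiltMoment α η s j)) := by
  simpa only [mul_comm, ← Real.sigmoid_neg, tiltMoment, logisticDensity] using
    (h.summable_tiltMoment hs hα hj).hasSum.tendsto_sum_nat

/-- The local limit theorem for the size in the tilted model. -/
lemma abs_tiltMass_sub_le (hα1 : α ≤ 1) (n : ℕ) {θ₀ : ℝ} (hθ0 : 0 ≤ θ₀) (hθπ : θ₀ < Real.pi)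
    (hB : 0 < tiltMoment α η s 2) :
    |2 * Real.pi * tiltMass α η s n - √(2 * Real.pi / tiltMoment α η s 2)
        * Real.exp (-(n - tiltMean α η s) ^ 2 / (2 * tiltMoment α η s 2))|
      ≤ 10 * tiltMoment α η s 3 * θ₀ ^ 4
        + 2 * Real.pi * Real.exp (-(Real.exp (-25) / (4 * α * Real.pi ^ 2) * vol α η
          * min 1 ((θ₀ / η) ^ 2)))
        + Real.exp (-(θ₀ ^ 2 * tiltMoment α η s 2 / 4)) * √(4 * Real.pi / tiltMoment α η s 2) := by
  have hη := h.pos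
  have hV := vol_pos (α := α) hη
  have hmass := h.tendsto_bernMass hs hα n
  have hmean := h.tendsto_sum_tiltMean hs hα
  have hB2 := h.tendsto_sum_tiltMoment hs hα (j := 2) (by norm_num)
  have hB3 := h.tendsto_sum_tiltMoment hs hα (j := 3) (by norm_num)
  have hleft := ((hmass.const_mul (2 * Real.pi)).sub
    (((tendsto_const_nhds (x := 2 * Real.pi)).div hB2 hB.ne').sqrt.mul
      (((hmean.const_sub (n : ℝ)).pow 2).neg.div (hB2.const_mul 2) (by positivity)).rexp)).abs
  have hright := ((hB3.const_mul 10).mul_const (θ₀ ^ 4) |>.add_const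
    (2 * Real.pi * Real.exp (-(Real.exp (-25) / (4 * α * Real.pi ^ 2) * vol α η
      * min 1 ((θ₀ / η) ^ 2))))).add
    (((hB2.const_mul (θ₀ ^ 2)).div_const 4).neg.rexp.mul
      ((tendsto_const_nhds (x := 4 * Real.pi)).div hB2 hB.ne').sqrt)
  refine le_of_tendsto_of_tendsto hleft hright ?_
  filter_upwards [h.eventually_le_sum_one_sub_cos hs hα hα1, hB2.eventually_const_lt hB]
    with M hM hBM
  refine abs_bernMass_sub_le n (fun a => Real.sigmoid_nonneg _) (fun a => Real.sigmoid_le_one _)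
    hθ0 hθπ rfl rfl hBM fun θ hθ hθ' => ?_
  simp only [← Real.sigmoid_neg]
  refine le_trans ?_ (hM θ hθ')
  gcongr _ * min _ ?_
  rw [div_pow, div_pow, ← sq_abs θ]
  gcongr

end TiltBounds

end TiltedModel

section Elementary

lemma abs_log_le_two_mul {x : ℝ} (h : |x - 1| ≤ 1 / 2) : |Real.log x| ≤ 2 * |x - 1| := by
  have hx : 0 < x := by linarith [(abs_le.1 h).1]
  have hupper := Real.log_le_sub_one_of_pos hx
  have hlower := Real.one_sub_inv_le_log_of_pos hx
  have hinv : -(2 * |x - 1|) ≤ 1 - x⁻¹ := by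
    have hdiv : 1 - x⁻¹ = (x - 1) / x := by field_simp
    rw [hdiv, le_div_iff₀ hx]
    nlinarith [neg_abs_le (x - 1), abs_nonneg (x - 1)]
  exact abs_le.2 ⟨hinv.trans hlower, by linarith [le_abs_self (x - 1), abs_nonneg (x - 1)]⟩

lemma exp_neg_mul_sq_le {c U : ℝ} (hc : 0 < c) (hU : 0 < U) (j : ℕ) :
    Real.exp (-(c * U ^ 2)) ≤ j.factorial / c ^ j / U ^ (2 * j) := by
  have h := Real.pow_div_factorial_le_exp (x := c * U ^ 2) (by positivity) j
  rw [Real.exp_neg, inv_eq_one_div, div_div, div_le_div_iff₀ (Real.exp_pos _) (by positivity)]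
  rw [div_le_iff₀ (by positivity), mul_pow, ← pow_mul] at h
  linarith

lemma abs_sqrt_mul_sub_le {B T G E F : ℝ} (hB : 0 < B) (hE : 0 ≤ E) (hF : 0 ≤ F)
    (h : |2 * Real.pi * T - √(2 * Real.pi / B) * G| ≤ E + F * √(4 * Real.pi / B)) :
    |√(2 * Real.pi * B) * T - G| ≤ √B * E + 2 * F := by
  have hpi := Real.pi_pos
  have hN : √(B / (2 * Real.pi)) ≤ √B :=
    Real.sqrt_le_sqrt (div_le_self hB.le (by linarith [Real.pi_gt_three]))
  have hN4 : √(B / (2 * Real.pi)) * √(4 * Real.pi / B) ≤ 2 := by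
    rw [← Real.sqrt_mul (by positivity)]
    refine Real.sqrt_le_iff.2 ⟨zero_le_two, le_of_eq_of_le ?_ (by norm_num : (2 : ℝ) ≤ 2 ^ 2)⟩
    field_simp
    norm_num
  have hscale : √(2 * Real.pi * B) * T - G
      = √(B / (2 * Real.pi)) * (2 * Real.pi * T - √(2 * Real.pi / B) * G) := by
    have hsq := Real.sq_sqrt (show 0 ≤ 2 * Real.pi by positivity)
    rw [Real.sqrt_mul (by positivity), Real.sqrt_div hB.le, Real.sqrt_div (by positivity)]
    nth_rw 3 [← hsq]
    field_simp
  rw [hscale, abs_mul, abs_of_nonneg (Real.sqrt_nonneg _)]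
  calc √(B / (2 * Real.pi)) * |2 * Real.pi * T - √(2 * Real.pi / B) * G|
      ≤ √(B / (2 * Real.pi)) * (E + F * √(4 * Real.pi / B)) := by gcongr
    _ = √(B / (2 * Real.pi)) * E + √(B / (2 * Real.pi)) * √(4 * Real.pi / B) * F := by ring
    _ ≤ √B * E + 2 * F := by gcongr

lemma abs_log_add_log_div_two_le {B B₀ T a b : ℝ} (hB : 0 < B) (hB₀ : 0 < B₀)
    (hT : |√(2 * Real.pi * B) * T - 1| ≤ a) (ha : a ≤ 1 / 2) (hBB : |B / B₀ - 1| ≤ b)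
    (hb : b ≤ 1 / 2) :
    |Real.log T + Real.log (2 * Real.pi * B₀) / 2| ≤ 2 * a + b := by
  have := Real.pi_pos
  have hsqrt : 0 < √(2 * Real.pi * B) := Real.sqrt_pos.2 (by positivity)
  have hTpos : 0 < T :=
    pos_of_mul_pos_right (by linarith [(abs_le.1 (hT.trans ha)).1]) hsqrt.le
  have hlogT := abs_log_le_two_mul (hT.trans ha)
  have hlogB := abs_log_le_two_mul (hBB.trans hb)
  rw [Real.log_mul hsqrt.ne' hTpos.ne', Real.log_sqrt (by positivity),
    Real.log_mul (by positivity) hB.ne'] at hlogT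
  rw [Real.log_div hB.ne' hB₀.ne'] at hlogB
  rw [Real.log_mul (by positivity) hB₀.ne']
  rw [abs_le] at hlogT hlogB ⊢
  constructor <;> linarith

end Elementary

lemma inv_le_vol {α η : ℝ} (hα : 0 < α) (hα1 : α ≤ 1) (hη : 0 < η) (hη1 : η ≤ 1) :
    η⁻¹ ≤ vol α η := by
  rw [vol, ← Real.rpow_neg_one]
  exact Real.rpow_le_rpow_of_exponent_ge hη hη1 (neg_le_neg ((one_le_div₀ hα).2 hα1))

lemma tendsto_vol_atTop {α : ℝ} (hα : 0 < α) : Tendsto (vol α) (𝓝[>] 0) atTop :=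
  tendsto_rpow_neg_nhdsGT_zero (by simpa using hα)

namespace TiltBounds

section TiltedVariance

variable {α η C s : ℝ} (h : TiltBounds α η C) (hs : 4 * C ^ 3 * |s| ≤ 1)
include h hs

lemma mul_abs_le_half : C * |s| ≤ 1 / 2 := by
  have hC : C ≤ C ^ 3 := le_self_pow₀ h.one_le (by norm_num)
  nlinarith [abs_nonneg s]

variable (hα : 0 < α)
include hα

lemma abs_sq_mul_tiltMoment_two_sub_le :
    |η ^ 2 * tiltMoment α η s 2 - η ^ 2 * momentSum α η 2| ≤ 2 * C ^ 2 * |s| * vol α η := by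
  have hη := h.pos
  rw [← mul_sub, abs_mul, abs_of_pos (by positivity : 0 < η ^ 2), mul_comm]
  exact (le_div_iff₀ (by positivity)).1 (h.abs_tiltMoment_two_sub_le (h.mul_abs_le_half hs) hα)

lemma vol_le_mul_tiltMoment_two : vol α η ≤ 2 * C * (η ^ 2 * tiltMoment α η s 2) := by
  have hC := h.C_pos
  have hV := vol_pos (α := α) h.pos
  have hdiff := (abs_le.1 (h.abs_sq_mul_tiltMoment_two_sub_le hs hα)).1
  have hhalf : C * (2 * C ^ 2 * |s| * vol α η) ≤ vol α η / 2 := by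
    calc C * (2 * C ^ 2 * |s| * vol α η) = 4 * C ^ 3 * |s| * (vol α η / 2) := by ring
      _ ≤ vol α η / 2 := mul_le_of_le_one_left (by positivity) hs
  linarith [h.le_momentSum, mul_le_mul_of_nonneg_left hdiff hC.le]

lemma sq_mul_tiltMoment_two_le : η ^ 2 * tiltMoment α η s 2 ≤ 2 * C * vol α η := by
  have hC := h.one_le
  have hV := vol_pos (α := α) h.pos
  have hdiff := (abs_le.1 (h.abs_sq_mul_tiltMoment_two_sub_le hs hα)).2
  have hpow : C ^ 2 ≤ C ^ 3 := pow_le_pow_right₀ hC (by norm_num)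
  have hsmall : 2 * C ^ 2 * |s| ≤ C := by nlinarith [abs_nonneg s]
  linarith [h.momentSum_le, mul_le_mul_of_nonneg_right hsmall hV.le]

lemma tiltMoment_two_pos : 0 < tiltMoment α η s 2 := by
  have hη := h.pos
  have hprod := (vol_pos hη).trans_le (h.vol_le_mul_tiltMoment_two hs hα)
  exact pos_of_mul_pos_right (pos_of_mul_pos_right hprod (by linarith [h.C_pos])) (sq_nonneg η)

lemma abs_tiltMoment_two_div_sub_one_le :
    |tiltMoment α η s 2 / momentSum α η 2 - 1| ≤ 2 * C ^ 3 * |s| := by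
  have hη := h.pos
  have hC := h.C_pos
  have hM := momentSum_pos hα hη 2
  have hdiv : tiltMoment α η s 2 / momentSum α η 2 - 1
      = (η ^ 2 * tiltMoment α η s 2 - η ^ 2 * momentSum α η 2) / (η ^ 2 * momentSum α η 2) := by
    field_simp
  rw [hdiv, abs_div, abs_of_pos (by positivity : 0 < η ^ 2 * momentSum α η 2),
    div_le_iff₀ (by positivity)]
  calc _ ≤ 2 * C ^ 2 * |s| * vol α η := h.abs_sq_mul_tiltMoment_two_sub_le hs hα
    _ ≤ 2 * C ^ 2 * |s| * (C * (η ^ 2 * momentSum α η 2)) := by gcongr; exact h.le_momentSum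
    _ = _ := by ring

end TiltedVariance

-- Writing the volume as `U ^ 16` keeps all exponents integral: the local limit theorem is applied
-- with cut-off `η / U ^ 7` and tilt `|s| ≤ U ^ (-5)`, and every error is then `O(U ^ (-4))`.
section SixteenthRoot

variable {α η C s U : ℝ} (h : TiltBounds α η C) (hU : 4 * C ^ 3 ≤ U)
include h hU

lemma one_le_of_le : 1 ≤ U := by
  linarith [one_le_pow₀ h.one_le (n := 3)]

variable (hs : |s| * U ^ 5 ≤ 1)
include hs

lemma mul_abs_le_one_of_le : 4 * C ^ 3 * |s| ≤ 1 := by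
  have hU5 := le_self_pow₀ (h.one_le_of_le hU) (by norm_num : 5 ≠ 0)
  nlinarith [abs_nonneg s]

variable (hα : 0 < α) (hV : vol α η = U ^ 16)
include hα hV

lemma sqrt_tiltMoment_two_le : √(tiltMoment α η s 2) ≤ 2 * C * U ^ 8 / η := by
  have hη := h.pos
  have hC := h.one_le
  have hU1 := h.one_le_of_le hU
  have hle := h.sq_mul_tiltMoment_two_le (h.mul_abs_le_one_of_le hU hs) hα
  refine Real.sqrt_le_iff.2 ⟨by positivity, ?_⟩
  rw [div_pow, le_div_iff₀ (by positivity), mul_comm]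
  calc η ^ 2 * tiltMoment α η s 2 ≤ 2 * C * U ^ 16 := hV ▸ hle
    _ ≤ 2 * C * U ^ 16 * (2 * C) := le_mul_of_one_le_right (by positivity) (by linarith)
    _ = _ := by ring

lemma sqrt_mul_tiltMoment_three_le :
    √(tiltMoment α η s 2) * (10 * tiltMoment α η s 3 * (η / U ^ 7) ^ 4) ≤ 40 * C ^ 2 / U ^ 4 := by
  have hη := h.pos
  have hC := h.C_pos
  have hU1 := h.one_le_of_le hU
  have hthree := h.tiltMoment_three_le
    (h.mul_abs_le_half (h.mul_abs_le_one_of_le hU hs)) hα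
  calc √(tiltMoment α η s 2) * (10 * tiltMoment α η s 3 * (η / U ^ 7) ^ 4)
      ≤ √(tiltMoment α η s 2) * (10 * (2 * C * U ^ 16 / η ^ 3) * (η / U ^ 7) ^ 4) := by
        gcongr
        exact hV ▸ hthree
    _ ≤ 2 * C * U ^ 8 / η * (10 * (2 * C * U ^ 16 / η ^ 3) * (η / U ^ 7) ^ 4) := by
        gcongr
        exact h.sqrt_tiltMoment_two_le hU hs hα hV
    _ = 40 * C ^ 2 / U ^ 4 := by field_simp; ring

lemma sqrt_mul_exp_neg_min_le (hα1 : α ≤ 1) {c : ℝ} (hc : 0 < c) :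
    √(tiltMoment α η s 2)
        * (2 * Real.pi * Real.exp (-(c * vol α η * min 1 ((η / U ^ 7 / η) ^ 2))))
      ≤ 4 * Real.pi * C * ((14 : ℕ).factorial / c ^ 14) / U ^ 4 := by
  have hη := h.pos
  have hC := h.C_pos
  have hU1 := h.one_le_of_le hU
  have hmin : c * vol α η * min 1 ((η / U ^ 7 / η) ^ 2) = c * U ^ 2 := by
    have hsq : (η / U ^ 7 / η) ^ 2 = 1 / U ^ 14 := by field_simp
    rw [hsq, min_eq_right ((div_le_one (by positivity)).2 (one_le_pow₀ hU1)), hV]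
    field_simp
  have hsqrt : √(tiltMoment α η s 2) ≤ 2 * C * U ^ 24 := by
    calc √(tiltMoment α η s 2) ≤ 2 * C * U ^ 8 / η := h.sqrt_tiltMoment_two_le hU hs hα hV
      _ = 2 * C * U ^ 8 * η⁻¹ := div_eq_mul_inv _ _
      _ ≤ 2 * C * U ^ 8 * U ^ 16 := by gcongr; exact hV ▸ inv_le_vol hα hα1 hη h.le_one
      _ = 2 * C * U ^ 24 := by ring
  rw [hmin]
  calc √(tiltMoment α η s 2) * (2 * Real.pi * Real.exp (-(c * U ^ 2)))
      ≤ 2 * C * U ^ 24 * (2 * Real.pi * ((14 : ℕ).factorial / c ^ 14 / U ^ (2 * 14))) := by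
        gcongr
        exact exp_neg_mul_sq_le hc (by positivity) 14
    _ = _ := by field_simp; ring

lemma exp_neg_sq_mul_tiltMoment_two_le :
    Real.exp (-((η / U ^ 7) ^ 2 * tiltMoment α η s 2 / 4)) ≤ 128 * C ^ 2 / U ^ 4 := by
  have hη := h.pos
  have hC := h.C_pos
  have hU1 := h.one_le_of_le hU
  have hle := h.vol_le_mul_tiltMoment_two (h.mul_abs_le_one_of_le hU hs) hα
  have hexp : 1 / (8 * C) * U ^ 2 ≤ (η / U ^ 7) ^ 2 * tiltMoment α η s 2 / 4 := by
    rw [hV] at hle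
    have hB : (η / U ^ 7) ^ 2 * tiltMoment α η s 2 / 4
        = 2 * C * (η ^ 2 * tiltMoment α η s 2) / (8 * C * U ^ 14) := by
      field_simp
      ring
    rw [hB]
    calc 1 / (8 * C) * U ^ 2 = U ^ 16 / (8 * C * U ^ 14) := by field_simp
      _ ≤ _ := by gcongr
  calc Real.exp (-((η / U ^ 7) ^ 2 * tiltMoment α η s 2 / 4))
      ≤ Real.exp (-(1 / (8 * C) * U ^ 2)) := by gcongr
    _ ≤ (2 : ℕ).factorial / (1 / (8 * C)) ^ 2 / U ^ (2 * 2) :=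
        exp_neg_mul_sq_le (by positivity) (by positivity) 2
    _ = 128 * C ^ 2 / U ^ 4 := by
        rw [Nat.factorial_two]
        field_simp
        norm_num
        ring

lemma abs_exp_neg_sq_div_sub_one_le {n : ℕ} (hn : meanSize α η = n) :
    |Real.exp (-(n - tiltMean α η s) ^ 2 / (2 * tiltMoment α η s 2)) - 1|
      ≤ 4 * C ^ 7 / U ^ 4 := by
  have hη := h.pos
  have hC := h.C_pos
  have hU1 := h.one_le_of_le hU
  have hsmall := h.mul_abs_le_one_of_le hU hs
  have hB := h.tiltMoment_two_pos hsmall hα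
  have hvar : U ^ 16 ≤ _ := hV ▸ h.vol_le_mul_tiltMoment_two hsmall hα
  have hmean : |(n : ℝ) - tiltMean α η s| ≤ 2 * C ^ 3 * U ^ 6 / η := by
    rw [abs_sub_comm, ← hn]
    calc _ ≤ 2 * C ^ 3 * |s| ^ 2 * vol α η / η :=
          h.abs_tiltMean_sub_le (h.mul_abs_le_half hsmall) hα
      _ = 2 * C ^ 3 * (|s| * U ^ 5) ^ 2 * U ^ 6 / η := by rw [hV]; ring
      _ ≤ 2 * C ^ 3 * 1 ^ 2 * U ^ 6 / η := by gcongr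
      _ = 2 * C ^ 3 * U ^ 6 / η := by rw [one_pow, mul_one]
  have hratio : (n - tiltMean α η s) ^ 2 / (2 * tiltMoment α η s 2) ≤ 4 * C ^ 7 / U ^ 4 := by
    rw [div_le_div_iff₀ (by positivity) (by positivity), ← sq_abs]
    calc |n - tiltMean α η s| ^ 2 * U ^ 4 ≤ (2 * C ^ 3 * U ^ 6 / η) ^ 2 * U ^ 4 := by gcongr
      _ = 4 * C ^ 6 * U ^ 16 / η ^ 2 := by field_simp; ring
      _ ≤ 4 * C ^ 6 * (2 * C * (η ^ 2 * tiltMoment α η s 2)) / η ^ 2 := by gcongr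
      _ = _ := by field_simp
  have hnonneg : 0 ≤ (n - tiltMean α η s) ^ 2 / (2 * tiltMoment α η s 2) := by positivity
  rw [neg_div, abs_sub_comm, abs_of_nonneg (sub_nonneg.2 (Real.exp_le_one_iff.2 (by linarith)))]
  linarith [Real.add_one_le_exp (-((n - tiltMean α η s) ^ 2 / (2 * tiltMoment α η s 2)))]

end SixteenthRoot

lemma exists_abs_sqrt_mul_tiltMass_sub_one_le {α : ℝ} (hα : 0 < α) (hα1 : α ≤ 1) (C : ℝ) :
    ∃ A : ℝ, ∀ (η U s : ℝ) (n : ℕ), TiltBounds α η C → 4 * C ^ 3 ≤ U → |s| * U ^ 5 ≤ 1 →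
      vol α η = U ^ 16 → meanSize α η = n →
      |√(2 * Real.pi * tiltMoment α η s 2) * tiltMass α η s n - 1| ≤ A / U ^ 4 := by
  set c := Real.exp (-25) / (4 * α * Real.pi ^ 2)
  refine ⟨40 * C ^ 2 + 4 * Real.pi * C * ((14 : ℕ).factorial / c ^ 14) + 2 * (128 * C ^ 2)
    + 4 * C ^ 7, fun η U s n h hU hs hV hn => ?_⟩
  have hη := h.pos
  have hU1 := h.one_le_of_le hU
  have hsmall := h.mul_abs_le_one_of_le hU hs
  have hB := h.tiltMoment_two_pos hsmall hα
  have hcut : η / U ^ 7 < Real.pi := by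
    have : η / U ^ 7 ≤ η := div_le_self hη.le (one_le_pow₀ hU1)
    linarith [h.le_one, Real.pi_gt_three]
  have hthree : 0 ≤ tiltMoment α η s 3 := tsum_nonneg fun a =>
    mul_nonneg (by positivity) (logisticDensity_pos _).le
  have hlocal := abs_sqrt_mul_sub_le hB (by positivity) (by positivity)
    (h.abs_tiltMass_sub_le (h.mul_abs_le_half hsmall) hα hα1 n (by positivity) hcut hB)
  have hcubic := h.sqrt_mul_tiltMoment_three_le hU hs hα hV
  have harc := h.sqrt_mul_exp_neg_min_le hU hs hα hV hα1 (show 0 < c by positivity)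
  have htail := h.exp_neg_sq_mul_tiltMoment_two_le hU hs hα hV
  have hgauss := h.abs_exp_neg_sq_div_sub_one_le hU hs hα hV hn
  refine (abs_sub_le _ _ _).trans ((add_le_add hlocal hgauss).trans ?_)
  rw [mul_add, add_div, add_div, add_div, mul_div_assoc 2]
  gcongr

lemma exists_abs_log_tiltMass_add_le {α : ℝ} (hα : 0 < α) (hα1 : α ≤ 1) (C : ℝ) :
    ∃ A : ℝ, ∀ (η U s : ℝ) (n : ℕ), TiltBounds α η C → A ≤ U → |s| * U ^ 5 ≤ 1 →
      vol α η = U ^ 16 → meanSize α η = n →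
      |Real.log (tiltMass α η s n) + Real.log (2 * Real.pi * momentSum α η 2) / 2|
        ≤ A / U ^ 4 := by
  obtain ⟨A, hA⟩ := exists_abs_sqrt_mul_tiltMass_sub_one_le hα hα1 C
  refine ⟨2 * |A| + 4 * C ^ 3, fun η U s n h hAU hs hV hn => ?_⟩
  have hC := h.C_pos
  have hU : 4 * C ^ 3 ≤ U := by linarith [abs_nonneg A]
  have hU1 := h.one_le_of_le hU
  have hsmall := h.mul_abs_le_one_of_le hU hs
  have hU4 : U ≤ U ^ 4 := le_self_pow₀ hU1 (by norm_num)
  have hs4 : |s| ≤ 1 / U ^ 4 := by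
    rw [le_div_iff₀ (by positivity)]
    refine le_trans ?_ hs
    gcongr
    norm_num
  have hmass : |√(2 * Real.pi * tiltMoment α η s 2) * tiltMass α η s n - 1| ≤ |A| / U ^ 4 :=
    (hA η U s n h hU hs hV hn).trans (by gcongr; exact le_abs_self A)
  have hA4 : |A| / U ^ 4 ≤ 1 / 2 := by
    rw [div_le_div_iff₀ (by positivity) two_pos]
    linarith [pow_pos hC 3]
  calc _ ≤ 2 * (|A| / U ^ 4) + 2 * C ^ 3 * |s| :=
        abs_log_add_log_div_two_le (h.tiltMoment_two_pos hsmall hα) (momentSum_pos hα h.pos 2)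
          hmass hA4 (h.abs_tiltMoment_two_div_sub_one_le hsmall hα) (by linarith)
    _ ≤ 2 * (|A| / U ^ 4) + 4 * C ^ 3 * (1 / U ^ 4) := by gcongr; norm_num
    _ = _ := by ring

lemma log_mgf_numSummands {α η C s : ℝ} (h : TiltBounds α η C) (hs : C * |s| ≤ 1 / 2)
    (hα : 0 < α) (hα1 : α ≤ 1) {n : ℕ} (hn : 1 ≤ n) :
    Real.log (mgf numSummands (unif α n) s)
      = Real.log (tiltMass α η s n) - Real.log (tiltMass α η 0 n) + s * slope α η * n
        + tiltCumulant α η s := by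
  have hZ : ∀ t, 0 < partitionSum α n t := partitionSum_pos hα hα1 hn
  have hlog : ∀ t, Real.log (tiltMass α η t n) = -(η + t * slope α η) * n
      + Real.log (partitionSum α n t) - ∑' a, softplus (tiltArg α η t a) := fun t => by
    rw [tiltMass, Real.log_mul (mul_ne_zero (Real.exp_ne_zero _) (hZ t).ne') (Real.exp_ne_zero _),
      Real.log_mul (Real.exp_ne_zero _) (hZ t).ne', Real.log_exp, Real.log_exp]
    ring
  have hcum : tiltCumulant α η s
      = ∑' a, softplus (tiltArg α η s a) - ∑' a, softplus (tiltArg α η 0 a) := by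
    rw [← (h.summable_softplus_tiltArg hs hα).tsum_sub
      (h.summable_softplus_tiltArg (s := 0) (by simp) hα)]
    simp [tiltCumulant, tiltArg]
  rw [mgf_numSummands hα, Real.log_div (hZ s).ne' (hZ 0).ne', hlog, hlog, hcum]
  ring

lemma exists_abs_log_mgf_sub_le {α : ℝ} (hα : 0 < α) (hα1 : α ≤ 1) (C : ℝ) :
    ∃ A : ℝ, ∀ (η U s : ℝ) (n : ℕ), TiltBounds α η C → A ≤ U → |s| * U ^ 5 ≤ 1 →
      vol α η = U ^ 16 → 1 ≤ n → meanSize α η = n →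
      |Real.log (mgf numSummands (unif α n) s) - (s * mu α η + s ^ 2 * sigmaSq α η / 2)|
        ≤ A * (|s| ^ 3 * vol α η + 1 / U ^ 4) := by
  obtain ⟨A, hA⟩ := exists_abs_log_tiltMass_add_le hα hα1 C
  refine ⟨2 * |A| + 4 * C ^ 3 + 2 * C ^ 4, fun η U s n h hAU hs hV hn hmean => ?_⟩
  have hC := h.C_pos
  have hC3 : 0 < C ^ 3 := by positivity
  have hC4 : 0 < C ^ 4 := by positivity
  have hU : 4 * C ^ 3 ≤ U := by linarith [abs_nonneg A]
  have hU1 := h.one_le_of_le hU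
  have hhalf := h.mul_abs_le_half (h.mul_abs_le_one_of_le hU hs)
  have hAU' : A ≤ U := by linarith [le_abs_self A, abs_nonneg A]
  have htilt := abs_le.1 (hA η U s n h hAU' hs hV hmean)
  have hzero := abs_le.1 (hA η U 0 n h hAU' (by simp) hV hmean)
  have hcum := abs_le.1 (hmean ▸ h.abs_tiltCumulant_sub_le hhalf hα)
  have hV0 := vol_pos (α := α) h.pos
  have hbound : 2 * (A / U ^ 4) + 2 * C ^ 4 * |s| ^ 3 * vol α η
      ≤ (2 * |A| + 4 * C ^ 3 + 2 * C ^ 4) * (|s| ^ 3 * vol α η + 1 / U ^ 4) := by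
    calc 2 * (A / U ^ 4) + 2 * C ^ 4 * |s| ^ 3 * vol α η
        = 2 * A * (1 / U ^ 4) + 2 * C ^ 4 * (|s| ^ 3 * vol α η) := by ring
      _ ≤ (2 * |A| + 4 * C ^ 3 + 2 * C ^ 4) * (1 / U ^ 4)
          + (2 * |A| + 4 * C ^ 3 + 2 * C ^ 4) * (|s| ^ 3 * vol α η) := by
          gcongr
          · linarith [le_abs_self A]
          · linarith [abs_nonneg A]
      _ = _ := by ring
  rw [log_mgf_numSummands h hhalf hα hα1 hn]
  refine (abs_le.2 ⟨?_, ?_⟩ : |_| ≤ 2 * (A / U ^ 4) + 2 * C ^ 4 * |s| ^ 3 * vol α η).trans hbound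
    <;> linarith

end TiltBounds

theorem exists_log_mgf_bound {α : ℝ} (hα : 0 < α) (hα1 : α ≤ 1) :
    ∃ A : ℝ, 0 ≤ A ∧ ∀ᶠ η in 𝓝[>] 0, ∀ n : ℕ, 1 ≤ n → meanSize α η = n → ∀ s : ℝ,
      |s| * vol α η ^ (5 / 16 : ℝ) ≤ 1 →
      |Real.log (mgf numSummands (unif α n) s) - (s * mu α η + s ^ 2 * sigmaSq α η / 2)|
        ≤ A * (|s| ^ 3 * vol α η + vol α η ^ (-(1 / 4) : ℝ)) := by
  obtain ⟨C, hC⟩ := exists_tiltBounds hα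
  obtain ⟨A, hA⟩ := TiltBounds.exists_abs_log_mgf_sub_le hα hα1 C
  refine ⟨|A|, abs_nonneg A, ?_⟩
  filter_upwards [hC, ((tendsto_rpow_atTop (by norm_num : 0 < (1 / 16 : ℝ))).comp
    (tendsto_vol_atTop hα)).eventually_ge_atTop A] with η h hAU n hn hmean s hs
  have hV := vol_pos (α := α) h.pos
  have hpow (j : ℕ) : (vol α η ^ (1 / 16 : ℝ)) ^ j = vol α η ^ (1 / 16 * j : ℝ) := by
    rw [← Real.rpow_natCast, ← Real.rpow_mul hV.le]
  have hV16 : vol α η = (vol α η ^ (1 / 16 : ℝ)) ^ 16 := by rw [hpow]; norm_num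
  have hV5 : vol α η ^ (5 / 16 : ℝ) = (vol α η ^ (1 / 16 : ℝ)) ^ 5 := by rw [hpow]; norm_num
  have hV4 : vol α η ^ (-(1 / 4) : ℝ) = 1 / (vol α η ^ (1 / 16 : ℝ)) ^ 4 := by
    rw [hpow, Real.rpow_neg hV.le, one_div]
    norm_num
  rw [hV4]
  refine (hA η (vol α η ^ (1 / 16 : ℝ)) s n h hAU (hV5 ▸ hs) hV16 hn hmean).trans ?_
  gcongr
  exact le_abs_self A

section WeakConvergence

open BoundedContinuousFunction

variable {E : Type*} [TopologicalSpace E] {f : E → ℝ}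

lemma exists_boundedContinuous_abs_sub_le (hf : Continuous f) {K : ℝ} (hK : 0 < K) :
    ∃ g : E →ᵇ ℝ, ∀ x, |f x - g x| ≤ f x ^ 2 / K := by
  refine ⟨.ofNormedAddCommGroup (fun x => max (-K) (min K (f x))) (by fun_prop) K fun x => ?_,
    fun x => ?_⟩
  · exact abs_le.2 ⟨le_max_left _ _, max_le (by linarith) (min_le_left _ _)⟩
  · simp only [coe_ofNormedAddCommGroup]
    rw [le_div_iff₀ hK]
    rcases le_total K (f x) with h | h
    · rw [min_eq_left h, max_eq_right (by linarith), abs_of_nonneg (by linarith)]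
      nlinarith
    rcases le_total (f x) (-K) with h' | h'
    · rw [min_eq_right h, max_eq_left h', abs_of_nonpos (by linarith)]
      nlinarith
    · rw [min_eq_right h, max_eq_right h', sub_self, abs_zero, zero_mul]
      positivity

variable [MeasurableSpace E] [OpensMeasurableSpace E]

lemma abs_integral_sub_integral_le {P : Measure E} [IsProbabilityMeasure P] {K : ℝ}
    (hf : Continuous f) (hi : Integrable (fun x => f x ^ 2) P) {g : E →ᵇ ℝ}
    (hg : ∀ x, |f x - g x| ≤ f x ^ 2 / K) :
    |∫ x, f x ∂P - ∫ x, g x ∂P| ≤ (∫ x, f x ^ 2 ∂P) / K := by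
  have hfi : Integrable f P :=
    ((memLp_two_iff_integrable_sq hf.aestronglyMeasurable).2 hi).integrable one_le_two
  rw [← integral_sub hfi (g.integrable P), ← integral_div]
  exact (abs_integral_le_integral_abs).trans
    (integral_mono (hfi.sub (g.integrable P)).abs (hi.div_const K) hg)

variable [HasOuterApproxClosed E] {P : ℕ → ProbabilityMeasure E} {Q : ProbabilityMeasure E} {B : ℝ}

lemma lintegral_le_of_tendsto (h : Tendsto P atTop (𝓝 Q)) (hf : Continuous f) (hf0 : 0 ≤ f)
    (hi : ∀ n, Integrable f (P n)) (hB : ∀ n, ∫ x, f x ∂(P n) ≤ B) :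
    ∫⁻ x, ENNReal.ofReal (f x) ∂Q ≤ ENNReal.ofReal B := by
  refine (lintegral_le_liminf_lintegral_of_forall_isOpen_measure_le_liminf_measure hf hf0
    fun G hG => ProbabilityMeasure.le_liminf_measure_open_of_tendsto h hG).trans ?_
  refine (liminf_le_liminf (Eventually.of_forall fun n => ?_)).trans_eq (liminf_const _)
  rw [← ofReal_integral_eq_lintegral_ofReal (hi n) (ae_of_all _ hf0)]
  exact ENNReal.ofReal_le_ofReal (hB n)

lemma integrable_of_tendsto (h : Tendsto P atTop (𝓝 Q)) (hf : Continuous f) (hf0 : 0 ≤ f)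
    (hi : ∀ n, Integrable f (P n)) (hB : ∀ n, ∫ x, f x ∂(P n) ≤ B) : Integrable f Q :=
  (lintegral_ofReal_ne_top_iff_integrable hf.aestronglyMeasurable (ae_of_all _ hf0)).1
    ((lintegral_le_of_tendsto h hf hf0 hi hB).trans_lt ENNReal.ofReal_lt_top).ne

lemma integral_le_of_tendsto (h : Tendsto P atTop (𝓝 Q)) (hf : Continuous f) (hf0 : 0 ≤ f)
    (hi : ∀ n, Integrable f (P n)) (hB : ∀ n, ∫ x, f x ∂(P n) ≤ B) : ∫ x, f x ∂Q ≤ B := by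
  have hB0 : 0 ≤ B := (integral_nonneg hf0).trans (hB 0)
  rw [← ENNReal.ofReal_le_ofReal_iff hB0, ofReal_integral_eq_lintegral_ofReal
    (integrable_of_tendsto h hf hf0 hi hB) (ae_of_all _ hf0)]
  exact lintegral_le_of_tendsto h hf hf0 hi hB

lemma tendsto_integral_of_integral_sq_le (h : Tendsto P atTop (𝓝 Q)) (hf : Continuous f)
    (hi : ∀ n, Integrable (fun x => f x ^ 2) (P n)) (hB : ∀ n, ∫ x, f x ^ 2 ∂(P n) ≤ B) :
    Tendsto (fun n => ∫ x, f x ∂(P n)) atTop (𝓝 (∫ x, f x ∂Q)) := by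
  have hf2 : Continuous fun x => f x ^ 2 := hf.pow 2
  have hf0 : 0 ≤ fun x => f x ^ 2 := fun x => sq_nonneg _
  have hiQ : Integrable (fun x => f x ^ 2) Q := integrable_of_tendsto h hf2 hf0 hi hB
  have hBQ : ∫ x, f x ^ 2 ∂Q ≤ B := integral_le_of_tendsto h hf2 hf0 hi hB
  have hB0 : 0 ≤ B := (integral_nonneg hf0).trans (hB 0)
  rw [Metric.tendsto_nhds]
  intro ε hε
  obtain ⟨K, hK, hKε⟩ : ∃ K > 0, B / K < ε / 3 :=
    ⟨4 * (B + 1) / ε, by positivity, by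
      rw [div_div_eq_mul_div, div_lt_iff₀ (by positivity)]; nlinarith⟩
  obtain ⟨g, hg⟩ := exists_boundedContinuous_abs_sub_le hf hK
  have hgQ : |∫ x, f x ∂Q - ∫ x, g x ∂Q| ≤ B / K :=
    (abs_integral_sub_integral_le hf hiQ hg).trans (by gcongr)
  filter_upwards [Metric.tendsto_nhds.1
    (ProbabilityMeasure.tendsto_iff_forall_integral_tendsto.1 h g) (ε / 3) (by positivity)]
    with n hn
  have hgP : |∫ x, f x ∂(P n) - ∫ x, g x ∂(P n)| ≤ B / K :=
    (abs_integral_sub_integral_le hf (hi n) hg).trans (by gcongr; exact hB n)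
  rw [Real.dist_eq] at hn ⊢
  rw [abs_lt] at hn ⊢
  rw [abs_le] at hgQ hgP
  constructor <;> linarith

end WeakConvergence

section MgfConvergence

variable {P : ℕ → ProbabilityMeasure ℝ} {Q : ProbabilityMeasure ℝ}

lemma measureReal_norm_gt_le {P : Measure ℝ} [IsProbabilityMeasure P]
    (hP : ∀ t, Integrable (fun x => Real.exp (t * x)) P) (r : ℝ) :
    P.real {x | r < ‖x‖} ≤ Real.exp (-r) * (mgf id P 1 + mgf id P (-1)) := by
  have hsub : {x : ℝ | r < ‖x‖} ⊆ {x | r ≤ id x} ∪ {x | id x ≤ -r} := fun x hx =>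
    (lt_abs.1 (show r < |x| from hx)).imp (fun h => h.le) fun h => show x ≤ -r by linarith
  calc P.real {x | r < ‖x‖} ≤ P.real {x | r ≤ id x} + P.real {x | id x ≤ -r} :=
        (measureReal_mono hsub).trans (measureReal_union_le _ _)
    _ ≤ Real.exp (-1 * r) * mgf id P 1 + Real.exp (- -1 * -r) * mgf id P (-1) :=
        add_le_add (measure_ge_le_exp_mul_mgf r zero_le_one (hP 1))
          (measure_le_le_exp_mul_mgf (-r) (by norm_num) (hP (-1)))
    _ = Real.exp (-r) * (mgf id P 1 + mgf id P (-1)) := by ring_nf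

section

variable (hP : ∀ n t, Integrable (fun x => Real.exp (t * x)) (P n : Measure ℝ))
include hP

lemma isTightMeasureSet_of_bddAbove_mgf
    (h : ∀ t, BddAbove (Set.range fun n => mgf id (P n : Measure ℝ) t)) :
    IsTightMeasureSet {(P n : Measure ℝ) | n} := by
  obtain ⟨B, hB⟩ := h 1
  obtain ⟨B', hB'⟩ := h (-1)
  have hlim : Tendsto (fun r : ℝ => ENNReal.ofReal (Real.exp (-r) * (B + B'))) atTop (𝓝 0) := by
    simpa using ENNReal.tendsto_ofReal (Real.tendsto_exp_neg_atTop_nhds_zero.mul_const (B + B'))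
  refine isTightMeasureSet_of_tendsto_measure_norm_gt
    (tendsto_of_tendsto_of_tendsto_of_le_of_le tendsto_const_nhds hlim (fun _ => zero_le) ?_)
  refine fun r => iSup₂_le ?_
  rintro _ ⟨n, rfl⟩
  rw [← ofReal_measureReal]
  refine ENNReal.ofReal_le_ofReal ((measureReal_norm_gt_le (hP n) r).trans ?_)
  gcongr
  · exact hB ⟨n, rfl⟩
  · exact hB' ⟨n, rfl⟩

/- The square of `exp (t x)` is `exp (2 t x)`, whose integrals stay bounded. -/
lemma tendsto_mgf_of_tendsto (h : Tendsto P atTop (𝓝 Q))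
    (hb : ∀ t, BddAbove (Set.range fun n => mgf id (P n : Measure ℝ) t)) (t : ℝ) :
    Tendsto (fun n => mgf id (P n : Measure ℝ) t) atTop (𝓝 (mgf id (Q : Measure ℝ) t)) := by
  obtain ⟨B, hB⟩ := hb (2 * t)
  have hsq : (fun x => Real.exp (t * x) ^ 2) = fun x => Real.exp (2 * t * x) := by
    funext x
    rw [← Real.exp_nat_mul, Nat.cast_two, mul_assoc]
  refine tendsto_integral_of_integral_sq_le (f := fun x => Real.exp (t * x)) (B := B) h
    (by fun_prop) (fun n => ?_) fun n => ?_
  · rw [hsq]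
    exact hP n (2 * t)
  · rw [hsq]
    exact hB ⟨n, rfl⟩

/-- Curtiss's theorem. -/
theorem tendsto_of_tendsto_mgf (hQ : ∀ t, Integrable (fun x => Real.exp (t * x)) (Q : Measure ℝ))
    (h : ∀ t, Tendsto (fun n => mgf id (P n : Measure ℝ) t) atTop (𝓝 (mgf id (Q : Measure ℝ) t))) :
    Tendsto P atTop (𝓝 Q) := by
  have hb : ∀ t, BddAbove (Set.range fun n => mgf id (P n : Measure ℝ) t) :=
    fun t => (h t).bddAbove_range
  have hcpt : IsCompact (closure (Set.range P)) :=
    isCompact_closure_of_isTightMeasureSet (by simpa using isTightMeasureSet_of_bddAbove_mgf hP hb)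
  refine tendsto_of_subseq_tendsto fun k hk => ?_
  obtain ⟨ν, -, φ, hφ, hν⟩ := hcpt.isSeqCompact fun n => subset_closure ⟨k n, rfl⟩
  have hkφ : Tendsto (k ∘ φ) atTop atTop := hk.comp hφ.tendsto_atTop
  have hbφ : ∀ t, BddAbove (Set.range fun n => mgf id (P (k (φ n)) : Measure ℝ) t) := fun t =>
    ((h t).comp hkφ).bddAbove_range
  have hmgf : mgf id (Q : Measure ℝ) = mgf id (ν : Measure ℝ) := funext fun t =>
    tendsto_nhds_unique ((h t).comp hkφ) (tendsto_mgf_of_tendsto (fun n => hP _) hν hbφ t)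
  have hset : integrableExpSet id (Q : Measure ℝ) = Set.univ := Set.eq_univ_of_forall hQ
  have hc : complexMGF id (Q : Measure ℝ) = complexMGF id (ν : Measure ℝ) :=
    funext fun z => eqOn_complexMGF_of_mgf hmgf (by simp [hset])
  have hQν : (Q : Measure ℝ) = ν := Measure.ext_of_complexMGF_id_eq hc
  obtain rfl : Q = ν := Subtype.ext hQν
  exact ⟨φ, hν⟩

lemma tendsto_integral_pow_of_tendsto (h : Tendsto P atTop (𝓝 Q))
    (hb : ∀ t, BddAbove (Set.range fun n => mgf id (P n : Measure ℝ) t)) (k : ℕ) :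
    Tendsto (fun n => ∫ x, x ^ k ∂(P n)) atTop (𝓝 (∫ x, x ^ k ∂(Q : Measure ℝ))) := by
  obtain ⟨B, hB⟩ := hb 1
  obtain ⟨B', hB'⟩ := hb (-1)
  have hle : ∀ x : ℝ, (x ^ k) ^ 2 ≤
      (2 * k).factorial * (Real.exp (1 * x) + Real.exp (-1 * x)) := fun x => by
    have h := Real.pow_div_factorial_le_exp |x| (abs_nonneg x) (2 * k)
    rw [div_le_iff₀' (by positivity), mul_comm 2 k, pow_mul, ← abs_pow, sq_abs] at h
    rw [mul_comm 2 k]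
    refine h.trans (mul_le_mul_of_nonneg_left ?_ (by positivity))
    simpa using Real.exp_abs_le x
  have hdom : ∀ n, Integrable
      (fun x => (2 * k).factorial * (Real.exp (1 * x) + Real.exp (-1 * x))) (P n : Measure ℝ) :=
    fun n => ((hP n 1).add (hP n (-1))).const_mul _
  have hi : ∀ n, Integrable (fun x => (x ^ k) ^ 2) (P n : Measure ℝ) := fun n =>
    (hdom n).mono' (by fun_prop) (ae_of_all _ fun x => by
      rw [Real.norm_of_nonneg (by positivity)]
      exact hle x)
  refine tendsto_integral_of_integral_sq_le (B := (2 * k).factorial * (B + B')) h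
    (continuous_pow k) hi fun n => (integral_mono (hi n) (hdom n) hle).trans ?_
  rw [integral_const_mul, integral_add (hP n 1) (hP n (-1))]
  gcongr
  · exact hB ⟨n, rfl⟩
  · exact hB' ⟨n, rfl⟩

end

end MgfConvergence

section Polya

variable {F : ℕ → ℝ → ℝ} {G : ℝ → ℝ}

lemma exists_Ioo_lt_add (hGc : Continuous G) {ε : ℝ} (hε : 0 < ε) (x : ℝ) :
    ∃ c d, x ∈ Set.Ioo c d ∧ G d < G c + ε := by
  obtain ⟨δ, hδ, hG⟩ := Metric.continuous_iff.1 hGc x (ε / 2) (by positivity)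
  have hδ2 : |δ / 2| < δ := by rw [abs_of_pos] <;> linarith
  have hc := hG (x - δ / 2) (by rwa [Real.dist_eq, sub_sub_cancel_left, abs_neg])
  have hd := hG (x + δ / 2) (by rwa [Real.dist_eq, add_sub_cancel_left])
  rw [Real.dist_eq, abs_lt] at hc hd
  exact ⟨x - δ / 2, x + δ / 2, ⟨by linarith, by linarith⟩, by linarith⟩

lemma exists_finset_forall_lt_add (hG : Monotone G) (hGc : Continuous G)
    (hG0 : Tendsto G atBot (𝓝 0)) (hG1 : Tendsto G atTop (𝓝 1)) {ε : ℝ} (hε : 0 < ε) :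
    ∃ s : Finset ℝ, ∀ x, (G x < ε ∨ ∃ c ∈ s, c ≤ x ∧ G x < G c + ε) ∧
      (1 < G x + ε ∨ ∃ d ∈ s, x ≤ d ∧ G d < G x + ε) := by
  obtain ⟨a, ha⟩ := (hG0.eventually_lt_const hε).exists
  obtain ⟨b, hb⟩ := (hG1.eventually_const_lt (sub_lt_self 1 hε)).exists
  choose c d hmem hcd using exists_Ioo_lt_add hGc hε
  obtain ⟨t, -, ht⟩ := (isCompact_Icc (a := a) (b := b)).elim_nhds_subcover
    (fun x => Set.Ioo (c x) (d x)) fun x _ => isOpen_Ioo.mem_nhds (hmem x)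
  refine ⟨insert a (insert b (t.image c ∪ t.image d)), fun x => ?_⟩
  rcases lt_or_ge x a with hxa | hxa
  · have h0 : 0 ≤ G x := hG.le_of_tendsto hG0 x
    exact ⟨.inl ((hG hxa.le).trans_lt ha), .inr ⟨a, by simp, hxa.le, by linarith⟩⟩
  rcases lt_or_ge b x with hxb | hxb
  · have h1 : G x ≤ 1 := hG.ge_of_tendsto hG1 x
    have hbx : G b ≤ G x := hG hxb.le
    exact ⟨.inr ⟨b, by simp, hxb.le, by linarith⟩, .inl (by linarith)⟩
  obtain ⟨y, hy, hcx, hxd⟩ := Set.mem_iUnion₂.1 (ht ⟨hxa, hxb⟩)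
  exact ⟨.inr ⟨c y, by simp; grind, hcx.le, (hG hxd.le).trans_lt (hcd y)⟩,
    .inr ⟨d y, by simp; grind, hxd.le, (hcd y).trans_le (by gcongr; exact hG hcx.le)⟩⟩

/-- Pólya's theorem. -/
theorem tendstoUniformly_of_monotone (hF : ∀ n, Monotone (F n)) (hF0 : ∀ n x, 0 ≤ F n x)
    (hF1 : ∀ n x, F n x ≤ 1) (hG : Monotone G) (hGc : Continuous G)
    (hG0 : Tendsto G atBot (𝓝 0)) (hG1 : Tendsto G atTop (𝓝 1))
    (h : ∀ x, Tendsto (fun n => F n x) atTop (𝓝 (G x))) : TendstoUniformly F G atTop := by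
  rw [Metric.tendstoUniformly_iff]
  intro ε hε
  obtain ⟨s, hs⟩ := exists_finset_forall_lt_add hG hGc hG0 hG1 (half_pos hε)
  have hclose : ∀ᶠ n in atTop, ∀ y ∈ s, |F n y - G y| < ε / 2 :=
    (eventually_all_finset s).2 fun y _ => Metric.tendsto_nhds.1 (h y) _ (half_pos hε)
  filter_upwards [hclose] with n hn x
  have hlower : G x - ε < F n x := by
    rcases (hs x).1 with hx | ⟨c, hc, hcx, hx⟩
    · linarith [hF0 n x]
    · linarith [(abs_lt.1 (hn c hc)).1, hF n hcx]
  have hupper : F n x < G x + ε := by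
    rcases (hs x).2 with hx | ⟨d, hd, hxd, hx⟩
    · linarith [hF1 n x]
    · linarith [(abs_lt.1 (hn d hd)).2, hF n hxd]
  rw [Real.dist_eq, abs_lt]
  constructor <;> linarith

end Polya

section NormalLimit

/-- The standard normal law, as a point of the space of probability measures. -/
noncomputable def stdNormal : ProbabilityMeasure ℝ := ⟨gaussianReal 0 1, inferInstance⟩

lemma cdf_gaussianReal_eq_Φ : ⇑(cdf (gaussianReal 0 1)) = Φ := by
  funext x
  rw [cdf_eq_real, measureReal_def, gaussianReal_apply_eq_integral _ one_ne_zero,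
    ENNReal.toReal_ofReal (setIntegral_nonneg measurableSet_Iic
      fun _ _ => gaussianPDFReal_nonneg _ _ _), Φ, ← integral_const_mul]
  simp [gaussianPDFReal]

lemma gaussianReal_real_Iio (x : ℝ) : (gaussianReal 0 1).real (Set.Iio x) = Φ x := by
  have := nullSingletonClass_gaussianReal (μ := 0) (v := 1) one_ne_zero
  rw [← cdf_gaussianReal_eq_Φ, cdf_eq_real, measureReal_congr Iio_ae_eq_Iic]

lemma continuous_Φ : Continuous Φ := by
  have hi : Integrable fun t : ℝ => Real.exp (-t ^ 2 / 2) := by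
    refine (integrable_exp_neg_mul_sq (b := 1 / 2) (by norm_num)).congr (ae_of_all _ fun t => ?_)
    ring_nf
  have hΦ : Φ = fun x => 1 / √(2 * Real.pi) *
      ((∫ t in Set.Iic 0, Real.exp (-t ^ 2 / 2)) + ∫ t in (0 : ℝ)..x, Real.exp (-t ^ 2 / 2)) := by
    funext x
    rw [Φ, ← intervalIntegral.integral_Iic_sub_Iic hi.integrableOn hi.integrableOn,
      add_sub_cancel]
  rw [hΦ]
  exact continuous_const.mul (continuous_const.add
    (intervalIntegral.continuous_primitive (fun _ _ => hi.intervalIntegrable) 0))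

lemma tendstoUniformly_real_Iio {P : ℕ → ProbabilityMeasure ℝ}
    (h : Tendsto P atTop (𝓝 stdNormal)) :
    TendstoUniformly (fun n x => (P n : Measure ℝ).real (Set.Iio x)) Φ atTop := by
  have := nullSingletonClass_gaussianReal (μ := 0) (v := 1) one_ne_zero
  refine tendstoUniformly_of_monotone
    (fun n x y hxy => measureReal_mono (Set.Iio_subset_Iio hxy))
    (fun _ _ => measureReal_nonneg) (fun _ _ => measureReal_le_one)
    (cdf_gaussianReal_eq_Φ ▸ monotone_cdf _) continuous_Φ
    (cdf_gaussianReal_eq_Φ ▸ tendsto_cdf_atBot _) (cdf_gaussianReal_eq_Φ ▸ tendsto_cdf_atTop _)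
    fun x => ?_
  have hx := ProbabilityMeasure.tendsto_measure_of_null_frontier_of_tendsto' h
    (E := Set.Iio x) (by simp [stdNormal])
  rw [← gaussianReal_real_Iio]
  exact (ENNReal.tendsto_toReal (measure_ne_top _ _)).comp hx

variable {Ω : Type*} [MeasurableSpace Ω] {P : ℕ → Measure Ω} [∀ n, IsProbabilityMeasure (P n)]
  {X : ℕ → Ω → ℝ} (hX : ∀ n, AEMeasurable (X n) (P n))
    (hP : ∀ n t, Integrable (fun ω => Real.exp (t * X n ω)) (P n))
    (h : ∀ t, Tendsto (fun n => mgf (X n) (P n) t) atTop (𝓝 (Real.exp (t ^ 2 / 2))))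
include hX hP h

lemma tendsto_map_stdNormal :
    Tendsto (β := ProbabilityMeasure ℝ)
      (fun n => ⟨(P n).map (X n), Measure.isProbabilityMeasure_map (hX n)⟩) atTop
      (𝓝 stdNormal) := by
  refine tendsto_of_tendsto_mgf (fun n t => ?_) (fun t => integrable_exp_mul_gaussianReal t)
    fun t => ?_
  · exact (integrable_map_measure (by fun_prop) (hX n)).2 (hP n t)
  · simpa [stdNormal, mgf_id_map (hX _), mgf_id_gaussianReal] using h t

lemma tendsto_integral_pow_of_tendsto_mgf (k : ℕ) :
    Tendsto (fun n => ∫ ω, X n ω ^ k ∂(P n)) atTop (𝓝 (∫ x, x ^ k ∂(gaussianReal 0 1))) := by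
  refine (tendsto_integral_pow_of_tendsto (fun n t => ?_) (tendsto_map_stdNormal hX hP h)
    (fun t => ?_) k).congr fun n =>
      integral_map (hX n) (continuous_pow k).aestronglyMeasurable
  · exact (integrable_map_measure (by fun_prop) (hX n)).2 (hP n t)
  · simpa [mgf_id_map (hX _)] using (h t).bddAbove_range

lemma tendsto_integral_of_tendsto_mgf :
    Tendsto (fun n => ∫ ω, X n ω ∂(P n)) atTop (𝓝 0) := by
  simpa using tendsto_integral_pow_of_tendsto_mgf hX hP h 1

lemma tendsto_variance_of_tendsto_mgf :
    Tendsto (fun n => variance (X n) (P n)) atTop (𝓝 1) := by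
  have hsq : ∫ x, x ^ 2 ∂(gaussianReal 0 1) = 1 := by
    have h := variance_id_gaussianReal (μ := 0) (v := 1)
    rwa [variance_of_integral_eq_zero aemeasurable_id (by simp)] at h
  have hlim := (tendsto_integral_pow_of_tendsto_mgf hX hP h 2).sub
    ((tendsto_integral_of_tendsto_mgf hX hP h).pow 2)
  rw [hsq, zero_pow two_ne_zero, sub_zero] at hlim
  refine hlim.congr fun n => ?_
  have hi : Integrable (fun ω => X n ω ^ 2) (P n) :=
    integrable_pow_of_integrable_exp_mul one_ne_zero (hP n 1) (hP n (-1)) 2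
  exact (variance_eq_sub ((memLp_two_iff_integrable_sq (hX n).aestronglyMeasurable).2 hi)).symm

lemma tendstoUniformly_Φ :
    TendstoUniformly (fun n x => (P n).real {ω | X n ω < x}) Φ atTop := by
  simpa [measureReal_def, Measure.map_apply_of_aemeasurable (hX _) measurableSet_Iio] using!
    tendstoUniformly_real_Iio (tendsto_map_stdNormal hX hP h)

end NormalLimit

section SaddlePoint

variable {α : ℝ} (hα : 0 < α)
include hα

lemma constA_pos : 0 < constA (1 / α) := by
  rw [← integral_rpow_mul_sigmoid_neg_rpow hα]
  have hpos : ∀ y : ℝ, 0 < y → 0 < y ^ α * Real.sigmoid (-(y ^ α)) := fun y hy =>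
    mul_pos (by positivity) (Real.sigmoid_pos _)
  refine setIntegral_Ioi_pos le_rfl ?_ (fun y hy => (hpos y hy).le) hpos
  have hbound := abs_pow_mul_le 1 abs_sigmoid_neg_le
  simp only [pow_one] at hbound
  exact integrableOn_comp_rpow (f := fun x => x * Real.sigmoid (-x)) hα one_half_pos
    (measurable_id.mul continuous_sigmoid_neg.measurable) hbound

lemma mu_constant_pos : 0 < -(1 / α) * polylog (1 / α) (-1) * Real.Gamma (1 / α) := by
  rw [← integral_sigmoid_neg_rpow hα]
  refine setIntegral_Ioi_pos le_rfl ?_ (fun y _ => Real.sigmoid_nonneg _)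
    fun y _ => Real.sigmoid_pos _
  refine integrableOn_comp_rpow (f := fun x => Real.sigmoid (-x)) (C := 1) hα one_pos
    continuous_sigmoid_neg.measurable fun x _ => ?_
  simpa using abs_sigmoid_neg_le x

lemma strictAntiOn_meanSize : StrictAntiOn (meanSize α) (Set.Ioi 0) := by
  intro x hx y hy hxy
  have hp : ∀ a, (0 : ℝ) < part α a := fun a => by exact_mod_cast one_le_part hα.le a
  have hlt : ∀ a, (part α a : ℝ) * Real.sigmoid (-(y * part α a))
      < part α a * Real.sigmoid (-(x * part α a)) := fun a =>
    mul_lt_mul_of_pos_left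
      (Real.sigmoid_lt (neg_lt_neg (mul_lt_mul_of_pos_right hxy (hp a)))) (hp a)
  exact Summable.tsum_lt_tsum (i := 0) (fun a => (hlt a).le) (hlt 0) (summable_meanSize hα hy)
    (summable_meanSize hα hx)

omit hα in
lemma norm_part_mul_sigmoid_neg_le {x y : ℝ} (hxy : x ≤ y) (a : ℕ) :
    ‖(part α a : ℝ) * Real.sigmoid (-(y * part α a))‖
      ≤ part α a * Real.sigmoid (-(x * part α a)) := by
  rw [Real.norm_of_nonneg (mul_nonneg (Nat.cast_nonneg _) (Real.sigmoid_nonneg _))]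
  gcongr

lemma continuousOn_meanSize : ContinuousOn (meanSize α) (Set.Ioi 0) := by
  intro x (hx : 0 < x)
  have hcont : ContinuousOn (meanSize α) (Set.Ioi (x / 2)) :=
    continuousOn_tsum (fun a => (continuous_const.mul
        (continuous_sigmoid_neg.comp (by fun_prop))).continuousOn)
      (summable_meanSize hα (half_pos hx)) fun a y hy => norm_part_mul_sigmoid_neg_le hy.le a
  exact (hcont.continuousAt (Ioi_mem_nhds (half_lt_self hx))).continuousWithinAt

lemma tendsto_meanSize_atTop : Tendsto (meanSize α) atTop (𝓝 0) := by
  have hterm : ∀ a, Tendsto (fun η : ℝ => (part α a : ℝ) * Real.sigmoid (-(η * part α a))) atTop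
      (𝓝 0) := fun a => by
    have hp : (0 : ℝ) < part α a := by exact_mod_cast one_le_part hα.le a
    simpa using (Real.tendsto_sigmoid_atBot.comp
      (tendsto_neg_atTop_atBot.comp (tendsto_id.atTop_mul_const hp))).const_mul (part α a : ℝ)
  have h := tendsto_tsum_of_dominated_convergence (summable_meanSize hα one_pos) hterm
    ((eventually_ge_atTop 1).mono fun η hη => norm_part_mul_sigmoid_neg_le hη)
  rwa [tsum_zero] at h

lemma tendsto_meanSize_nhdsGT_zero : Tendsto (meanSize α) (𝓝[>] 0) atTop := by
  refine (((tendsto_vol_atTop hα).atTop_mul_atTop₀ tendsto_inv_nhdsGT_zero).atTop_mul_pos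
    (constA_pos hα) (tendsto_meanSize hα)).congr' ?_
  filter_upwards [self_mem_nhdsWithin] with η (hη : 0 < η)
  calc vol α η * η⁻¹ * (η ^ (1 / α) * (η * meanSize α η))
      = η ^ (1 / α) * vol α η * (η⁻¹ * η) * meanSize α η := by ring
    _ = meanSize α η := by rw [rpow_mul_vol hη, inv_mul_cancel₀ hη.ne', one_mul, one_mul]

theorem existsUnique_isSaddlePoint {n : ℕ} (hn : 1 ≤ n) : ∃! η, IsSaddlePoint α n η := by
  simp only [isSaddlePoint_iff hα]
  have hivt := isPreconnected_Ioi.intermediate_value_Ioi (le_principal_iff.2 (Ioi_mem_atTop 0))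
    (le_principal_iff.2 self_mem_nhdsWithin) (continuousOn_meanSize hα)
    (tendsto_meanSize_atTop hα) (tendsto_meanSize_nhdsGT_zero hα)
  obtain ⟨η, hη, heq⟩ := hivt (Set.mem_Ioi.2 (Nat.cast_pos.2 hn : (0 : ℝ) < n))
  exact ⟨η, ⟨hη, heq⟩, fun z hz =>
    (strictAntiOn_meanSize hα).injOn hz.1 hη (hz.2.trans heq.symm)⟩

end SaddlePoint

/-- The order of magnitude `n ^ (1 / (α + 1))` of the mean and of the variance. -/
noncomputable def scale (α : ℝ) (n : ℕ) : ℝ :=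
  (n : ℝ) ^ (1 / (α + 1))

lemma scale_pos (α : ℝ) {n : ℕ} (hn : 1 ≤ n) : 0 < scale α n :=
  Real.rpow_pos_of_pos (Nat.cast_pos.2 hn) _

/-- The limit of `vol α η / scale α n` along the saddle points. -/
noncomputable def volConst (α : ℝ) : ℝ :=
  constA (1 / α) ^ (-(1 / α / (1 / α + 1)))

lemma volConst_pos {α : ℝ} (hα : 0 < α) : 0 < volConst α :=
  Real.rpow_pos_of_pos (constA_pos hα) _

lemma c₁_eq (α : ℝ) :
    c₁ (1 / α) = -(1 / α) * polylog (1 / α) (-1) * Real.Gamma (1 / α) * volConst α := rfl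

lemma c₂_eq {α : ℝ} (hα : 0 < α) (hα1 : α < 1) : c₂ (1 / α)
    = (limMoment α 0 - limMoment α 1 ^ 2 / limMoment α 2) * volConst α := by
  have h₀ : limMoment α 0 = -(1 / α) * polylog (1 / α - 1) (-1) * Real.Gamma (1 / α) := by
    rw [limMoment_eq hα hα1, Nat.cast_zero, add_zero]
    ring
  have h₁ : limMoment α 1 = -(1 / α * polylog (1 / α) (-1) * Real.Gamma (1 / α + 1)) := by
    rw [limMoment_eq hα hα1, Nat.cast_one, add_sub_cancel_right]
    ring
  have h₂ : limMoment α 2 = -(1 / α * polylog (1 / α + 1) (-1) * Real.Gamma (1 / α + 2)) := by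
    rw [limMoment_eq hα hα1, Nat.cast_ofNat, show 1 / α + 2 - 1 = 1 / α + 1 by ring]
    ring
  rw [c₂, volConst, h₀, h₁, h₂, neg_sq, div_neg, sub_neg_eq_add]

lemma tendsto_scale_atTop {α : ℝ} (hα : 0 < α) : Tendsto (scale α) atTop atTop :=
  (tendsto_rpow_atTop (by positivity)).comp tendsto_natCast_atTop_atTop

section SaddleSequence

variable {α : ℝ} {η : ℕ → ℝ} (hα : 0 < α) (hη : ∀ n : ℕ, 1 ≤ n → IsSaddlePoint α n (η n))
include hα hη

lemma tendsto_saddle : Tendsto η atTop (𝓝[>] 0) := by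
  refine tendsto_nhdsWithin_iff.2 ⟨Metric.tendsto_nhds.2 fun δ hδ => ?_,
    (eventually_ge_atTop 1).mono fun n hn => (hη n hn).1⟩
  filter_upwards [eventually_ge_atTop 1,
    tendsto_natCast_atTop_atTop.eventually_gt_atTop (meanSize α δ)] with n hn hnδ
  obtain ⟨hpos, hsize⟩ := (isSaddlePoint_iff hα n).1 (hη n hn)
  rw [Real.dist_eq, sub_zero, abs_of_pos hpos]
  rw [← hsize] at hnδ
  exact ((strictAntiOn_meanSize hα).lt_iff_gt hδ hpos).1 hnδ

lemma tendsto_vol_div_scale : Tendsto (fun n => vol α (η n) / scale α n) atTop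
    (𝓝 (volConst α)) := by
  refine (((tendsto_meanSize hα).comp (tendsto_saddle hα hη)).rpow_const
    (Or.inl (constA_pos hα).ne')).congr' ?_
  filter_upwards [eventually_ge_atTop 1] with n hn
  obtain ⟨hpos, hsize⟩ := (isSaddlePoint_iff hα n).1 (hη n hn)
  have hassoc : η n ^ (1 / α) * (η n * n) = η n ^ (1 / α + 1) * n := by
    rw [Real.rpow_add_one hpos.ne', mul_assoc]
  have hexp : (1 / α + 1) * -(1 / α / (1 / α + 1)) = -(1 / α) := by field_simp
  have hexp' : 1 / α / (1 / α + 1) = 1 / (α + 1) := by field_simp; ring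
  rw [Function.comp_apply, hsize, hassoc, Real.mul_rpow (by positivity) n.cast_nonneg,
    ← Real.rpow_mul hpos.le, hexp, hexp', Real.rpow_neg n.cast_nonneg, ← div_eq_mul_inv]
  rfl

lemma isEquivalent_of_tendsto_rpow_mul {f : ℝ → ℝ} {c : ℝ} (hc : c ≠ 0)
    (hf : Tendsto (fun η => η ^ (1 / α) * f η) (𝓝[>] 0) (𝓝 c)) :
    (fun n => f (η n)) ~[atTop] fun n => c * volConst α * scale α n := by
  have hne := mul_ne_zero hc (volConst_pos hα).ne'
  have hlim := ((hf.comp (tendsto_saddle hα hη)).mul (tendsto_vol_div_scale hα hη)).div_const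
    (c * volConst α)
  rw [div_self hne] at hlim
  refine (isEquivalent_iff_tendsto_one ?_).2 (hlim.congr' ?_)
  · filter_upwards [eventually_ge_atTop 1] with n hn using mul_ne_zero hne (scale_pos α hn).ne'
  · filter_upwards [eventually_ge_atTop 1] with n hn
    rw [Function.comp_apply, mul_div_assoc', mul_right_comm, rpow_mul_vol (hη n hn).1, one_mul,
      div_div, mul_comm (scale α n), Pi.div_apply]

lemma isTheta_of_tendsto_rpow_mul {f : ℝ → ℝ} {c : ℝ} (hc : c ≠ 0)
    (hf : Tendsto (fun η => η ^ (1 / α) * f η) (𝓝[>] 0) (𝓝 c)) :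
    (fun n => f (η n)) =Θ[atTop] scale α :=
  (isEquivalent_of_tendsto_rpow_mul hα hη hc hf).isTheta.trans <|
    (isTheta_refl _ _).const_mul_left
      (mul_ne_zero hc (volConst_pos hα).ne')

lemma isTheta_vol : (fun n => vol α (η n)) =Θ[atTop] scale α :=
  (isTheta_of_div_tendsto_nhds_ne_zero (tendsto_vol_div_scale hα hη) (volConst_pos hα).ne').symm

lemma isTheta_mu : (fun n => mu α (η n)) =Θ[atTop] scale α :=
  isTheta_of_tendsto_rpow_mul hα hη (mu_constant_pos hα).ne' (tendsto_mu hα)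

lemma isTheta_sigmaSq : (fun n => sigmaSq α (η n)) =Θ[atTop] scale α :=
  isTheta_of_tendsto_rpow_mul hα hη (limMoment_variance_pos hα).ne' (tendsto_sigmaSq hα)

lemma tendsto_sigmaSq_atTop : Tendsto (fun n => sigmaSq α (η n)) atTop atTop :=
  (isEquivalent_of_tendsto_rpow_mul hα hη (limMoment_variance_pos hα).ne'
      (tendsto_sigmaSq hα)).symm.tendsto_atTop <|
    (tendsto_scale_atTop hα).const_mul_atTop
      (mul_pos (limMoment_variance_pos hα) (volConst_pos hα))

lemma exists_vol_sigmaSq_bounds : ∃ K : ℝ, 1 ≤ K ∧ ∀ᶠ n in atTop,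
    vol α (η n) ≤ K * scale α n ∧ scale α n ≤ K * vol α (η n) ∧
      scale α n ≤ K * sigmaSq α (η n) := by
  obtain ⟨K, hK, h₁, h₂, h₃⟩ := ((eventually_ge_atTop 1).and <|
    (isBigO_iff_eventually.1 (isTheta_vol hα hη).1).and <|
    (isBigO_iff_eventually.1 (isTheta_vol hα hη).2).and <|
    isBigO_iff_eventually.1 (isTheta_sigmaSq hα hη).2).exists
  refine ⟨K, hK, ?_⟩
  filter_upwards [h₁, h₂, h₃, eventually_ge_atTop 1,
    (tendsto_sigmaSq_atTop hα hη).eventually_ge_atTop 0] with n h₁ h₂ h₃ hn hσ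
  rw [Real.norm_of_nonneg (scale_pos α hn).le] at h₁ h₂ h₃
  rw [Real.norm_of_nonneg (vol_pos (hη n hn).1).le] at h₁ h₂
  rw [Real.norm_of_nonneg hσ] at h₃
  exact ⟨h₁, h₂, h₃⟩

end SaddleSequence

section Comparable

variable {K V W : ℝ} (hK : 1 ≤ K) (hW : 0 < W)
include hK hW

lemma rpow_le_mul_rpow (hV : 0 ≤ V) (hVW : V ≤ K * W) {p : ℝ} (hp : 0 ≤ p) (hp1 : p ≤ 1) :
    V ^ p ≤ K * W ^ p := by
  have hK0 : 0 ≤ K := zero_le_one.trans hK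
  calc V ^ p ≤ (K * W) ^ p := Real.rpow_le_rpow hV hVW hp
    _ = K ^ p * W ^ p := Real.mul_rpow hK0 hW.le
    _ ≤ K * W ^ p := by
        gcongr
        simpa using Real.rpow_le_rpow_of_exponent_le hK hp1

lemma rpow_neg_le_mul_rpow_neg (hV : 0 < V) (hWV : W ≤ K * V) {p : ℝ} (hp : 0 ≤ p) (hp1 : p ≤ 1) :
    V ^ (-p) ≤ K * W ^ (-p) := by
  have h := rpow_le_mul_rpow hK hV hW.le hWV hp hp1
  rw [Real.rpow_neg hV.le, Real.rpow_neg hW.le, ← div_eq_mul_inv, inv_eq_one_div,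
    div_le_div_iff₀ (by positivity) (by positivity)]
  linarith

variable {S : ℝ} (hS : 0 < S) (hWS : W ≤ K * S)
include hS hWS

lemma abs_div_sqrt_le (t : ℝ) : |t / √S| ≤ K * |t| * W ^ (-(1 / 2) : ℝ) := by
  have h := rpow_neg_le_mul_rpow_neg hK hW hS hWS one_half_pos.le (by norm_num)
  rw [Real.rpow_neg hS.le, ← Real.sqrt_eq_rpow] at h
  rw [abs_div, abs_of_nonneg (Real.sqrt_nonneg _), div_eq_mul_inv, mul_comm K, mul_assoc]
  exact mul_le_mul_of_nonneg_left h (abs_nonneg _)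

variable (hV : 0 < V) (hVW : V ≤ K * W)
include hV hVW

lemma abs_div_sqrt_mul_rpow_le_one {t : ℝ} (ht : K ^ 2 * |t| ≤ W ^ (3 / 16 : ℝ)) :
    |t / √S| * V ^ (5 / 16 : ℝ) ≤ 1 := by
  calc |t / √S| * V ^ (5 / 16 : ℝ)
      ≤ K * |t| * W ^ (-(1 / 2) : ℝ) * (K * W ^ (5 / 16 : ℝ)) :=
        mul_le_mul (abs_div_sqrt_le hK hW hS hWS t)
          (rpow_le_mul_rpow hK hW hV.le hVW (by norm_num) (by norm_num))
          (by positivity) (by positivity)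
    _ = K ^ 2 * |t| * (W ^ (-(1 / 2) : ℝ) * W ^ (5 / 16 : ℝ)) := by ring
    _ ≤ W ^ (3 / 16 : ℝ) * (W ^ (-(1 / 2) : ℝ) * W ^ (5 / 16 : ℝ)) := by gcongr
    _ = 1 := by rw [← Real.rpow_add hW, ← Real.rpow_add hW]; norm_num

lemma abs_div_sqrt_pow_three_mul_le (t : ℝ) :
    |t / √S| ^ 3 * V ≤ K ^ 4 * (|t| ^ 3 * W ^ (-(1 / 2) : ℝ)) := by
  calc |t / √S| ^ 3 * V ≤ (K * |t| * W ^ (-(1 / 2) : ℝ)) ^ 3 * (K * W) := by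
        gcongr
        exact abs_div_sqrt_le hK hW hS hWS t
    _ = K ^ 4 * (|t| ^ 3 * ((W ^ (-(1 / 2) : ℝ)) ^ 3 * W)) := by ring
    _ = K ^ 4 * (|t| ^ 3 * W ^ (-(1 / 2) : ℝ)) := by
        rw [← Real.rpow_mul_natCast hW.le, ← Real.rpow_add_one hW.ne']
        norm_num

end Comparable

/-- The normalised number of summands `(ϖ - μ) / σ`. -/
noncomputable def normalized (α η : ℝ) (S : Finset ℕ) : ℝ :=
  (numSummands S - mu α η) / √(sigmaSq α η)

lemma mgf_normalized (α η : ℝ) (n : ℕ) (t : ℝ) :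
    mgf (normalized α η) (unif α n) t
      = Real.exp (-(t / √(sigmaSq α η) * mu α η))
        * mgf numSummands (unif α n) (t / √(sigmaSq α η)) := by
  rw [mgf, mgf, ← integral_const_mul]
  refine integral_congr_ae (Eventually.of_forall fun S => ?_)
  simp only [normalized, ← Real.exp_add]
  ring_nf

section Normalized

variable {α η : ℝ} (hα : 0 < α) {n : ℕ}
include hα

lemma integrable_unif (n : ℕ) (f : Finset ℕ → ℝ) : Integrable f (unif α n) :=
  integrable_uniformOn (partitions_finite hα n) f

lemma mgf_unif_pos (hα1 : α ≤ 1) (hn : 1 ≤ n) (X : Finset ℕ → ℝ) (t : ℝ) :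
    0 < mgf X (unif α n) t := by
  have := isProbabilityMeasure_unif hα hα1 hn
  exact mgf_pos (integrable_unif hα n _)

lemma log_mgf_normalized (hα1 : α ≤ 1) (hσ : 0 < sigmaSq α η) (hn : 1 ≤ n) (t : ℝ) :
    Real.log (mgf (normalized α η) (unif α n) t) - t ^ 2 / 2
      = Real.log (mgf numSummands (unif α n) (t / √(sigmaSq α η)))
        - (t / √(sigmaSq α η) * mu α η + (t / √(sigmaSq α η)) ^ 2 * sigmaSq α η / 2) := by
  rw [mgf_normalized, Real.log_mul (Real.exp_pos _).ne' (mgf_unif_pos hα hα1 hn _ _).ne',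
    Real.log_exp, div_pow, Real.sq_sqrt hσ.le]
  field_simp
  ring

lemma integral_normalized (hα1 : α ≤ 1) (hσ : 0 < sigmaSq α η) (hn : 1 ≤ n) :
    ∫ S, numSummands S ∂(unif α n)
      = mu α η + √(sigmaSq α η) * ∫ S, normalized α η S ∂(unif α n) := by
  have := isProbabilityMeasure_unif hα hα1 hn
  have hσ0 := (Real.sqrt_pos.2 hσ).ne'
  simp only [normalized]
  rw [integral_div, mul_div_cancel₀ _ hσ0, integral_sub (integrable_unif hα n _)
    (integrable_const _), integral_const, probReal_univ, one_smul, add_sub_cancel]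

lemma variance_normalized (hα1 : α ≤ 1) (hσ : 0 < sigmaSq α η) (hn : 1 ≤ n) :
    variance numSummands (unif α n) = sigmaSq α η * variance (normalized α η) (unif α n) := by
  have := isProbabilityMeasure_unif hα hα1 hn
  have hσ0 := (Real.sqrt_pos.2 hσ).ne'
  have heq : numSummands = fun S => √(sigmaSq α η) * normalized α η S + mu α η := by
    funext S
    rw [normalized, mul_div_cancel₀ _ hσ0, sub_add_cancel]
  conv_lhs => rw [heq]
  rw [variance_add_const (integrable_unif hα n _).1, variance_const_mul, Real.sq_sqrt hσ.le]

end Normalized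

section NormalizedSequence

variable {α : ℝ} {η : ℕ → ℝ} (hα : 0 < α)
include hα

lemma eventually_log_pow_three_le :
    ∀ᶠ n : ℕ in atTop, Real.log n ^ 3 ≤ scale α n ^ (1 / 4 : ℝ) := by
  have hlittle := (isLittleO_log_rpow_rpow_atTop 3
    (show 0 < 1 / (α + 1) * (1 / 4) by positivity)).comp_tendsto tendsto_natCast_atTop_atTop
  filter_upwards [hlittle.def one_pos] with n hn
  have hlog := Real.log_natCast_nonneg n
  rw [Function.comp_apply, Function.comp_apply, one_mul, Real.norm_of_nonneg (by positivity),
    Real.norm_of_nonneg (by positivity)] at hn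
  rw [scale, ← Real.rpow_mul n.cast_nonneg]
  exact_mod_cast hn

lemma natCast_rpow_eq_scale_rpow (n : ℕ) :
    (n : ℝ) ^ (1 / (6 * α + 6)) = scale α n ^ (1 / 6 : ℝ) := by
  rw [scale, ← Real.rpow_mul n.cast_nonneg]
  congr 1
  field_simp

variable (hα1 : α ≤ 1) (hη : ∀ n : ℕ, 1 ≤ n → IsSaddlePoint α n (η n))
include hα1 hη

theorem exists_log_mgf_normalized_bound : ∃ A : ℝ, 0 < A ∧ ∀ᶠ n in atTop, ∀ t : ℝ,
    A * |t| ≤ scale α n ^ (3 / 16 : ℝ) →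
      |Real.log (mgf (normalized α (η n)) (unif α n) t) - t ^ 2 / 2|
        ≤ A * (|t| ^ 3 * scale α n ^ (-(1 / 2) : ℝ) + scale α n ^ (-(1 / 4) : ℝ)) := by
  obtain ⟨A, hA0, hA⟩ := exists_log_mgf_bound hα hα1
  obtain ⟨K, hK, hbounds⟩ := exists_vol_sigmaSq_bounds hα hη
  have hK4 : K ≤ K ^ 4 := le_self_pow₀ hK (by norm_num)
  have hAK : 0 ≤ A * K ^ 4 := by positivity
  refine ⟨K ^ 2 + A * K ^ 4, by positivity, ?_⟩
  filter_upwards [(tendsto_saddle hα hη).eventually hA, hbounds,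
    (tendsto_sigmaSq_atTop hα hη).eventually_gt_atTop 0, eventually_ge_atTop 1]
    with n hAn ⟨hVW, hWV, hWS⟩ hS hn t ht
  obtain ⟨hpos, hsize⟩ := (isSaddlePoint_iff hα n).1 (hη n hn)
  have hW := scale_pos α hn
  have hV := vol_pos (α := α) hpos
  have hrange : K ^ 2 * |t| ≤ scale α n ^ (3 / 16 : ℝ) :=
    (mul_le_mul_of_nonneg_right (le_add_of_nonneg_right hAK) (abs_nonneg t)).trans ht
  rw [log_mgf_normalized hα hα1 hS hn]
  have hcubic := abs_div_sqrt_pow_three_mul_le hK hW hS hWS hV hVW t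
  have hconst : vol α (η n) ^ (-(1 / 4) : ℝ) ≤ K ^ 4 * scale α n ^ (-(1 / 4) : ℝ) :=
    (rpow_neg_le_mul_rpow_neg hK hW hV hWV (p := 1 / 4) (by norm_num) (by norm_num)).trans
      (mul_le_mul_of_nonneg_right hK4 (by positivity))
  refine (hAn n hn hsize _ (abs_div_sqrt_mul_rpow_le_one hK hW hS hWS hV hVW hrange)).trans ?_
  calc A * (|t / √(sigmaSq α (η n))| ^ 3 * vol α (η n) + vol α (η n) ^ (-(1 / 4) : ℝ))
      ≤ A * (K ^ 4 * (|t| ^ 3 * scale α n ^ (-(1 / 2) : ℝ))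
          + K ^ 4 * scale α n ^ (-(1 / 4) : ℝ)) :=
        mul_le_mul_of_nonneg_left (add_le_add hcubic hconst) hA0
    _ = A * K ^ 4 * (|t| ^ 3 * scale α n ^ (-(1 / 2) : ℝ) + scale α n ^ (-(1 / 4) : ℝ)) := by ring
    _ ≤ _ := by
        gcongr
        exact le_add_of_nonneg_left (sq_nonneg K)

theorem tendsto_mgf_normalized (t : ℝ) :
    Tendsto (fun n => mgf (normalized α (η n)) (unif α n) t) atTop
      (𝓝 (Real.exp (t ^ 2 / 2))) := by
  obtain ⟨A, -, hA⟩ := exists_log_mgf_normalized_bound hα hα1 hη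
  have hW := tendsto_scale_atTop hα
  have hsmall : Tendsto (fun n => A * (|t| ^ 3 * scale α n ^ (-(1 / 2) : ℝ)
      + scale α n ^ (-(1 / 4) : ℝ))) atTop (𝓝 0) := by
    have h₁ := (tendsto_rpow_neg_atTop (y := 1 / 2) (by norm_num)).comp hW
    have h₂ := (tendsto_rpow_neg_atTop (y := 1 / 4) (by norm_num)).comp hW
    simpa using ((h₁.const_mul (|t| ^ 3)).add h₂).const_mul A
  have hlog : Tendsto (fun n => Real.log (mgf (normalized α (η n)) (unif α n) t)) atTop
      (𝓝 (t ^ 2 / 2)) := by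
    refine tendsto_iff_norm_sub_tendsto_zero.2
      (squeeze_zero' (Eventually.of_forall fun _ => norm_nonneg _) ?_ hsmall)
    filter_upwards [hA, ((tendsto_rpow_atTop (y := 3 / 16) (by norm_num)).comp
      hW).eventually_ge_atTop (A * |t|)] with n hn ht using hn t ht
  refine ((Real.continuous_exp.tendsto _).comp hlog).congr' ?_
  filter_upwards [eventually_ge_atTop 1] with n hn
  exact Real.exp_log (mgf_unif_pos hα hα1 hn _ t)

lemma exists_log_mgf_normalized_le : ∃ A : ℝ, 0 < A ∧ ∀ᶠ n : ℕ in atTop, ∀ t : ℝ,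
    |t| ≤ (n : ℝ) ^ (1 / (6 * α + 6)) / Real.log n →
      Real.log (mgf (normalized α (η n)) (unif α n) t) ≤ t ^ 2 / 2 + A / Real.log n ^ 3 := by
  obtain ⟨A, hA0, hA⟩ := exists_log_mgf_normalized_bound hα hα1 hη
  refine ⟨A * 2, by positivity, ?_⟩
  filter_upwards [hA, eventually_log_pow_three_le hα,
    (Real.tendsto_log_atTop.comp tendsto_natCast_atTop_atTop).eventually_ge_atTop 1,
    ((tendsto_rpow_atTop (y := 1 / 48) (by norm_num)).comp
      (tendsto_scale_atTop hα)).eventually_ge_atTop A, eventually_ge_atTop 1]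
    with n hbound hlog3 (hlog : 1 ≤ Real.log n) (hWA : A ≤ scale α n ^ (1 / 48 : ℝ)) hn t ht
  rw [natCast_rpow_eq_scale_rpow hα] at ht
  have hW := scale_pos α hn
  have : 0 < Real.log n := one_pos.trans_le hlog
  have hrange : A * |t| ≤ scale α n ^ (3 / 16 : ℝ) := by
    calc A * |t| ≤ scale α n ^ (1 / 48 : ℝ) * scale α n ^ (1 / 6 : ℝ) := by
          gcongr
          exact ht.trans (div_le_self (by positivity) hlog)
      _ = scale α n ^ (3 / 16 : ℝ) := by rw [← Real.rpow_add hW]; norm_num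
  have hcubic : |t| ^ 3 * scale α n ^ (-(1 / 2) : ℝ) ≤ 1 / Real.log n ^ 3 := by
    calc |t| ^ 3 * scale α n ^ (-(1 / 2) : ℝ)
        ≤ (scale α n ^ (1 / 6 : ℝ) / Real.log n) ^ 3 * scale α n ^ (-(1 / 2) : ℝ) := by gcongr
      _ = (scale α n ^ (1 / 6 : ℝ)) ^ 3 * scale α n ^ (-(1 / 2) : ℝ) / Real.log n ^ 3 := by ring
      _ = 1 / Real.log n ^ 3 := by
          rw [← Real.rpow_mul_natCast hW.le, ← Real.rpow_add hW]
          norm_num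
  have hconst : scale α n ^ (-(1 / 4) : ℝ) ≤ 1 / Real.log n ^ 3 := by
    rw [Real.rpow_neg hW.le, ← one_div]
    exact one_div_le_one_div_of_le (by positivity) hlog3
  refine sub_le_iff_le_add'.1 ((le_abs_self _).trans ((hbound t hrange).trans ?_))
  calc A * (|t| ^ 3 * scale α n ^ (-(1 / 2) : ℝ) + scale α n ^ (-(1 / 4) : ℝ))
      ≤ A * (1 / Real.log n ^ 3 + 1 / Real.log n ^ 3) := by gcongr
    _ = A * 2 / Real.log n ^ 3 := by ring

theorem exists_mgf_normalized_le : ∃ C : ℝ, ∀ᶠ n : ℕ in atTop, ∀ t : ℝ,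
    |t| ≤ (n : ℝ) ^ (1 / (6 * α + 6)) / Real.log n →
      mgf (normalized α (η n)) (unif α n) t
        ≤ Real.exp (t ^ 2 / 2) * (1 + C / Real.log n ^ 3) := by
  obtain ⟨A, hA0, hA⟩ := exists_log_mgf_normalized_le hα hα1 hη
  have hlog := Real.tendsto_log_atTop.comp tendsto_natCast_atTop_atTop
  refine ⟨2 * A, ?_⟩
  filter_upwards [hA, ((tendsto_pow_atTop three_ne_zero).comp hlog).eventually_ge_atTop A,
    hlog.eventually_gt_atTop 0, eventually_ge_atTop 1]
    with n hbound (hL3 : A ≤ Real.log n ^ 3) (hL : 0 < Real.log n) hn t ht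
  have hexp : Real.exp (A / Real.log n ^ 3) ≤ 1 + 2 * A / Real.log n ^ 3 := by
    have hy : |A / Real.log n ^ 3| = A / Real.log n ^ 3 := abs_of_pos (by positivity)
    have h := Real.abs_exp_sub_one_le (hy.trans_le ((div_le_one (by positivity)).2 hL3))
    rw [hy, ← mul_div_assoc] at h
    linarith [le_abs_self (Real.exp (A / Real.log n ^ 3) - 1)]
  calc mgf (normalized α (η n)) (unif α n) t
      = Real.exp (Real.log (mgf (normalized α (η n)) (unif α n) t)) :=
        (Real.exp_log (mgf_unif_pos hα hα1 hn _ t)).symm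
    _ ≤ Real.exp (t ^ 2 / 2 + A / Real.log n ^ 3) := Real.exp_le_exp.2 (hbound t ht)
    _ = Real.exp (t ^ 2 / 2) * Real.exp (A / Real.log n ^ 3) := Real.exp_add _ _
    _ ≤ Real.exp (t ^ 2 / 2) * (1 + 2 * A / Real.log n ^ 3) := by gcongr

end NormalizedSequence

section Limits

variable {α : ℝ} {η : ℕ → ℝ} (hα : 0 < α) (hα1 : α ≤ 1)
  (hη : ∀ n : ℕ, 1 ≤ n → IsSaddlePoint α n (η n))
include hα hα1 hη

lemma tendsto_mgf_normalized_succ (t : ℝ) :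
    Tendsto (fun n => mgf (normalized α (η (n + 1))) (unif α (n + 1)) t) atTop
      (𝓝 (Real.exp (t ^ 2 / 2))) :=
  (tendsto_add_atTop_iff_nat 1).2 (tendsto_mgf_normalized hα hα1 hη t)

lemma tendsto_integral_normalized :
    Tendsto (fun n => ∫ S, normalized α (η n) S ∂(unif α n)) atTop (𝓝 0) := by
  have := fun n : ℕ => isProbabilityMeasure_unif hα hα1 n.succ_pos
  exact (tendsto_add_atTop_iff_nat 1).1 <|
    tendsto_integral_of_tendsto_mgf (fun _ => (integrable_unif hα _ _).aemeasurable)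
      (fun _ _ => integrable_unif hα _ _) (tendsto_mgf_normalized_succ hα hα1 hη)

lemma tendsto_variance_normalized :
    Tendsto (fun n => variance (normalized α (η n)) (unif α n)) atTop (𝓝 1) := by
  have := fun n : ℕ => isProbabilityMeasure_unif hα hα1 n.succ_pos
  exact (tendsto_add_atTop_iff_nat 1).1 <|
    tendsto_variance_of_tendsto_mgf (fun _ => (integrable_unif hα _ _).aemeasurable)
      (fun _ _ => integrable_unif hα _ _) (tendsto_mgf_normalized_succ hα hα1 hη)

theorem tendstoUniformly_normalized :
    TendstoUniformly (fun (n : ℕ) (x : ℝ) => (unif α n).real {S | normalized α (η n) S < x})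
      Φ atTop := by
  have := fun n : ℕ => isProbabilityMeasure_unif hα hα1 n.succ_pos
  have h := tendstoUniformly_Φ (fun _ => (integrable_unif hα _ _).aemeasurable)
    (fun _ _ => integrable_unif hα _ _) (tendsto_mgf_normalized_succ hα hα1 hη)
  intro u hu
  rw [← map_add_atTop_eq_nat 1, eventually_map]
  exact h u hu

omit hα1 in
lemma isBigO_sqrt_sigmaSq_mu :
    (fun n => √(sigmaSq α (η n))) =O[atTop] fun n => mu α (η n) := by
  refine IsBigO.trans (IsBigO.of_norm_eventuallyLE ?_)
    ((isTheta_sigmaSq hα hη).trans (isTheta_mu hα hη).symm).1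
  filter_upwards [(tendsto_sigmaSq_atTop hα hη).eventually_ge_atTop 1] with n hn
  rw [Real.norm_of_nonneg (Real.sqrt_nonneg _)]
  exact Real.sqrt_le_self_iff.2 (Or.inr hn)

theorem integral_numSummands_isEquivalent :
    (fun n => ∫ S, numSummands S ∂(unif α n)) ~[atTop] fun n => mu α (η n) := by
  have hsmall := (isBigO_sqrt_sigmaSq_mu hα hη).mul_isLittleO
    ((isLittleO_one_iff ℝ).2 (tendsto_integral_normalized hα hα1 hη))
  simp only [mul_one] at hsmall
  refine hsmall.congr' ?_ EventuallyEq.rfl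
  filter_upwards [(tendsto_sigmaSq_atTop hα hη).eventually_gt_atTop 0, eventually_ge_atTop 1]
    with n hσ hn
  rw [Pi.sub_apply, integral_normalized hα hα1 hσ hn, add_sub_cancel_left]

theorem variance_numSummands_isEquivalent :
    (fun n => variance numSummands (unif α n)) ~[atTop] fun n => sigmaSq α (η n) := by
  have hpos := (tendsto_sigmaSq_atTop hα hη).eventually_gt_atTop 0
  refine (isEquivalent_iff_tendsto_one (hpos.mono fun n hσ => hσ.ne')).2
    ((tendsto_variance_normalized hα hα1 hη).congr' ?_)
  filter_upwards [hpos, eventually_ge_atTop 1] with n hσ hn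
  rw [Pi.div_apply, variance_normalized hα hα1 hσ hn, mul_div_cancel_left₀ _ hσ.ne']

end Limits

section Chernoff

variable {Ω : Type*} [MeasurableSpace Ω] {P : Measure Ω} [IsFiniteMeasure P] {X : Ω → ℝ}
  {T x e B : ℝ} (hT : 0 ≤ T) (he : T ^ 2 / 2 - T * x ≤ e)
include hT he

lemma measureReal_ge_le_exp_mul (hint : Integrable (fun ω => Real.exp (T * X ω)) P)
    (hmgf : mgf X P T ≤ Real.exp (T ^ 2 / 2) * B) :
    P.real {ω | x ≤ X ω} ≤ Real.exp e * B := by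
  have hB : 0 ≤ B := nonneg_of_mul_nonneg_right (mgf_nonneg.trans hmgf) (Real.exp_pos _)
  calc P.real {ω | x ≤ X ω} ≤ Real.exp (-T * x) * mgf X P T := measure_ge_le_exp_mul_mgf x hT hint
    _ ≤ Real.exp (-T * x) * (Real.exp (T ^ 2 / 2) * B) := by gcongr
    _ = Real.exp (T ^ 2 / 2 - T * x) * B := by rw [← mul_assoc, ← Real.exp_add]; ring_nf
    _ ≤ Real.exp e * B := by gcongr

lemma measureReal_le_neg_le_exp_mul (hint : Integrable (fun ω => Real.exp (-T * X ω)) P)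
    (hmgf : mgf X P (-T) ≤ Real.exp (T ^ 2 / 2) * B) :
    P.real {ω | X ω ≤ -x} ≤ Real.exp e * B := by
  simp only [le_neg (b := x)]
  refine measureReal_ge_le_exp_mul (X := -X) hT he ?_ (mgf_neg.trans_le hmgf)
  simpa only [Pi.neg_apply, mul_neg, neg_mul] using hint

end Chernoff

lemma tail_le {α η : ℝ} (hα : 0 < α) (hα1 : α ≤ 1) {n : ℕ} (hn : 1 ≤ n) {T x e B : ℝ}
    (hT : 0 ≤ T)
    (hmgf : ∀ t, |t| ≤ T → mgf (normalized α η) (unif α n) t ≤ Real.exp (t ^ 2 / 2) * B)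
    (he : T ^ 2 / 2 - T * x ≤ e) :
    (unif α n).real {S | normalized α η S ≥ x} ≤ Real.exp e * B ∧
      (unif α n).real {S | normalized α η S ≤ -x} ≤ Real.exp e * B := by
  have := isProbabilityMeasure_unif hα hα1 hn
  have habs : |-T| ≤ T := by rw [abs_neg, abs_of_nonneg hT]
  exact ⟨measureReal_ge_le_exp_mul hT he (integrable_unif hα n _)
      (hmgf T (abs_of_nonneg hT).le),
    measureReal_le_neg_le_exp_mul hT he (integrable_unif hα n _)
      (neg_sq T ▸ hmgf (-T) habs)⟩

end AlphaPartition

open AlphaPartition in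
theorem theorem1 (α : ℝ) (hα0 : 0 < α) (hα1 : α < 1) :
    -- the saddle point exists and is unique
    (∀ n : ℕ, 1 ≤ n → ∃! η : ℝ, IsSaddlePoint α n η) ∧
    ∀ η : ℕ → ℝ, (∀ n : ℕ, 1 ≤ n → IsSaddlePoint α n (η n)) →
      -- mean and variance of the number of summands
      (fun n : ℕ => ∫ S, numSummands S ∂(unif α n)) ~[atTop] (fun n => mu α (η n)) ∧
      (fun n : ℕ => variance numSummands (unif α n)) ~[atTop] (fun n => sigmaSq α (η n)) ∧
      -- central limit theorem, uniformly in `x`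
      TendstoUniformly
        (fun (n : ℕ) (x : ℝ) =>
          (unif α n).real {S | (numSummands S - mu α (η n)) / √(sigmaSq α (η n)) < x})
        Φ atTop ∧
      -- asymptotics of `μ_n` and `σ_n²`
      (fun n : ℕ => mu α (η n)) ~[atTop]
        (fun n => c₁ (1 / α) * (n : ℝ) ^ (1 / (α + 1))) ∧
      (fun n : ℕ => sigmaSq α (η n)) ~[atTop]
        (fun n => c₂ (1 / α) * (n : ℝ) ^ (1 / (α + 1))) ∧
      -- upper and lower tails
      ∃ C : ℝ, ∃ N : ℕ, ∀ n : ℕ, N ≤ n → ∀ x : ℝ,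
        (0 ≤ x → x ≤ (n : ℝ) ^ (1 / (6 * α + 6)) / Real.log n →
          (unif α n).real {S | (numSummands S - mu α (η n)) / √(sigmaSq α (η n)) ≥ x}
              ≤ Real.exp (-x ^ 2 / 2) * (1 + C / Real.log n ^ 3) ∧
          (unif α n).real {S | (numSummands S - mu α (η n)) / √(sigmaSq α (η n)) ≤ -x}
              ≤ Real.exp (-x ^ 2 / 2) * (1 + C / Real.log n ^ 3)) ∧
        ((n : ℝ) ^ (1 / (6 * α + 6)) / Real.log n ≤ x →
          (unif α n).real {S | (numSummands S - mu α (η n)) / √(sigmaSq α (η n)) ≥ x}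
              ≤ Real.exp (-((n : ℝ) ^ (1 / (6 * α + 6)) / Real.log n) * x / 2)
                  * (1 + C / Real.log n ^ 3) ∧
          (unif α n).real {S | (numSummands S - mu α (η n)) / √(sigmaSq α (η n)) ≤ -x}
              ≤ Real.exp (-((n : ℝ) ^ (1 / (6 * α + 6)) / Real.log n) * x / 2)
                  * (1 + C / Real.log n ^ 3)) := by
  refine ⟨fun n hn => existsUnique_isSaddlePoint hα0 hn, fun η hη =>
    ⟨integral_numSummands_isEquivalent hα0 hα1.le hη,
      variance_numSummands_isEquivalent hα0 hα1.le hη,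
      tendstoUniformly_normalized hα0 hα1.le hη, ?_, ?_, ?_⟩⟩
  · rw [c₁_eq]
    exact isEquivalent_of_tendsto_rpow_mul hα0 hη (mu_constant_pos hα0).ne' (tendsto_mu hα0)
  · rw [c₂_eq hα0 hα1]
    exact isEquivalent_of_tendsto_rpow_mul hα0 hη (limMoment_variance_pos hα0).ne'
      (tendsto_sigmaSq hα0)
  · obtain ⟨C, hC⟩ := exists_mgf_normalized_le hα0 hα1.le hη
    obtain ⟨N, hN⟩ := eventually_atTop.1 (hC.and (eventually_ge_atTop 1))
    refine ⟨C, N, fun n hNn x => ?_⟩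
    obtain ⟨hmgf, hn⟩ := hN n hNn
    have hT : 0 ≤ (n : ℝ) ^ (1 / (6 * α + 6)) / Real.log n :=
      div_nonneg (by positivity) (Real.log_natCast_nonneg n)
    exact ⟨fun hx hxT => tail_le hα0 hα1.le hn hx (fun t ht => hmgf t (ht.trans hxT)) (by linarith),
      fun hTx => tail_le hα0 hα1.le hn hT hmgf (by nlinarith)⟩
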